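/- **Setting.** Let $\omega\subset\mathbb R^2$ be a bounded open set, $Y=[0,1]^2$, and let $\theta\in C^2(\mathbb R^2)$ be $Y$-periodic; put $\theta_0=\theta-\int_Y\theta\,dy$. For $h>0$ let $\Omega^h=\omega\times(-\frac{h^2}{2},\frac{h^2}{2})$, $\Omega=\Omega^1$, $P^h(x',x_3)=(x',h^2x_3)$, $$\Theta^h(x',x_3)=\big(x',h^2\theta(\tfrac{x'}{h})\big)+x_3\,\mathbf n^h(x'),\qquad \mathbf n^h(x')=\frac{\big(-h\partial_1\theta(\frac{x'}h),-h\partial_2\theta(\frac{x'}h),1\big)}{\sqrt{1+h^2\partial_1\theta(\frac{x'}h)^2+h^2\partial_2\theta(\frac{x'}h)^2}},\qquad \hat\Omega^h=\Theta^h(\Omega^h).$$ Let $W:\mathbb R^{3\times3}\to[0,\infty]$ be Borel measurable, of class $C^2$ in a neighbourhood of $SO(3)$, with $W(\mathbf R\mathbf F)=W(\mathbf F)$ for $\mathbf R\in SO(3)$, $W=0$ on $SO(3)$, and $W(\mathbf F)\ge C_W\,\mathrm{dist}^2(\mathbf F,SO(3))$ for some $C_W>0$. Put $Q_3(\mathbf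 F)=D^2W(\mathbf I)(\mathbf F,\mathbf F)$ and, for $\mathbf G\in\mathbb R^{2\times2}$, $Q_2(\mathbf G)=\min_{\mathbf a\in\mathbb R^3}Q_3(\mathbf G+\mathbf a\otimes\mathbf e_3+\mathbf e_3\otimes\mathbf a)$. Let $$I^h(\mathbf y)=\frac1{h^8}\,\frac1{h^2}\int_{\hat\Omega^h}W(\nabla\mathbf y)\,dx .$$ A sequence $f^h\in L^2(\omega)$ two-scale converges to $f\in L^2(\omega\times Y)$ if $\int_\omega f^h(x)\psi(x,\frac xh)\,dx\to\int_\omega\int_Y f\psi\,dy\,dx$ for all $\psi\in L^2(\omega;C_\#(Y))$, where $C_\#(Y)$ is the space of continuous $Y$-periodic functions. $\dot H^m_\#(Y)$ is the space of $Y$-periodic $H^m$ functions with mean zero over $Y$. **Hypotheses.** Let $h$ run through a sequence of positive numbers tending to $0$. Let $\mathbf y^h\in W^{1,2}(\hat\Omega^h;\mathbb R^3)$, $\mathbf R^h\in W^{1,2}(\omega;SO(3))$, $\bar{\mathbf R}^h\in SO(3)$, $\mathbf c^h\in\mathbb R^3$, $\tilde{\mathbf y}^h=(\bar{\mathbf R}^h)^T\mathbf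 y^h-\mathbf c^h$, and define, for $\alpha=1,2$, $$u^h_\alpha(x')=\frac1{h^4}\Big(\int_{-1/2}^{1/2}\tilde y^h_\alpha\circ\Theta^h\circ P^h\,dx_3-x_\alpha-h^2R^h_{\alpha3}(x')\,\theta_0(\tfrac{x'}h)\Big),\qquad v^h(x')=\frac1{h^2}\int_{-1/2}^{1/2}\tilde y_3^h\circ\Theta^h\circ P^h\,dx_3-\theta(\tfrac{x'}h).$$ Suppose that there are $\mathbf u\in W^{1,2}(\omega;\mathbb R^2)$, $v\in W^{2,2}(\omega)$, $\mathbf A\in W^{1,2}(\omega;\mathbb R^{3\times3})$ and constants $C$, $C_p$ independent of $h$ with * $\|(\nabla\tilde{\mathbf y}^h)\circ\Theta^h\circ P^h-\mathbf R^h\|_{L^2(\Omega)}\le Ch^4$, $\ \|\mathbf R^h-\mathbf I\|_{L^p(\omega)}\le C_ph^2$ for all $1\le p<\infty$, $\ \|\nabla\mathbf R^h\|_{L^2(\omega)}\le Ch^2$; * $v^h\to v$ in $W^{1,2}(\omega)$ and $\mathbf u^h\rightharpoonup\mathbf u$ weakly in $W^{1,2}(\omega;\mathbb R^2)$; * $h^{-2}(\mathbf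 R^h-\mathbf I)\rightharpoonup\mathbf A$ weakly in $W^{1,2}(\omega)$, $\ h^{-2}((\nabla\tilde{\mathbf y}^h)\circ\Theta^h\circ P^h-\mathbf I)\rightharpoonup\mathbf A$ weakly in $L^2(\Omega)$, $\ \mathbf A=\mathbf e_3\otimes\nabla v-\nabla v\otimes\mathbf e_3$, and $h^{-4}\,\mathrm{sym}(\mathbf R^h-\mathbf I)\to\frac12\mathbf A^2$ in $L^2$. Suppose moreover that, for some $\mathbf u_1\in L^2(\omega;\dot H^1_\#(Y))^2$ and $v_1\in L^2(\omega;\dot H^2_\#(Y))$, $$\nabla\mathbf u^h\ \to\ \nabla\mathbf u(x)+\nabla_y\mathbf u_1(x,y),\qquad \nabla\,\frac1{h^2}\begin{pmatrix}R^h_{13}\\R^h_{23}\end{pmatrix}\ \to\ -\nabla^2v(x)-\nabla_y^2v_1(x,y)\qquad\text{in the two-scale sense.}$$ **Conclusion.** $$\liminf_{h\to0}I^h(\mathbf y^h)\ \ge\ I^L(\mathbf u,\mathbf u_1,v,v_1),$$ where $$I^L(\mathbf u,\mathbf u_1,v,v_1)=\int_\omega\int_Y\tfrac12Q_2\Big(\mathrm{sym}\nabla\mathbf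 u+\mathrm{sym}\nabla_y\mathbf u_1-\theta_0(y)\nabla^2v-\theta_0(y)\nabla_y^2v_1+\tfrac12\nabla v\otimes\nabla v\Big)dy\,dx+\frac1{24}\int_\omega\int_YQ_2(\nabla_y^2v_1)\,dy\,dx+\frac1{24}\int_\omega Q_2(\nabla^2v)\,dx .$$ -/

import Mathlib

open MeasureTheory Filter Topology Set
open scoped ENNReal

noncomputable section

namespace WrinkledPlate

/-- The plane, with points `x' = (x₁, x₂)` (and also `y = (y₁, y₂)`). -/
abbrev V2 := Fin 2 → ℝ
/-- Physical space. -/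
abbrev V3 := Fin 3 → ℝ
abbrev M2 := Matrix (Fin 2) (Fin 2) ℝ
abbrev M3 := Matrix (Fin 3) (Fin 3) ℝ

/-- The classical partial derivative `∂ᵢ f (x)`. -/
def pderiv {d : ℕ} (i : Fin d) (f : (Fin d → ℝ) → ℝ) (x : Fin d → ℝ) : ℝ :=
  fderiv ℝ f x (Pi.single i 1)

/-! ### Sobolev spaces and convergence -/

/-- `f ∈ W^{1,2}(U)` (in particular `f ∈ L²(U)`, `∇f ∈ L²(U)`) with weak gradient `g`. -/
structure HasWeakGrad {d : ℕ} (U : Set (Fin d → ℝ)) (f : (Fin d → ℝ) → ℝ)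
    (g : (Fin d → ℝ) → Fin d → ℝ) : Prop where
  memLp : MemLp f 2 (volume.restrict U)
  memLp_grad : ∀ i, MemLp (fun x => g x i) 2 (volume.restrict U)
  integral_eq : ∀ φ : (Fin d → ℝ) → ℝ, ContDiff ℝ ((⊤ : ℕ∞) : WithTop ℕ∞) φ → HasCompactSupport φ → tsupport φ ⊆ U →
    ∀ i, ∫ x in U, f x * pderiv i φ x = - ∫ x in U, g x i * φ x

/-- `f ∈ W^{2,2}(U)` with weak gradient `g` and weak Hessian `H`. -/
structure HasWeakHess {d : ℕ} (U : Set (Fin d → ℝ)) (f : (Fin d → ℝ) → ℝ)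
    (g : (Fin d → ℝ) → Fin d → ℝ) (H : (Fin d → ℝ) → Matrix (Fin d) (Fin d) ℝ) : Prop where
  grad : HasWeakGrad U f g
  hess : ∀ i, HasWeakGrad U (fun x => g x i) (fun x => H x i)

/-- Strong convergence in `L²(μ)`. -/
def TendstoL2 {X : Type*} [MeasurableSpace X] (μ : Measure X) (f : ℕ → X → ℝ) (f₀ : X → ℝ) :
    Prop :=
  (∀ n, MemLp (f n) 2 μ) ∧ MemLp f₀ 2 μ ∧
    Tendsto (fun n => eLpNorm (fun x => f n x - f₀ x) 2 μ) atTop (𝓝 0)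

/-- Weak convergence in `L²(μ)`. -/
def TendstoWeakL2 {X : Type*} [MeasurableSpace X] (μ : Measure X) (f : ℕ → X → ℝ) (f₀ : X → ℝ) :
    Prop :=
  (∀ n, MemLp (f n) 2 μ) ∧ MemLp f₀ 2 μ ∧
    ∀ g : X → ℝ, MemLp g 2 μ →
      Tendsto (fun n => ∫ x, f n x * g x ∂μ) atTop (𝓝 (∫ x, f₀ x * g x ∂μ))

/-- Strong convergence in `W^{1,2}(U)`. -/
def TendstoW12 {d : ℕ} (U : Set (Fin d → ℝ)) (f : ℕ → (Fin d → ℝ) → ℝ) (f₀ : (Fin d → ℝ) → ℝ) :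
    Prop :=
  ∃ (g : ℕ → (Fin d → ℝ) → Fin d → ℝ) (g₀ : (Fin d → ℝ) → Fin d → ℝ),
    (∀ n, HasWeakGrad U (f n) (g n)) ∧ HasWeakGrad U f₀ g₀ ∧
    TendstoL2 (volume.restrict U) f f₀ ∧
    ∀ i, TendstoL2 (volume.restrict U) (fun n x => g n x i) (fun x => g₀ x i)

/-- Weak convergence in `W^{1,2}(U)`. -/
def TendstoWeakW12 {d : ℕ} (U : Set (Fin d → ℝ)) (f : ℕ → (Fin d → ℝ) → ℝ)
    (f₀ : (Fin d → ℝ) → ℝ) : Prop :=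
  ∃ (g : ℕ → (Fin d → ℝ) → Fin d → ℝ) (g₀ : (Fin d → ℝ) → Fin d → ℝ),
    (∀ n, HasWeakGrad U (f n) (g n)) ∧ HasWeakGrad U f₀ g₀ ∧
    TendstoWeakL2 (volume.restrict U) f f₀ ∧
    ∀ i, TendstoWeakL2 (volume.restrict U) (fun n x => g n x i) (fun x => g₀ x i)

/-! ### The periodicity cell, periodic Sobolev spaces, two-scale convergence -/

/-- The cell `Y = [0,1]²`. -/
def cell : Set V2 := Icc 0 1

/-- `Y`-periodicity. -/
def IsPeriodic (f : V2 → ℝ) : Prop := ∀ (i : Fin 2) (y : V2), f (y + Pi.single i 1) = f y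

/-- `f ∈ H¹_#(Y)` with gradient `g`: on the torus, i.e. tested with all smooth periodic functions. -/
structure HasPeriodicWeakGrad (f : V2 → ℝ) (g : V2 → V2) : Prop where
  memLp : MemLp f 2 (volume.restrict cell)
  memLp_grad : ∀ i, MemLp (fun y => g y i) 2 (volume.restrict cell)
  integral_eq : ∀ η : V2 → ℝ, ContDiff ℝ ((⊤ : ℕ∞) : WithTop ℕ∞) η → IsPeriodic η →
    ∀ i, ∫ y in cell, f y * pderiv i η y = - ∫ y in cell, g y i * η y

/-- `w ∈ L²(ω; Ḣ¹_#(Y))` with `∇_y w = g`; the dot means vanishing mean over `Y`. -/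
structure IsL2Hdot1 (ω : Set V2) (w : V2 × V2 → ℝ) (g : V2 × V2 → V2) : Prop where
  memLp : MemLp w 2 (volume.restrict (ω ×ˢ cell))
  memLp_grad : ∀ i, MemLp (fun p => g p i) 2 (volume.restrict (ω ×ˢ cell))
  grad : ∀ᵐ x ∂(volume.restrict ω), HasPeriodicWeakGrad (fun y => w (x, y)) (fun y => g (x, y))
  mean_zero : ∀ᵐ x ∂(volume.restrict ω), ∫ y in cell, w (x, y) = 0

/-- `w ∈ L²(ω; Ḣ²_#(Y))` with `∇_y w = g` and `∇_y² w = H`. -/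
structure IsL2Hdot2 (ω : Set V2) (w : V2 × V2 → ℝ) (g : V2 × V2 → V2) (H : V2 × V2 → M2) :
    Prop where
  first : IsL2Hdot1 ω w g
  memLp_hess : ∀ i j, MemLp (fun p => H p i j) 2 (volume.restrict (ω ×ˢ cell))
  hess : ∀ᵐ x ∂(volume.restrict ω), ∀ i,
    HasPeriodicWeakGrad (fun y => g (x, y) i) (fun y => H (x, y) i)

/-- The class of `y ∈ ℝ²` modulo `ℤ²`. -/
def toTorus (y : V2) : UnitAddTorus (Fin 2) := fun i => ((y i : ℝ) : UnitAddCircle)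

/-- Two-scale convergence of `f n ∈ L²(ω)` to `f₀ ∈ L²(ω × Y)`, along the scales `h n`.
The test functions range over `L²(ω; C_#(Y))`, where `C_#(Y)` is the Banach space of continuous
`Y`-periodic functions, i.e. of continuous functions on the torus. -/
def TwoScale (ω : Set V2) (h : ℕ → ℝ) (f : ℕ → V2 → ℝ) (f₀ : V2 × V2 → ℝ) : Prop :=
  (∀ n, MemLp (f n) 2 (volume.restrict ω)) ∧ MemLp f₀ 2 (volume.restrict (ω ×ˢ cell)) ∧
    ∀ ψ : V2 → C(UnitAddTorus (Fin 2), ℝ), MemLp ψ 2 (volume.restrict ω) →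
      Tendsto (fun n => ∫ x in ω, f n x * ψ x (toTorus ((h n)⁻¹ • x))) atTop
        (𝓝 (∫ p in ω ×ˢ cell, f₀ p * ψ p.1 (toTorus p.2)))

/-! ### Geometry of the wrinkled plate -/

/-- `Ω^h = ω × (-h²/2, h²/2)`; the fixed domain `Ω` is `plate ω 1`. -/
def plate (ω : Set V2) (h : ℝ) : Set (V2 × ℝ) := ω ×ˢ Ioo (-(h ^ 2 / 2)) (h ^ 2 / 2)

/-- The unit normal `n^h(x')` to the graph `x₃ = h² θ(x'/h)`. -/
def normal (θ : V2 → ℝ) (h : ℝ) (x : V2) : V3 :=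
  (Real.sqrt (h ^ 2 * pderiv 0 θ (h⁻¹ • x) ^ 2 + h ^ 2 * pderiv 1 θ (h⁻¹ • x) ^ 2 + 1))⁻¹ •
    ![-(h * pderiv 0 θ (h⁻¹ • x)), -(h * pderiv 1 θ (h⁻¹ • x)), 1]

/-- `Θ^h(x', x₃^h) = (x', h² θ(x'/h)) + x₃^h n^h(x')`. -/
def Theta (θ : V2 → ℝ) (h : ℝ) (p : V2 × ℝ) : V3 :=
  ![p.1 0, p.1 1, h ^ 2 * θ (h⁻¹ • p.1)] + p.2 • normal θ h p.1

/-- The reference configuration `Θ^h(Ω^h)` of the wrinkled plate. -/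
def shell (ω : Set V2) (θ : V2 → ℝ) (h : ℝ) : Set V3 := Theta θ h '' plate ω h

/-- `Θ^h ∘ P^h`, where `P^h(x', x₃) = (x', h² x₃)`. -/
def ThetaP (θ : V2 → ℝ) (h : ℝ) (p : V2 × ℝ) : V3 := Theta θ h (p.1, h ^ 2 * p.2)

/-- `θ₀ = θ - ∫_Y θ`. -/
def theta0 (θ : V2 → ℝ) (y : V2) : ℝ := θ y - ∫ z in cell, θ z

/-! ### Elasticity -/

/-- `SO(3)`. -/
def SO3 : Set M3 := {R | R ∈ Matrix.specialOrthogonalGroup (Fin 3) ℝ}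

section Density

attribute [local instance] Matrix.frobeniusNormedAddCommGroup Matrix.frobeniusNormedSpace

/-- The assumptions on the stored energy density `W : ℝ^{3×3} → [0, ∞]`; `dist` is taken with
respect to the Frobenius norm `|A|² = tr (AᵀA)`. -/
structure IsStoredEnergy (W : M3 → ℝ≥0∞) : Prop where
  /-- Borel measurability in the nine entries. -/
  measurable : Measurable (fun F : Fin 3 → Fin 3 → ℝ => W (Matrix.of F))
  smooth : ∃ U : Set M3, IsOpen U ∧ SO3 ⊆ U ∧ (∀ F ∈ U, W F ≠ ⊤) ∧
    ContDiffOn ℝ 2 (fun F => (W F).toReal) U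
  frame : ∀ F : M3, ∀ R ∈ SO3, W (R * F) = W F
  coercive : ∃ C : ℝ, 0 < C ∧ ∀ F : M3, ENNReal.ofReal (C * Metric.infDist F SO3 ^ 2) ≤ W F
  zero : ∀ R ∈ SO3, W R = 0

/-- `Q₃(F) = D²W(I)(F, F)`. -/
def Q3 (W : M3 → ℝ≥0∞) (F : M3) : ℝ :=
  iteratedFDeriv ℝ 2 (fun X : M3 => (W X).toReal) 1 ![F, F]

end Density

/-- A `2 × 2` matrix as a `3 × 3` matrix with vanishing third row and column. -/
def embed (G : M2) : M3 := !![G 0 0, G 0 1, 0; G 1 0, G 1 1, 0; 0, 0, 0]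

/-- The third basis vector. -/
def e3 : V3 := Pi.single 2 1

/-- `Q₂(G) = min_a Q₃(G + a ⊗ e₃ + e₃ ⊗ a)`. -/
def Q2 (W : M3 → ℝ≥0∞) (G : M2) : ℝ :=
  ⨅ a : V3, Q3 W (embed G + Matrix.vecMulVec a e3 + Matrix.vecMulVec e3 a)

/-- The rescaled energy `I^h(y) = h⁻⁸ h⁻² ∫_{Θ^h(Ω^h)} W(∇y) dx`, as a function of `∇y`. -/
def energy (W : M3 → ℝ≥0∞) (ω : Set V2) (θ : V2 → ℝ) (h : ℝ) (Dy : V3 → M3) : ℝ≥0∞ :=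
  ENNReal.ofReal ((h ^ 8)⁻¹ * (h ^ 2)⁻¹) * ∫⁻ x in shell ω θ h, W (Dy x)

/-- The symmetric part of a square matrix. -/
def symPart {d : ℕ} (G : Matrix (Fin d) (Fin d) ℝ) : Matrix (Fin d) (Fin d) ℝ :=
  (1 / 2 : ℝ) • (G + G.transpose)

/-- The in-plane strain
`sym ∇u + sym ∇_y u₁ - θ₀ ∇²v - θ₀ ∇_y² v₁ + ½ ∇v ⊗ ∇v` at the point `p = (x, y)`. -/
def strain (θ : V2 → ℝ) (Du : V2 → M2) (Du₁ : V2 × V2 → M2) (Dv : V2 → V2) (D2v : V2 → M2)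
    (D2v₁ : V2 × V2 → M2) (p : V2 × V2) : M2 :=
  symPart (Du p.1) + symPart (Du₁ p) - theta0 θ p.2 • D2v p.1 - theta0 θ p.2 • D2v₁ p
    + (1 / 2 : ℝ) • Matrix.vecMulVec (Dv p.1) (Dv p.1)

/-- The limit functional `I^L(u, u₁, v, v₁)`, as a function of the derivatives that it involves.
The integrands are nonnegative, and the integrals are taken in `[0, ∞]`. -/
def limitEnergy (W : M3 → ℝ≥0∞) (ω : Set V2) (θ : V2 → ℝ) (Du : V2 → M2) (Du₁ : V2 × V2 → M2)
    (Dv : V2 → V2) (D2v : V2 → M2) (D2v₁ : V2 × V2 → M2) : ℝ≥0∞ :=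
  (∫⁻ p in ω ×ˢ cell, ENNReal.ofReal (1 / 2 * Q2 W (strain θ Du Du₁ Dv D2v D2v₁ p)))
    + (∫⁻ p in ω ×ˢ cell, ENNReal.ofReal (1 / 24 * Q2 W (D2v₁ p)))
    + ∫⁻ x in ω, ENNReal.ofReal (1 / 24 * Q2 W (D2v x))

/-! ### Displacements and the convergences -/

/-- The corrected in-plane displacement
`h⁻⁴ (∫_{-1/2}^{1/2} (y_β ∘ Θ^h ∘ P^h)(x', x₃) dx₃ - x_β - h² R_{β3}(x') θ₀(x'/h))`. -/
def inPlane (θ : V2 → ℝ) (h : ℝ) (y : V3 → V3) (R : V2 → M3) (x : V2) (β : Fin 2) : ℝ :=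
  (h ^ 4)⁻¹ * ((∫ t in (-1 / 2 : ℝ)..(1 / 2), y (ThetaP θ h (x, t)) β.castSucc) - x β
    - h ^ 2 * (R x β.castSucc 2 * theta0 θ (h⁻¹ • x)))

/-- The out-of-plane displacement
`h⁻² ∫_{-1/2}^{1/2} (y₃ ∘ Θ^h ∘ P^h)(x', x₃) dx₃ - θ(x'/h)`. -/
def outOfPlane (θ : V2 → ℝ) (h : ℝ) (y : V3 → V3) (x : V2) : ℝ :=
  (h ^ 2)⁻¹ * (∫ t in (-1 / 2 : ℝ)..(1 / 2), y (ThetaP θ h (x, t)) 2) - θ (h⁻¹ • x)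

/-- The estimates and convergences that define a compact sequence of deformations, along the scales
`h n → 0`. Here `Dy n` is the gradient of `y n`, `DR n x i j` is the gradient of the entry
`R n · i j`, and `Dv` is the gradient of `v`. Norms and limits of matrix fields are taken entry by
entry. Being a function of `x'` alone, `A` satisfies `∂₃ A = 0`; that `A ∈ W^{1,2}(ω; ℝ^{3×3})`
is part of `rotation_limit`. -/
structure CompactSequence (ω : Set V2) (θ : V2 → ℝ) (h : ℕ → ℝ) (y : ℕ → V3 → V3)
    (Dy : ℕ → V3 → M3) (R : ℕ → V2 → M3) (DR : ℕ → V2 → Fin 3 → Fin 3 → V2)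
    (u : V2 → V2) (v : V2 → ℝ) (Dv : V2 → V2) (A : V2 → M3) : Prop where
  /-- `‖(∇y^h) ∘ Θ^h ∘ P^h - R^h‖_{L²(Ω)} ≤ C h⁴` -/
  grad_near : ∃ C : ℝ, ∀ n i j,
    eLpNorm (fun p : V2 × ℝ => Dy n (ThetaP θ (h n) p) i j - R n p.1 i j) 2
      (volume.restrict (plate ω 1)) ≤ ENNReal.ofReal (C * h n ^ 4)
  /-- `‖R^h - I‖_{L^p(ω)} ≤ C_p h²` for all `p < ∞` -/
  rotation_near : ∀ p : ℝ≥0∞, 1 ≤ p → p ≠ ⊤ → ∃ C : ℝ, ∀ n i j,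
    eLpNorm (fun x => R n x i j - (1 : M3) i j) p (volume.restrict ω)
      ≤ ENNReal.ofReal (C * h n ^ 2)
  /-- `‖∇R^h‖_{L²(ω)} ≤ C h²` -/
  rotation_grad : ∃ C : ℝ, ∀ n i j α,
    eLpNorm (fun x => DR n x i j α) 2 (volume.restrict ω) ≤ ENNReal.ofReal (C * h n ^ 2)
  /-- `v^h → v` in `W^{1,2}(ω)` -/
  out_limit : TendstoW12 ω (fun n => outOfPlane θ (h n) (y n)) v
  /-- `u^h ⇀ u` in `W^{1,2}(ω; ℝ²)` -/
  in_limit : ∀ β, TendstoWeakW12 ω (fun n x => inPlane θ (h n) (y n) (R n) x β) (fun x => u x β)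
  /-- `(R^h - I) / h² ⇀ A` in `W^{1,2}(ω; ℝ^{3×3})` -/
  rotation_limit : ∀ i j,
    TendstoWeakW12 ω (fun n x => (h n ^ 2)⁻¹ * (R n x i j - (1 : M3) i j)) (fun x => A x i j)
  /-- `((∇y^h) ∘ Θ^h ∘ P^h - I) / h² ⇀ A` in `L²(Ω; ℝ^{3×3})` -/
  grad_limit : ∀ i j, TendstoWeakL2 (volume.restrict (plate ω 1))
    (fun n p => (h n ^ 2)⁻¹ * (Dy n (ThetaP θ (h n) p) i j - (1 : M3) i j)) (fun p => A p.1 i j)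
  /-- `A = e₃ ⊗ ∇v - ∇v ⊗ e₃` -/
  A_eq : ∀ᵐ x ∂(volume.restrict ω),
    A x = Matrix.vecMulVec e3 ![Dv x 0, Dv x 1, 0] - Matrix.vecMulVec ![Dv x 0, Dv x 1, 0] e3
  /-- `sym (R^h - I) / h⁴ → A² / 2` in `L²` -/
  sym_limit : ∀ i j, TendstoL2 (volume.restrict ω)
    (fun n x => (h n ^ 4)⁻¹ * symPart (R n x - 1) i j) (fun x => 1 / 2 * (A x * A x) i j)

end WrinkledPlate

end

open WrinkledPlate

namespace WrinkledPlate

/-! On the fixed plate the normalized gradient is `R^h + h⁴ G^h` with `G^h` bounded in `L²`.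
Multiplying by `(R^h)ᵀ` and using frame indifference, the energy becomes, up to a Jacobian factor
tending to one, the integral of `h⁻⁸ W(I + h⁴ (R^h)ᵀ G^h)`. Since `W` is minimal on `SO(3)`, its
expansion at `I` starts with `½ Q₃ ≥ ½ Q₂` of the in-plane block.

No weak limit of `G^h` is extracted. `Q₂` is a sum of squares of linear forms `ℓ_k` with symmetric
coefficients (`IsStoredEnergy.exists_Q2_eq_sum_sq`), and Young's inequality `½ a² ≥ a ψ - ½ ψ²`
replaces the quadratic lower bound by one that is affine in `G^h`
(`IsStoredEnergy.ofReal_le_scaled`). It then suffices to know the limits of the integrals of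
`ℓ_k(G^h)` against fields `ψ(x, x/h) + t χ(x, x/h)`, affine in the thickness variable `t`; that is,
two moments of `G^h` in `t`.

Zeroth moment (`integral_inPlane_gradient`): averaging the chain rule over the thickness expresses
`∇u^h` as `h⁻⁴(R^h - I)`, minus `h⁻² ∇R^h_{β3} θ₀(x/h)`, plus the mean of `G^h`, up to a vanishing
error. The term `h² R^h_{β3} θ₀(x/h)` in the definition of `u^h` is there to cancel the contribution
of the slope `h ∇θ(x/h)`. A symmetric form sees only `h⁻⁴ sym(R^h - I)`, which tends to `½ A²`, and
the in-plane block of `A²` is `-∇v ⊗ ∇v`; two-scale convergence gives the strain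
(`tendsto_pairing_increment`).

First moment (`sum_integral_first_moment`): integrating by parts once along the mid-surface and once
across the thickness shows that the `t`-moment of `G^h_{βα}` is `1/12` of `h⁻² ∂_α R^h_{β3}` up to a
vanishing error, whence the limit `-(1/12)(∇²v + ∇_y² v₁)` (`tendsto_pairing_moment`).

Optimizing over the test fields, which are dense in `L²(ω × Y)`, yields `½ ∫ Q₂(strain) + (1/24) ∫
Q₂(∇²v + ∇_y² v₁)`. The last integral splits into the two bending terms because `∇_y² v₁` has mean
zero over the cell (`integral_sq_pairing_add`). -/

/-! ### Expansion of `W` at the identity and the quadratic forms `Q₃`, `Q₂`. -/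

/-- The derivative of `f(a + Z) - ½ B(Z, Z)` is `o(‖Z‖)`, since `fderiv f` vanishes at `a` and has
the symmetric derivative `B` there. The mean value inequality on the ball of radius `‖X‖` gains the
second power. -/
theorem abs_taylor_two_sub_le {E : Type*} [NormedAddCommGroup E] [NormedSpace ℝ E] {f : E → ℝ}
    {a : E} (hf : ContDiffAt ℝ 2 f a) (h0 : fderiv ℝ f a = 0) {ε : ℝ} (hε : 0 < ε) :
    ∃ δ > 0, ∀ X : E, ‖X‖ < δ →
      |f (a + X) - f a - 1 / 2 * iteratedFDeriv ℝ 2 f a ![X, X]| ≤ ε * ‖X‖ ^ 2 := by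
  simp only [iteratedFDeriv_two_apply, Matrix.cons_val_zero, Matrix.cons_val_one]
  have hd : DifferentiableAt ℝ (fderiv ℝ f) a :=
    (hf.fderiv_right (m := 1) (by norm_num)).differentiableAt (by norm_num)
  have hsymm : ∀ x y, fderiv ℝ (fderiv ℝ f) a x y = fderiv ℝ (fderiv ℝ f) a y x := by
    have := (hf.isSymmSndFDerivAt (by simp))
    intro x y
    exact this x y
  set B := fderiv ℝ (fderiv ℝ f) a with hB
  have h1 := hd.hasFDerivAt.isLittleO.def hε
  have h2 : ∀ᶠ x in 𝓝 a, DifferentiableAt ℝ f x := by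
    have := hf.eventually (by simp)
    filter_upwards [this] with x hx using hx.differentiableAt (by norm_num)
  obtain ⟨δ, hδ, hball⟩ := Metric.eventually_nhds_iff_ball.1 (h1.and h2)
  refine ⟨δ, hδ, fun X hX => ?_⟩
  let k : E → ℝ := fun Z => f (a + Z) - 1 / 2 * B Z Z
  have hk : ∀ Z ∈ Metric.closedBall (0 : E) ‖X‖,
      HasFDerivWithinAt k (fderiv ℝ f (a + Z) - B Z) (Metric.closedBall (0 : E) ‖X‖) Z := by
    intro Z hZ
    have hZ' : a + Z ∈ Metric.ball a δ := by
      simp at hZ ⊢; linarith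
    have e1 : HasFDerivAt (fun Z => f (a + Z)) (fderiv ℝ f (a + Z)) Z := by
      have := (hball _ hZ').2.hasFDerivAt
      have h3 := this.comp Z ((hasFDerivAt_id Z).const_add a)
      simpa [Function.comp_def] using h3
    have e2 := B.hasFDerivAt (x := Z).clm_apply (hasFDerivAt_id Z)
    have e3 := (e1.sub (e2.const_mul (1 / 2 : ℝ))).hasFDerivWithinAt (s := Metric.closedBall (0 : E) ‖X‖)
    refine HasFDerivWithinAt.congr_fderiv e3 (ContinuousLinearMap.ext fun u => ?_)
    simp [hsymm u Z]
    ring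
  have hbound : ∀ Z ∈ Metric.closedBall (0 : E) ‖X‖, ‖fderiv ℝ f (a + Z) - B Z‖ ≤ ε * ‖X‖ := by
    intro Z hZ
    have hZ' : a + Z ∈ Metric.ball a δ := by
      simp at hZ ⊢; linarith
    have := (hball _ hZ').1
    simp only [h0, sub_zero, add_sub_cancel_left] at this
    refine this.trans ?_
    simp at hZ
    gcongr
  have := (convex_closedBall (0 : E) ‖X‖).norm_image_sub_le_of_norm_hasFDerivWithin_le hk hbound
    (x := 0) (y := X) (by simp) (by simp)
  simp only [k, add_zero, map_zero, mul_zero, sub_zero, Real.norm_eq_abs] at this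
  rw [show f (a + X) - f a - 1 / 2 * B X X = f (a + X) - 1 / 2 * B X X - f a by ring]
  calc _ ≤ _ := this
    _ = _ := by ring

theorem exists_bilin_iteratedFDeriv_two {E : Type*} [NormedAddCommGroup E] [NormedSpace ℝ E]
    {f : E → ℝ} {a : E} (hf : ContDiffAt ℝ 2 f a) :
    ∃ B : E →ₗ[ℝ] E →ₗ[ℝ] ℝ, (∀ x y, B x y = B y x) ∧
      ∀ X, iteratedFDeriv ℝ 2 f a ![X, X] = B X X := by
  refine ⟨(ContinuousLinearMap.coeLM ℝ) ∘ₗ (fderiv ℝ (fderiv ℝ f) a).toLinearMap, fun x y => ?_,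
    fun X => ?_⟩
  · exact hf.isSymmSndFDerivAt (by simp) x y
  · simp [iteratedFDeriv_two_apply]

theorem continuous_iteratedFDeriv_two {E : Type*} [NormedAddCommGroup E] [NormedSpace ℝ E]
    (f : E → ℝ) (a : E) : Continuous fun X => iteratedFDeriv ℝ 2 f a ![X, X] := by
  simp only [iteratedFDeriv_two_apply, Matrix.cons_val_zero, Matrix.cons_val_one]
  fun_prop

/-- The Gram matrix is positive semidefinite, hence a sum of rank-one matrices `w wᵀ`; the vectors
`w` are the rows of `A`. -/
theorem exists_norm_sq_of_nonneg {V : Type*} [AddCommGroup V] [Module ℝ V] [FiniteDimensional ℝ V]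
    (B : V →ₗ[ℝ] V →ₗ[ℝ] ℝ) (hs : ∀ x y, B x y = B y x) (hB : ∀ x, 0 ≤ B x x) :
    ∃ (m : ℕ) (A : V →ₗ[ℝ] EuclideanSpace ℝ (Fin m)), ∀ x, B x x = ‖A x‖ ^ 2 := by
  let b := Module.finBasis ℝ V
  let M : Matrix (Fin (Module.finrank ℝ V)) (Fin (Module.finrank ℝ V)) ℝ :=
    Matrix.of fun i j => B (b i) (b j)
  have hM : ∀ x, B x x = ∑ i, ∑ j, b.repr x i * M i j * b.repr x j := by
    intro x
    conv_lhs => rw [← b.sum_repr x]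
    simp only [map_sum, map_smul, LinearMap.sum_apply, LinearMap.smul_apply, smul_eq_mul,
      Matrix.of_apply, M, Finset.mul_sum]
    rw [Finset.sum_comm]
    exact Finset.sum_congr rfl fun i _ => Finset.sum_congr rfl fun j _ => by ring
  have hpos : M.PosSemidef := by
    refine Matrix.PosSemidef.of_dotProduct_mulVec_nonneg ?_ fun c => ?_
    · ext i j
      exact hs _ _
    · have h1 := hB (∑ i, c i • b i)
      rw [hM] at h1
      rw [b.repr_sum_self] at h1
      have h3 : star c ⬝ᵥ M.mulVec c = ∑ i, ∑ j, c i * M i j * c j := by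
        simp [dotProduct, Matrix.mulVec, Finset.mul_sum, mul_assoc]
      rw [h3]
      exact h1
  obtain ⟨m, w, hw⟩ := Matrix.posSemidef_iff_eq_sum_vecMulVec.1 hpos
  refine ⟨m, (WithLp.linearEquiv 2 ℝ (Fin m → ℝ)).symm.toLinearMap ∘ₗ
    LinearMap.pi (fun k => ∑ i, w k i • b.coord i), fun x => ?_⟩
  rw [hM, EuclideanSpace.real_norm_sq_eq, hw]
  have : ∀ k, ((WithLp.linearEquiv 2 ℝ (Fin m → ℝ)).symm.toLinearMap ∘ₗ
      LinearMap.pi (fun k => ∑ i, w k i • b.coord i)) x k = ∑ i, w k i * b.repr x i := by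
    intro k
    simp
  simp only [this, Matrix.sum_apply, Matrix.vecMulVec_apply, star_trivial, sq,
    Finset.sum_mul, Finset.mul_sum]
  rw [Finset.sum_comm]
  simp only [Finset.sum_comm (s := (Finset.univ : Finset (Fin (Module.finrank ℝ V))))
    (t := (Finset.univ : Finset (Fin m)))]
  exact Finset.sum_congr rfl fun k _ => Finset.sum_congr rfl fun i _ =>
    Finset.sum_congr rfl fun j _ => by ring

section

attribute [local instance] Matrix.frobeniusNormedAddCommGroup Matrix.frobeniusNormedSpace

theorem one_mem_SO3 : (1 : M3) ∈ SO3 := by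
  simp [SO3]

theorem frobenius_norm_sq (X : M3) : ‖X‖ ^ 2 = ∑ i, ∑ j, X i j ^ 2 := by
  rw [Matrix.frobenius_norm_def, ← Real.sqrt_eq_rpow, Real.sq_sqrt (by positivity)]
  simp

theorem IsStoredEnergy.contDiffAt_one {W : M3 → ℝ≥0∞} (hW : IsStoredEnergy W) :
    ContDiffAt ℝ 2 (fun F => (W F).toReal) 1 := by
  obtain ⟨U, hU, hS, -, hc⟩ := hW.smooth
  exact hc.contDiffAt (hU.mem_nhds (hS one_mem_SO3))

theorem IsStoredEnergy.exists_bilin {W : M3 → ℝ≥0∞} (hW : IsStoredEnergy W) :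
    ∃ B : M3 →ₗ[ℝ] M3 →ₗ[ℝ] ℝ, (∀ x y, B x y = B y x) ∧ ∀ X, Q3 W X = B X X :=
  exists_bilin_iteratedFDeriv_two hW.contDiffAt_one

theorem IsStoredEnergy.abs_toReal_sub_le {W : M3 → ℝ≥0∞} (hW : IsStoredEnergy W) {ε : ℝ}
    (hε : 0 < ε) :
    ∃ δ > 0, ∀ X : M3, ‖X‖ < δ → |(W (1 + X)).toReal - 1 / 2 * Q3 W X| ≤ ε * ‖X‖ ^ 2 := by
  have h1 : (W 1).toReal = 0 := by rw [hW.zero 1 one_mem_SO3]; rfl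
  -- `W ≥ 0 = W(I)`, so the identity is a minimum and the expansion has no linear term.
  have h0 : fderiv ℝ (fun F => (W F).toReal) 1 = 0 := by
    apply IsLocalMin.fderiv_eq_zero
    exact Filter.Eventually.of_forall fun F => by simp [h1]
  obtain ⟨δ, hδ, H⟩ := abs_taylor_two_sub_le hW.contDiffAt_one h0 hε
  refine ⟨δ, hδ, fun X hX => ?_⟩
  have := H X hX
  rwa [h1, sub_zero] at this

theorem IsStoredEnergy.ofReal_le {W : M3 → ℝ≥0∞} (hW : IsStoredEnergy W) {ε : ℝ} (hε : 0 < ε) :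
    ∃ r > 0, ∀ X : M3, ∑ i, ∑ j, X i j ^ 2 ≤ r →
      ENNReal.ofReal (1 / 2 * Q3 W X - ε * ∑ i, ∑ j, X i j ^ 2) ≤ W (1 + X) := by
  obtain ⟨δ, hδ, H⟩ := hW.abs_toReal_sub_le hε
  obtain ⟨U, hU, hS, hfin, -⟩ := hW.smooth
  obtain ⟨δ', hδ', H'⟩ := Metric.isOpen_iff.1 hU 1 (hS one_mem_SO3)
  have hm : 0 < min δ δ' := lt_min hδ hδ'
  refine ⟨(min δ δ' / 2) ^ 2, by positivity, fun X hX => ?_⟩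
  rw [← frobenius_norm_sq] at hX ⊢
  have hn : ‖X‖ < min δ δ' := by
    have := abs_le_of_sq_le_sq' hX (by positivity)
    linarith [this.2]
  have hf : W (1 + X) ≠ ⊤ := hfin _ (H' (by simpa using hn.trans_le (min_le_right _ _)))
  rw [← ENNReal.ofReal_toReal hf]
  apply ENNReal.ofReal_le_ofReal
  have := abs_le.1 (H X (hn.trans_le (min_le_left _ _)))
  linarith [this.1]

theorem IsStoredEnergy.Q3_smul {W : M3 → ℝ≥0∞} (hW : IsStoredEnergy W) (t : ℝ) (X : M3) :
    Q3 W (t • X) = t ^ 2 * Q3 W X := by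
  obtain ⟨B, -, hB⟩ := hW.exists_bilin
  simp [hB]; ring

theorem IsStoredEnergy.Q3_nonneg {W : M3 → ℝ≥0∞} (hW : IsStoredEnergy W) (X : M3) :
    0 ≤ Q3 W X := by
  by_contra! hneg
  have hX : 0 < ‖X‖ := by
    rw [norm_pos_iff]; rintro rfl
    have := hW.Q3_smul 0 0
    simp at this; linarith
  -- For this `ε` the Taylor remainder is at most half of the negative leading term, so `W` would be
  -- negative at a point of the ray through `X`.
  obtain ⟨δ, hδ, H⟩ := hW.abs_toReal_sub_le (ε := -Q3 W X / (4 * ‖X‖ ^ 2)) (by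
    apply div_pos <;> [linarith; positivity])
  have h1 := H ((δ / 2 / ‖X‖) • X) (by
    rw [norm_smul, Real.norm_of_nonneg (by positivity)]; field_simp; linarith)
  rw [hW.Q3_smul, norm_smul, Real.norm_of_nonneg (by positivity), mul_pow] at h1
  have h2 := (abs_le.1 h1).2
  have h3 : -Q3 W X / (4 * ‖X‖ ^ 2) * ((δ / 2 / ‖X‖) ^ 2 * ‖X‖ ^ 2)
    = - (δ / 2 / ‖X‖) ^ 2 * Q3 W X / 4 := by field_simp
  rw [h3] at h2
  have h4 : 0 ≤ (W (1 + (δ / 2 / ‖X‖) • X)).toReal := ENNReal.toReal_nonneg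
  have h5 : (δ / 2 / ‖X‖) ^ 2 * Q3 W X < 0 := mul_neg_of_pos_of_neg (by positivity) hneg
  linarith

/-- `W` vanishes along the curve, so `Q₃` of the difference quotient at the identity is bounded by a
multiple of the Taylor tolerance; let the quotient tend to `S` and the tolerance to zero. -/
theorem IsStoredEnergy.Q3_tangent {W : M3 → ℝ≥0∞} (hW : IsStoredEnergy W) {ρ : ℝ → M3} {S : M3}
    (hρ : ∀ t, ρ t ∈ SO3) (h0 : ρ 0 = 1) (hd : HasDerivAt ρ S 0) : Q3 W S = 0 := by
  refine le_antisymm ?_ (hW.Q3_nonneg S)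
  have hc : Continuous (fun X : M3 => Q3 W X) :=
    continuous_iteratedFDeriv_two _ _
  have hlim := hd.tendsto_slope_zero
  simp only [zero_add, h0] at hlim
  have key : ∀ ε > 0, 1 / 2 * Q3 W S ≤ ε * ‖S‖ ^ 2 := by
    intro ε hε
    obtain ⟨δ, hδ, H⟩ := hW.abs_toReal_sub_le hε
    have l1 := ((hc.tendsto S).comp hlim).const_mul (1 / 2 : ℝ)
    have l2 := ((hlim.norm).pow 2).const_mul ε
    refine le_of_tendsto_of_tendsto l1 l2 ?_
    have hcont : Tendsto (fun t => ‖ρ t - 1‖) (𝓝[≠] 0) (𝓝 0) := by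
      have := (hd.continuousAt.tendsto.mono_left (nhdsWithin_le_nhds (s := {0}ᶜ))).sub_const 1
      simpa [h0] using this.norm
    filter_upwards [hcont.eventually (gt_mem_nhds hδ), self_mem_nhdsWithin] with t ht ht0
    have h1 := H _ ht
    rw [add_sub_cancel, hW.zero _ (hρ t)] at h1
    simp only [Function.comp, hW.Q3_smul, norm_smul, mul_pow, norm_inv, Real.norm_eq_abs, inv_pow, sq_abs]
    have h2 := (abs_le.1 h1).1
    simp at h2
    have h3 : 0 ≤ (t ^ 2)⁻¹ := by positivity
    nlinarith [mul_le_mul_of_nonneg_left h2 h3]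
  have hn : 0 ≤ ‖S‖ ^ 2 := by positivity
  refine le_of_forall_pos_le_add fun ε hε => ?_
  have := key (ε / (2 * (‖S‖ ^ 2 + 1))) (by positivity)
  have h2 : ε / (2 * (‖S‖ ^ 2 + 1)) * ‖S‖ ^ 2 ≤ ε / 2 := by
    rw [div_mul_eq_mul_div, div_le_div_iff₀ (by positivity) (by positivity)]
    nlinarith
  linarith

/-- Rodrigues' formula: for each of the three standard skew generators this curve is a one-parameter
group of rotations, so every direction tangent to `SO(3)` at `I` is covered by explicit curves. -/
theorem hasDerivAt_rotation (S : M3) :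
    HasDerivAt (fun t : ℝ => 1 + Real.sin t • S + (1 - Real.cos t) • (S * S)) S 0 := by
  have h1 := ((Real.hasDerivAt_sin 0).smul_const S).const_add (1 : M3)
  have h2 := ((Real.hasDerivAt_cos 0).const_sub 1).smul_const (S * S)
  have h3 := h1.add h2
  simp only [Real.cos_zero, one_smul, Real.sin_zero, neg_zero, zero_smul, add_zero] at h3
  exact h3

theorem rotation_mem_SO3 {S : M3} (hS : S = !![0, 1, 0; -1, 0, 0; 0, 0, 0] ∨
    S = !![0, 0, 1; 0, 0, 0; -1, 0, 0] ∨ S = !![0, 0, 0; 0, 0, 1; 0, -1, 0]) (t : ℝ) :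
    1 + Real.sin t • S + (1 - Real.cos t) • (S * S) ∈ SO3 := by
  have ht := Real.sin_sq_add_cos_sq t
  rw [SO3, mem_ofPred_eq, Matrix.mem_specialOrthogonalGroup_iff, Matrix.mem_orthogonalGroup_iff]
  constructor
  · ext i j
    rcases hS with rfl | rfl | rfl <;> fin_cases i <;> fin_cases j <;>
      simp [Matrix.mul_apply, Fin.sum_univ_three, Matrix.one_apply] <;>
      linarith
  · rcases hS with rfl | rfl | rfl <;>
      simp [Matrix.det_fin_three] <;>
      linarith

/-- `Q₃` vanishes on the three skew generators, hence `A` kills them, and by linearity it kills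
every skew matrix; `X - Xᵀ` is skew. -/
theorem IsStoredEnergy.exists_norm_sq {W : M3 → ℝ≥0∞} (hW : IsStoredEnergy W) :
    ∃ (m : ℕ) (A : M3 →ₗ[ℝ] EuclideanSpace ℝ (Fin m)),
      (∀ X, Q3 W X = ‖A X‖ ^ 2) ∧ ∀ X, A X.transpose = A X := by
  obtain ⟨B, hs, hB⟩ := hW.exists_bilin
  obtain ⟨m, A, hA⟩ := exists_norm_sq_of_nonneg B hs fun X => by
    rw [← hB]; exact hW.Q3_nonneg X
  refine ⟨m, A, fun X => by rw [hB, hA], fun X => ?_⟩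
  have h0 : ∀ {S : M3}, (S = !![0, 1, 0; -1, 0, 0; 0, 0, 0] ∨
      S = !![0, 0, 1; 0, 0, 0; -1, 0, 0] ∨ S = !![0, 0, 0; 0, 0, 1; 0, -1, 0]) → A S = 0 := by
    intro S hS
    have := hW.Q3_tangent (rotation_mem_SO3 hS) (by simp) (hasDerivAt_rotation S)
    rw [hB, hA] at this
    simpa using this
  have hX : X = X.transpose + ((X 0 1 - X 1 0) • !![0, 1, 0; -1, 0, 0; 0, 0, 0] +
      (X 0 2 - X 2 0) • !![0, 0, 1; 0, 0, 0; -1, 0, 0] +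
      (X 1 2 - X 2 1) • !![0, 0, 0; 0, 0, 1; 0, -1, 0]) := by
    ext i j
    fin_cases i <;> fin_cases j <;> simp
  conv_rhs => rw [hX]
  simp only [map_add, map_smul, h0 (Or.inl rfl), h0 (Or.inr (Or.inl rfl)),
    h0 (Or.inr (Or.inr rfl)), smul_zero, add_zero]

end

def upper (X : M3) : M2 := Matrix.of fun i j => X i.castSucc j.castSucc

/-- The coefficients of a linear form on `2 × 2` matrices, applied to a matrix. -/
def pairing (l G : M2) : ℝ := ∑ i, ∑ j, l i j * G i j

def embedₗ : M2 →ₗ[ℝ] M3 where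
  toFun := embed
  map_add' G H := by ext i j; fin_cases i <;> fin_cases j <;> simp [embed]
  map_smul' c G := by ext i j; fin_cases i <;> fin_cases j <;> simp [embed]

def shearₗ : V3 →ₗ[ℝ] M3 where
  toFun a := Matrix.vecMulVec a e3 + Matrix.vecMulVec e3 a
  map_add' a b := by rw [Matrix.add_vecMulVec, Matrix.vecMulVec_add]; abel
  map_smul' c a := by simp [Matrix.smul_vecMulVec, Matrix.vecMulVec_smul]

theorem shearₗ_apply (a : V3) (i j : Fin 3) : shearₗ a i j = a i * e3 j + e3 i * a j := rfl

/-- Minimizing `‖A(G + shear)‖²` over the shears computes a squared distance to the subspace `K`,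
i.e. the squared norm of a projection onto `Kᗮ`, which is linear in `G`. The forms are the
coordinates of that projection; their coefficients are symmetric because `A` ignores transposition.
-/
theorem IsStoredEnergy.exists_Q2_eq_sum_sq {W : M3 → ℝ≥0∞} (hW : IsStoredEnergy W) :
    ∃ (m : ℕ) (l : Fin m → M2), (∀ k i j, l k i j = l k j i) ∧
      (∀ G, Q2 W G = ∑ k, pairing (l k) G ^ 2) ∧ ∀ X : M3, Q2 W (upper X) ≤ Q3 W X := by
  obtain ⟨m, A, hA, hAt⟩ := hW.exists_norm_sq
  let K := LinearMap.range (A ∘ₗ shearₗ)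
  let P : M2 →ₗ[ℝ] EuclideanSpace ℝ (Fin m) :=
    (Kᗮ.starProjection : EuclideanSpace ℝ (Fin m) →ₗ[ℝ] EuclideanSpace ℝ (Fin m)) ∘ₗ A ∘ₗ embedₗ
  have hker : ∀ a, Kᗮ.starProjection (A (shearₗ a)) = 0 := by
    intro a
    rw [Submodule.starProjection_apply_eq_zero_iff, Submodule.orthogonal_orthogonal]
    exact ⟨a, rfl⟩
  have hle : ∀ G a, ‖P G‖ ^ 2 ≤ Q3 W (embed G + shearₗ a) := by
    intro G a
    have h1 : P G = Kᗮ.starProjection (A (embed G + shearₗ a)) := by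
      rw [map_add, map_add, hker, add_zero]; rfl
    rw [hA, h1]
    gcongr
    exact Submodule.norm_starProjection_apply_le _ _
  have hQ : ∀ G, Q2 W G = ‖P G‖ ^ 2 := by
    intro G
    have hQ' : Q2 W G = ⨅ a : V3, Q3 W (embed G + shearₗ a) := by
      simp only [Q2, shearₗ, LinearMap.coe_mk, AddHom.coe_mk, add_assoc]
    rw [hQ']
    refine le_antisymm ?_ (le_ciInf (hle G))
    -- The minimizer is the shear, with opposite sign, that produces the component of `A(G)` in `K`.
    obtain ⟨a, ha⟩ : K.starProjection (A (embed G)) ∈ K := Submodule.starProjection_apply_mem _ _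
    refine (ciInf_le ⟨0, ?_⟩ (-a)).trans_eq ?_
    · rintro _ ⟨b, rfl⟩
      exact hW.Q3_nonneg _
    · have h2 : A (shearₗ a) = K.starProjection (A (embed G)) := ha
      rw [hA, map_add, map_neg, map_neg, h2, ← sub_eq_add_neg]
      have := K.starProjection_add_starProjection_orthogonal (A (embed G))
      congr 2
      rw [sub_eq_iff_eq_add']
      exact this.symm
  have hPt : ∀ G, P G.transpose = P G := by
    intro G
    have h1 : embed G.transpose = (embed G).transpose := by
      ext i j; fin_cases i <;> fin_cases j <;> simp [embed]
    change Kᗮ.starProjection (A (embed _)) = Kᗮ.starProjection (A (embed _))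
    rw [h1, hAt]
  let l : Fin m → M2 := fun k => Matrix.of fun i j => P (Matrix.single i j 1) k
  have hl : ∀ k G, pairing (l k) G = P G k := by
    intro k G
    conv_rhs => rw [Matrix.matrix_eq_sum_single G]
    simp only [map_sum, pairing, l, Matrix.of_apply]
    rw [WithLp.ofLp_sum, Finset.sum_apply]
    refine Finset.sum_congr rfl fun i _ => ?_
    rw [WithLp.ofLp_sum, Finset.sum_apply]
    refine Finset.sum_congr rfl fun j _ => ?_
    rw [show Matrix.single i j (G i j) = G i j • Matrix.single i j (1 : ℝ) by simp, map_smul]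
    simp [mul_comm]
  refine ⟨m, l, fun k i j => ?_, fun G => ?_, fun X => ?_⟩
  · simp only [l, Matrix.of_apply]
    rw [← hPt, Matrix.transpose_single]
  · rw [hQ, EuclideanSpace.real_norm_sq_eq]
    simp only [hl]
  -- The symmetric part of `X` is its in-plane block plus a shear. The last coefficient is halved
  -- because `e₃ ⊗ e₃` occurs twice in the shear.
  · have h1 : A X = A (embed (symPart (upper X)) +
        shearₗ ![(X 0 2 + X 2 0) / 2, (X 1 2 + X 2 1) / 2, X 2 2 / 2]) := by
      have : A X = A ((1 / 2 : ℝ) • (X + X.transpose)) := by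
        rw [map_smul, map_add, hAt, ← two_smul ℝ, smul_smul]; norm_num
      rw [this]
      congr 1
      ext i j
      fin_cases i <;> fin_cases j <;>
        simp [embed, shearₗ_apply, upper, symPart, e3] <;> ring
    rw [hA, h1, ← hA]
    refine le_trans (le_of_eq ?_) (hle _ _)
    rw [hQ]
    congr 2
    rw [symPart, map_smul, map_add, hPt, ← two_smul ℝ, smul_smul]; norm_num

/-! ### Weak gradients: rough test functions and composition with `C¹` charts. -/

theorem continuous_pderiv {d : ℕ} {φ : (Fin d → ℝ) → ℝ} (hφ : ContDiff ℝ 1 φ) (i : Fin d) :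
    Continuous (pderiv i φ) :=
  (hφ.continuous_fderiv (by simp)).clm_apply continuous_const

theorem tsupport_pderiv_subset {d : ℕ} (φ : (Fin d → ℝ) → ℝ) (i : Fin d) :
    tsupport (pderiv i φ) ⊆ tsupport φ := by
  refine (closure_mono fun x hx => ?_).trans (tsupport_fderiv_subset ℝ)
  simp only [Function.mem_support, pderiv] at hx ⊢
  intro h
  simp [h] at hx

theorem hasCompactSupport_pderiv {d : ℕ} {φ : (Fin d → ℝ) → ℝ} (hφ : HasCompactSupport φ)
    (i : Fin d) : HasCompactSupport (pderiv i φ) :=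
  hφ.mono' ((subset_tsupport _).trans (tsupport_pderiv_subset φ i))

open scoped Convolution in
-- Here `a` is the divergence of `H` in the sense of distributions only. Test fields transported by
-- a `C¹` chart carry a Jacobian factor that is merely continuous, so no derivative of `H` itself is
-- available. After mollification `a` is the classical divergence of smooth fields, and uniformly
-- bounded convergence allows passing to the limit.
theorem HasWeakGrad.integral_add_sum_eq_zero {d : ℕ} {U : Set (Fin d → ℝ)} (hU : IsOpen U)
    (hUf : volume U ≠ ⊤) {f : (Fin d → ℝ) → ℝ} {g : (Fin d → ℝ) → Fin d → ℝ}
    (hf : HasWeakGrad U f g) {a : (Fin d → ℝ) → ℝ} {H : Fin d → (Fin d → ℝ) → ℝ}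
    (ha : Continuous a) (hac : HasCompactSupport a)
    (hH : ∀ i, Continuous (H i)) (hHc : ∀ i, HasCompactSupport (H i)) (hHU : ∀ i, tsupport (H i) ⊆ U)
    (hz : ∀ ζ : (Fin d → ℝ) → ℝ, ContDiff ℝ ((⊤ : ℕ∞) : WithTop ℕ∞) ζ →
      ∫ x, ζ x * a x = - ∑ i, ∫ x, pderiv i ζ x * H i x) :
    ∫ x in U, f x * a x = - ∑ i, ∫ x in U, g x i * H i x := by
  have : IsFiniteMeasure (volume.restrict U) := ⟨by simpa using hUf.lt_top⟩
  let φ : ℕ → ContDiffBump (0 : Fin d → ℝ) := fun n =>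
    { rIn := 1 / (2 * ((n : ℝ) + 1)), rOut := 1 / ((n : ℝ) + 1), rIn_pos := by positivity,
      rIn_lt_rOut := by
        apply one_div_lt_one_div_of_lt <;> [positivity; linarith [(Nat.cast_nonneg n : (0:ℝ) ≤ n)]] }
  have hr : Tendsto (fun n => (φ n).rOut) atTop (𝓝 0) := tendsto_one_div_add_atTop_nhds_zero_nat
  let ρ : ℕ → (Fin d → ℝ) → ℝ := fun n => (φ n).normed volume
  let S : ℕ → ((Fin d → ℝ) → ℝ) → (Fin d → ℝ) → ℝ := fun n b =>
    (ρ n) ⋆[ContinuousLinearMap.lsmul ℝ ℝ, volume] b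
  have hρ : ∀ n, ContDiff ℝ ((⊤ : ℕ∞) : WithTop ℕ∞) (ρ n) := fun n => (φ n).contDiff_normed
  have hρc : ∀ n, HasCompactSupport (ρ n) := fun n => (φ n).hasCompactSupport_normed
  have hS : ∀ n b, Continuous b → ContDiff ℝ ((⊤ : ℕ∞) : WithTop ℕ∞) (S n b) := fun n b hb =>
    (hρc n).contDiff_convolution_left _ (hρ n) hb.locallyIntegrable
  have hder : ∀ n b, Continuous b → ∀ i x, pderiv i (S n b) x = ∫ t, pderiv i (ρ n) (x - t) * b t := by
    intro n b hb i x
    have h0 : S n b = b ⋆[ContinuousLinearMap.lsmul ℝ ℝ, volume] (ρ n) := by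
      funext y
      simp only [S]
      rw [convolution_lsmul_swap, convolution_def]
      simp [mul_comm]
    have h1 := (hρc n).hasFDerivAt_convolution_right (ContinuousLinearMap.lsmul ℝ ℝ)
      (hb.locallyIntegrable (μ := volume)) ((hρ n).of_le (by exact_mod_cast le_top)) x
    rw [h0, pderiv, h1.fderiv, convolution_precompR_apply _ hb.locallyIntegrable
      ((hρc n).fderiv ℝ) ((hρ n).continuous_fderiv (by simp)), convolution_def]
    simp [pderiv, mul_comm]
  have hdiv : ∀ n x, S n a x = ∑ i, pderiv i (S n (H i)) x := by
    intro n x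
    -- The distributional identity tested with the translated kernel is the identity for the
    -- mollified fields.
    have h1 := hz (fun t => ρ n (x - t)) ((hρ n).comp (contDiff_const.sub contDiff_id))
    simp only [hder n _ (hH _)]
    have h2 : ∀ i t, pderiv i (fun t => ρ n (x - t)) t = - pderiv i (ρ n) (x - t) := by
      intro i t
      have e1 : HasFDerivAt (fun t => ρ n (x - t)) _ t :=
        ((((hρ n).differentiable (by simp)) (x - t)).hasFDerivAt).comp t
          ((hasFDerivAt_id t).const_sub x)
      simp [pderiv, e1.fderiv]
    simp only [h2, neg_mul, integral_neg, Finset.sum_neg_distrib, neg_neg] at h1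
    rw [← h1]
    simp only [S]
    rw [convolution_lsmul_swap]
    simp
  have hlim : ∀ b, Continuous b → HasCompactSupport b → ∀ k, Integrable k (volume.restrict U) →
      Tendsto (fun n => ∫ x in U, k x * S n b x) atTop (𝓝 (∫ x in U, k x * b x)) := by
    intro b hb hbc k hk
    obtain ⟨M, hM⟩ := hb.bounded_above_of_compact_support hbc
    -- `3M`: the mollification differs from `b` by at most `2M`, and `|b| ≤ M`.
    refine tendsto_integral_of_dominated_convergence (fun x => ‖k x‖ * (3 * M)) ?_ ?_ ?_ ?_
    · exact fun n => hk.1.mul (hS n b hb).continuous.aestronglyMeasurable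
    · exact hk.norm.mul_const _
    · refine fun n => Eventually.of_forall fun x => ?_
      rw [norm_mul]
      gcongr
      have h1 : dist (S n b x) (b x) ≤ 2 * M := by
        refine (φ n).dist_normed_convolution_le hb.aestronglyMeasurable fun y _ => ?_
        rw [dist_eq_norm]
        linarith [norm_sub_le (b y) (b x), hM y, hM x]
      rw [dist_eq_norm] at h1
      have h2 := norm_add_le (S n b x - b x) (b x)
      rw [sub_add_cancel] at h2
      linarith [hM x]
    · refine Eventually.of_forall fun x => Tendsto.const_mul _ ?_
      exact ContDiffBump.convolution_tendsto_right_of_continuous hr hb x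
  have hf1 : Integrable f (volume.restrict U) := hf.memLp.integrable (by norm_num)
  have hg1 : ∀ i, Integrable (fun x => g x i) (volume.restrict U) := fun i =>
    (hf.memLp_grad i).integrable (by norm_num)
  have hsupp : ∀ᶠ n in atTop, ∀ i, HasCompactSupport (S n (H i)) ∧ tsupport (S n (H i)) ⊆ U := by
    rw [eventually_all]
    intro i
    obtain ⟨δ, hδ, hδU⟩ := (hHc i).isCompact.exists_cthickening_subset_open hU (hHU i)
    filter_upwards [hr.eventually (gt_mem_nhds hδ)] with n hn
    refine ⟨(hρc n).convolution _ (hHc i), subset_trans ?_ hδU⟩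
    refine closure_minimal ?_ Metric.isClosed_cthickening
    intro x hx
    obtain ⟨s, hs, t, ht, rfl⟩ := support_convolution_subset _ hx
    refine Metric.mem_cthickening_of_dist_le _ t _ _ (subset_tsupport _ ht) ?_
    have : s ∈ Metric.ball (0 : Fin d → ℝ) (φ n).rOut := by
      rw [← (φ n).support_normed_eq (μ := volume)]; exact hs
    simp at this ⊢
    linarith
  have hl := hlim a ha hac f hf1
  have hrr := (tendsto_finsetSum Finset.univ fun i _ => hlim (H i) (hH i) (hHc i) _ (hg1 i)).neg
  refine tendsto_nhds_unique hl (hrr.congr' ?_)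
  filter_upwards [hsupp] with n hn
  simp only [hdiv, Finset.mul_sum]
  rw [integral_finsetSum]
  · rw [← Finset.sum_neg_distrib]
    refine Finset.sum_congr rfl fun i _ => ?_
    rw [hf.integral_eq _ (hS n _ (hH i)) (hn i).1 (hn i).2 i]
  · intro i _
    have hc := continuous_pderiv ((hS n _ (hH i)).of_le (by exact_mod_cast le_top)) i
    obtain ⟨M, hM⟩ := hc.bounded_above_of_compact_support (hasCompactSupport_pderiv (hn i).1 i)
    exact hf1.mul_bdd (c := M) hc.aestronglyMeasurable (Eventually.of_forall hM)

/-- Needed because `θ` is only `C²`: products of a test function with the normal are no better than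
`C¹`. -/
theorem HasWeakGrad.integral_eq_of_contDiff_one {d : ℕ} {U : Set (Fin d → ℝ)} (hU : IsOpen U)
    (hUf : volume U ≠ ⊤) {f : (Fin d → ℝ) → ℝ} {g : (Fin d → ℝ) → Fin d → ℝ}
    (hf : HasWeakGrad U f g) {φ : (Fin d → ℝ) → ℝ} (hφ : ContDiff ℝ 1 φ)
    (hφc : HasCompactSupport φ) (hφU : tsupport φ ⊆ U) (i : Fin d) :
    ∫ x in U, f x * pderiv i φ x = - ∫ x in U, g x i * φ x := by
  have hcd : Continuous (pderiv i φ) := continuous_pderiv hφ i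
  have hcs : HasCompactSupport (pderiv i φ) := hasCompactSupport_pderiv hφc i
  have h := hf.integral_add_sum_eq_zero hU hUf (a := pderiv i φ)
    (H := fun j => if j = i then φ else 0) hcd hcs (fun j => ?_) (fun j => ?_) (fun j => ?_) ?_
  · rw [h, Finset.sum_eq_single i]
    · simp
    · intro j _ hj
      simp [hj]
    · simp
  · split_ifs <;> [exact hφ.continuous; exact continuous_zero]
  · split_ifs <;> [exact hφc; exact HasCompactSupport.zero]
  · split_ifs <;> [exact hφU; simp]
  · intro ζ hζ
    have hcζ : Continuous (pderiv i ζ) :=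
      (hζ.continuous_fderiv (by simp)).clm_apply continuous_const
    have := integral_mul_fderiv_eq_neg_fderiv_mul_of_integrable (μ := volume) (f := ζ) (g := φ)
      (v := Pi.single i 1)
      ((hcζ.mul hφ.continuous).integrable_of_hasCompactSupport hφc.mul_left)
      ((hζ.continuous.mul hcd).integrable_of_hasCompactSupport hcs.mul_left)
      ((hζ.continuous.mul hφ.continuous).integrable_of_hasCompactSupport hφc.mul_left)
      (fun x _ => hζ.differentiable (by simp) x) (fun x _ => hφ.differentiable (by simp) x)
    rw [Finset.sum_eq_single i]
    · simpa [pderiv] using this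
    · intro j _ hj
      simp [hj]
    · simp
theorem integrable_of_continuousOn_of_compact {E : Type*} [TopologicalSpace E] [T2Space E]
    [MeasurableSpace E] [BorelSpace E] {μ : Measure E} [IsFiniteMeasureOnCompacts μ]
    {b : E → ℝ} {K s : Set E} (hK : IsCompact K) (hKs : K ⊆ s) (hb : ContinuousOn b s)
    (h0 : ∀ p ∉ K, b p = 0) : Integrable b μ := by
  rw [← integrableOn_iff_integrable_of_support_subset (s := K)]
  · exact (hb.mono hKs).integrableOn_compact hK
  · intro p hp
    by_contra h
    exact hp (h0 p h)

/-- The function `b` on the source of a chart, transported to the target and extended by zero. -/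
noncomputable def transport {E : Type*} [TopologicalSpace E] (T : OpenPartialHomeomorph E E) (b : E → ℝ) : E → ℝ :=
  T.target.indicator (b ∘ T.symm)

section Transport

variable {E : Type*} [TopologicalSpace E] {T : OpenPartialHomeomorph E E} {b : E → ℝ}
  {K : Set E}

theorem transport_eq_zero (h0 : ∀ p ∉ K, b p = 0) {x : E} (hx : x ∉ T '' K) :
    transport T b x = 0 := by
  by_cases hxt : x ∈ T.target
  · rw [transport, indicator_of_mem hxt]
    exact h0 _ fun h => hx ⟨_, h, T.right_inv hxt⟩
  · rw [transport, indicator_of_notMem hxt]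

theorem isCompact_image_chart (hK : IsCompact K) (hKs : K ⊆ T.source) : IsCompact (T '' K) :=
  hK.image_of_continuousOn (T.continuousOn.mono hKs)

theorem continuous_transport [T2Space E] (hK : IsCompact K) (hKs : K ⊆ T.source)
    (hb : ContinuousOn b T.source) (h0 : ∀ p ∉ K, b p = 0) : Continuous (transport T b) := by
  rw [continuous_iff_continuousAt]
  intro x
  by_cases hx : x ∈ T '' K
  · have hxt : x ∈ T.target := by
      obtain ⟨p, hp, rfl⟩ := hx
      exact T.map_source (hKs hp)
    have h1 : ContinuousOn (b ∘ T.symm) T.target :=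
      hb.comp T.continuousOn_symm fun y hy => T.map_target hy
    refine (h1.continuousAt (T.open_target.mem_nhds hxt)).congr ?_
    filter_upwards [T.open_target.mem_nhds hxt] with y hy
    rw [transport, indicator_of_mem hy]
  · refine (continuousAt_const (y := (0 : ℝ))).congr ?_
    filter_upwards [(isCompact_image_chart hK hKs).isClosed.isOpen_compl.mem_nhds hx] with y hy
    exact (transport_eq_zero h0 hy).symm

theorem tsupport_transport_subset [T2Space E] (hK : IsCompact K) (hKs : K ⊆ T.source)
    (h0 : ∀ p ∉ K, b p = 0) : tsupport (transport T b) ⊆ T '' K :=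
  closure_minimal (fun x hx => by
    by_contra h
    exact hx (transport_eq_zero h0 h)) (isCompact_image_chart hK hKs).isClosed

theorem hasCompactSupport_transport [T2Space E] (hK : IsCompact K) (hKs : K ⊆ T.source)
    (h0 : ∀ p ∉ K, b p = 0) : HasCompactSupport (transport T b) :=
  (isCompact_image_chart hK hKs).of_isClosed_subset (isClosed_tsupport _)
    (tsupport_transport_subset hK hKs h0)

end Transport

theorem setIntegral_mul_transport {d : ℕ} {T : OpenPartialHomeomorph (Fin d → ℝ) (Fin d → ℝ)}
    (hT : ContDiffOn ℝ 1 T T.source) (b F : (Fin d → ℝ) → ℝ) :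
    ∫ x in T.target, F x * transport T b x =
      ∫ p in T.source, F (T p) * (|(fderiv ℝ T p).det| * b p) := by
  rw [← T.image_source_eq_target, integral_image_eq_integral_abs_det_fderiv_smul volume
    T.open_source.measurableSet (fun p hp => ((hT.differentiableOn (by simp) p hp).differentiableAt
      (T.open_source.mem_nhds hp)).hasFDerivAt.hasFDerivWithinAt) T.injOn]
  refine setIntegral_congr_fun T.open_source.measurableSet fun p hp => ?_
  simp only [transport, smul_eq_mul]
  rw [indicator_of_mem (T.map_source hp), Function.comp, T.left_inv hp]
  ring

theorem clm_apply_eq_sum {d : ℕ} (L : (Fin d → ℝ) →L[ℝ] ℝ) (w : Fin d → ℝ) :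
    L w = ∑ k, w k * L (Pi.single k 1) := by
  conv_lhs => rw [← Finset.univ_sum_single w, map_sum]
  refine Finset.sum_congr rfl fun k _ => ?_
  rw [← smul_eq_mul, ← map_smul, ← Pi.single_smul', smul_eq_mul, mul_one]

/-- The weak chain rule for composition with a `C¹` diffeomorphism. -/
theorem HasWeakGrad.integral_comp_chart {d : ℕ}
    {T : OpenPartialHomeomorph (Fin d → ℝ) (Fin d → ℝ)} (hT : ContDiffOn ℝ 1 T T.source)
    (hdet : ∀ p ∈ T.source, (fderiv ℝ T p).det ≠ 0) (hfin : volume T.target ≠ ⊤)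
    {f : (Fin d → ℝ) → ℝ} {g : (Fin d → ℝ) → Fin d → ℝ} (hf : HasWeakGrad T.target f g)
    {Φ : (Fin d → ℝ) → ℝ} (hΦ : ContDiff ℝ 1 Φ) (hΦc : HasCompactSupport Φ)
    (hΦs : tsupport Φ ⊆ T.source) (i : Fin d) :
    ∫ p in T.source, f (T p) * pderiv i Φ p =
      - ∑ k, ∫ p in T.source, g (T p) k * (pderiv i (fun q => T q k) p * Φ p) := by
  have hK : IsCompact (tsupport Φ) := hΦc
  have hTd : ∀ p ∈ T.source, DifferentiableAt ℝ T p := fun p hp =>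
    (hT.differentiableOn (by simp) p hp).differentiableAt (T.open_source.mem_nhds hp)
  have hTc : ContinuousOn (fderiv ℝ T) T.source :=
    hT.continuousOn_fderiv_of_isOpen T.open_source (by simp)
  have hJ : ContinuousOn (fun p => |(fderiv ℝ T p).det|) T.source :=
    (ContinuousLinearMap.continuous_det.comp_continuousOn hTc).abs
  have hJ0 : ∀ p ∈ T.source, |(fderiv ℝ T p).det| ≠ 0 := fun p hp => by simpa using hdet p hp
  have hTk : ∀ k, ∀ p ∈ T.source, pderiv i (fun q => T q k) p = fderiv ℝ T p (Pi.single i 1) k := by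
    intro k p hp
    have := (hasFDerivAt_pi'.1 (hTd p hp).hasFDerivAt k).fderiv
    simp [pderiv, this]
  have hTkc : ∀ k, ContinuousOn (pderiv i (fun q => T q k)) T.source := by
    intro k
    refine ContinuousOn.congr ?_ (hTk k)
    exact (continuous_apply k).comp_continuousOn (hTc.clm_apply continuousOn_const)
  -- Dividing by the Jacobian makes it cancel when the integrals over the target are pulled back.
  let a : (Fin d → ℝ) → ℝ := fun p => (|(fderiv ℝ T p).det|)⁻¹ * pderiv i Φ p
  let H : Fin d → (Fin d → ℝ) → ℝ := fun k p =>
    (|(fderiv ℝ T p).det|)⁻¹ * (pderiv i (fun q => T q k) p * Φ p)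
  have hΦ0 : ∀ p ∉ tsupport Φ, Φ p = 0 := fun p hp => image_eq_zero_of_notMem_tsupport hp
  have hdΦ0 : ∀ p ∉ tsupport Φ, pderiv i Φ p = 0 := fun p hp =>
    image_eq_zero_of_notMem_tsupport fun h => hp (tsupport_pderiv_subset Φ i h)
  have ha : ContinuousOn a T.source := (hJ.inv₀ hJ0).mul (continuous_pderiv hΦ i).continuousOn
  have ha0 : ∀ p ∉ tsupport Φ, a p = 0 := fun p hp => by simp [a, hdΦ0 p hp]
  have hH : ∀ k, ContinuousOn (H k) T.source := fun k =>
    (hJ.inv₀ hJ0).mul ((hTkc k).mul hΦ.continuous.continuousOn)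
  have hH0 : ∀ k, ∀ p ∉ tsupport Φ, H k p = 0 := fun k p hp => by simp [H, hΦ0 p hp]
  have hcv : ∀ F : (Fin d → ℝ) → ℝ, ∫ x in T.target, F x * transport T a x =
      ∫ p in T.source, F (T p) * pderiv i Φ p := by
    intro F
    rw [setIntegral_mul_transport hT]
    refine setIntegral_congr_fun T.open_source.measurableSet fun p hp => ?_
    simp only [a]
    rw [mul_inv_cancel_left₀ (hJ0 p hp)]
  have hcvH : ∀ k (F : (Fin d → ℝ) → ℝ), ∫ x in T.target, F x * transport T (H k) x =
      ∫ p in T.source, F (T p) * (pderiv i (fun q => T q k) p * Φ p) := by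
    intro k F
    rw [setIntegral_mul_transport hT]
    refine setIntegral_congr_fun T.open_source.measurableSet fun p hp => ?_
    simp only [H]
    rw [mul_inv_cancel_left₀ (hJ0 p hp)]
  have hfull : ∀ b F : (Fin d → ℝ) → ℝ, ∫ x, F x * transport T b x = ∫ x in T.target, F x * transport T b x := by
    intro b F
    rw [setIntegral_eq_integral_of_forall_compl_eq_zero]
    intro x hx
    simp [transport, hx]
  have hUi : T '' tsupport Φ ⊆ T.target := by
    rintro _ ⟨p, hp, rfl⟩
    exact T.map_source (hΦs hp)
  have key := hf.integral_add_sum_eq_zero T.open_target hfin (a := transport T a)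
    (H := fun k => transport T (H k)) (continuous_transport hK hΦs ha ha0)
    (hasCompactSupport_transport hK hΦs ha0)
    (fun k => continuous_transport hK hΦs (hH k) (hH0 k))
    (fun k => hasCompactSupport_transport hK hΦs (hH0 k))
    (fun k => (tsupport_transport_subset hK hΦs (hH0 k)).trans hUi) ?_
  · simpa only [hcv, hcvH] using key
  · intro ζ hζ
    simp only [hfull, hcv, hcvH]
    have hζd : ∀ x, DifferentiableAt ℝ ζ x := hζ.differentiable (by simp)
    have hcomp : ∀ p ∈ T.source, fderiv ℝ (fun q => ζ (T q)) p (Pi.single i 1) =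
        ∑ k, pderiv k ζ (T p) * pderiv i (fun q => T q k) p := by
      intro p hp
      have h1 : HasFDerivAt (fun q => ζ (T q)) _ p :=
        (hζd (T p)).hasFDerivAt.comp p (hTd p hp).hasFDerivAt
      rw [h1.fderiv, ContinuousLinearMap.comp_apply, clm_apply_eq_sum]
      refine Finset.sum_congr rfl fun k _ => ?_
      rw [hTk k p hp, mul_comm]
      rfl
    have hζT : ContinuousOn (fun q => ζ (T q)) T.source := hζ.continuous.comp_continuousOn T.continuousOn
    have hck : ∀ k, ContinuousOn (fun p => pderiv k ζ (T p) * (pderiv i (fun q => T q k) p * Φ p))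
        T.source := fun k =>
      ((continuous_pderiv (hζ.of_le (by exact_mod_cast le_top)) k).comp_continuousOn
        T.continuousOn).mul ((hTkc k).mul hΦ.continuous.continuousOn)
    have hik : ∀ k, Integrable (fun p => pderiv k ζ (T p) * (pderiv i (fun q => T q k) p * Φ p)) :=
      fun k => integrable_of_continuousOn_of_compact hK hΦs (hck k) fun p hp => by simp [hΦ0 p hp]
    have hs : ∀ p, fderiv ℝ (fun q => ζ (T q)) p (Pi.single i 1) * Φ p =
        ∑ k, pderiv k ζ (T p) * (pderiv i (fun q => T q k) p * Φ p) := by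
      intro p
      by_cases hp : p ∈ tsupport Φ
      · rw [hcomp p (hΦs hp), Finset.sum_mul]
        exact Finset.sum_congr rfl fun k _ => by ring
      · simp [hΦ0 p hp]
    -- That the transported `a` is the divergence of the transported `H` amounts to the classical
    -- chain rule for `ζ ∘ T`, integrated by parts. This composition need only be differentiable on
    -- the support of `Φ`, which lies in the source of the chart.
    have hparts := integral_mul_fderiv_eq_neg_fderiv_mul_of_integrable (μ := volume)
      (f := fun q => ζ (T q)) (g := Φ) (v := Pi.single i 1) ?_ ?_ ?_ ?_
      (fun x _ => hΦ.differentiable (by simp) x)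
    · rw [setIntegral_eq_integral_of_forall_compl_eq_zero
        (fun p hp => by rw [hdΦ0 p fun h => hp (hΦs h), mul_zero])]
      refine hparts.trans ?_
      congr 1
      simp only [hs]
      rw [integral_finsetSum _ fun k _ => hik k]
      refine Finset.sum_congr rfl fun k _ => ?_
      rw [setIntegral_eq_integral_of_forall_compl_eq_zero
        (fun p hp => by rw [hΦ0 p fun h => hp (hΦs h), mul_zero, mul_zero])]
    · simp only [hs]
      exact integrable_finsetSum _ fun k _ => hik k
    · exact integrable_of_continuousOn_of_compact hK hΦs
        (hζT.mul (continuous_pderiv hΦ i).continuousOn)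
        fun p hp => by rw [← pderiv, hdΦ0 p hp, mul_zero]
    · exact integrable_of_continuousOn_of_compact hK hΦs
        (hζT.mul hΦ.continuous.continuousOn) fun p hp => by rw [hΦ0 p hp, mul_zero]
    · exact fun p hp => (hζd (T p)).comp p (hTd p (hΦs hp))

/-! ### Periodic functions and the geometry of the wrinkled shell. -/

section Periodic

variable {f : V2 → ℝ}

theorem IsPeriodic.add_int (hf : IsPeriodic f) (y : V2) (k : Fin 2 → ℤ) :
    f (y + fun i => (k i : ℝ)) = f y := by
  have h0 : Function.Periodic f (Pi.single 0 1) := hf 0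
  have h1 : Function.Periodic f (Pi.single 1 1) := hf 1
  have : (fun i => (k i : ℝ)) = k 0 • (Pi.single 0 1 : V2) + k 1 • (Pi.single 1 1 : V2) := by
    ext i; fin_cases i <;> simp
  rw [this, ← add_assoc, h1.zsmul (k 1), h0.zsmul (k 0)]

theorem IsPeriodic.fract (hf : IsPeriodic f) (y : V2) : f (fun i => Int.fract (y i)) = f y := by
  rw [← hf.add_int _ fun i => ⌊y i⌋]
  congr 1
  ext i
  simp

theorem fract_mem_cell (y : V2) : (fun i => Int.fract (y i)) ∈ cell :=
  ⟨fun _ => Int.fract_nonneg _, fun _ => (Int.fract_lt_one _).le⟩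

theorem isCompact_cell : IsCompact cell := isCompact_Icc

theorem IsPeriodic.exists_bound (hf : IsPeriodic f) (hc : Continuous f) :
    ∃ M, 0 < M ∧ ∀ y, |f y| ≤ M := by
  obtain ⟨M, hM⟩ := isCompact_cell.exists_bound_of_continuousOn hc.continuousOn
  refine ⟨max M 1, by positivity, fun y => ?_⟩
  rw [← hf.fract]
  exact (hM _ (fract_mem_cell y)).trans (le_max_left _ _)

theorem IsPeriodic.pderiv (hf : IsPeriodic f) (i : Fin 2) : IsPeriodic (pderiv i f) := by
  intro j y
  simp only [WrinkledPlate.pderiv]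
  rw [← fderiv_comp_add_right]
  simp only [hf j]

theorem norm_clm_le_sum {d : ℕ} (L : (Fin d → ℝ) →L[ℝ] ℝ) : ‖L‖ ≤ ∑ k, |L (Pi.single k 1)| := by
  refine L.opNorm_le_bound (Finset.sum_nonneg fun _ _ => abs_nonneg _) fun w => ?_
  rw [clm_apply_eq_sum, Finset.sum_mul]
  refine (Finset.abs_sum_le_sum_abs _ _).trans (Finset.sum_le_sum fun k _ => ?_)
  rw [abs_mul, mul_comm]
  gcongr
  exact norm_le_pi_norm w k

theorem IsPeriodic.exists_lipschitz (hf : IsPeriodic f) (hc : ContDiff ℝ 1 f) :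
    ∃ M, 0 < M ∧ ∀ y z, |f y - f z| ≤ M * ‖y - z‖ := by
  choose M hM0 hM using fun i => (hf.pderiv i).exists_bound (continuous_pderiv hc i)
  refine ⟨∑ i, M i, Finset.sum_pos (fun i _ => hM0 i) Finset.univ_nonempty, fun y z => ?_⟩
  refine convex_univ.norm_image_sub_le_of_norm_fderiv_le (𝕜 := ℝ) (f := f)
    (fun x _ => hc.differentiable (by simp) x) (fun x _ => ?_) (mem_univ z) (mem_univ y)
  exact (norm_clm_le_sum _).trans (Finset.sum_le_sum fun i _ => hM i x)

end Periodic

/-- The upward unit normal of a plane with slope `p`. -/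
noncomputable def unitNormal (p : V2) : V3 :=
  (Real.sqrt (p 0 ^ 2 + p 1 ^ 2 + 1))⁻¹ • ![-p 0, -p 1, 1]

theorem contDiff_unitNormal : ContDiff ℝ 1 unitNormal := by
  have h1 : ContDiff ℝ 1 fun p : V2 => Real.sqrt (p 0 ^ 2 + p 1 ^ 2 + 1) :=
    ContDiff.sqrt (by fun_prop) fun p => by positivity
  have h2 : ContDiff ℝ 1 fun p : V2 => (![-p 0, -p 1, 1] : V3) := by
    rw [contDiff_pi]
    intro i
    fin_cases i <;> simp <;> fun_prop
  exact (h1.inv fun p => by positivity).smul h2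

theorem unitNormal_zero : unitNormal 0 = e3 := by
  ext i
  fin_cases i <;> simp [unitNormal, e3]

noncomputable def slope (θ : V2 → ℝ) (h : ℝ) (x : V2) : V2 := fun i => h * pderiv i θ (h⁻¹ • x)

theorem normal_eq (θ : V2 → ℝ) (h : ℝ) (x : V2) : normal θ h x = unitNormal (slope θ h x) := by
  simp only [normal, unitNormal, slope, mul_pow]

theorem contDiff_pderiv {θ : V2 → ℝ} (hθ : ContDiff ℝ 2 θ) (i : Fin 2) :
    ContDiff ℝ 1 (pderiv i θ) :=
  (hθ.fderiv_right (by norm_num)).clm_apply contDiff_const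

theorem contDiff_normal {θ : V2 → ℝ} (hθ : ContDiff ℝ 2 θ) (h : ℝ) : ContDiff ℝ 1 (normal θ h) := by
  have : normal θ h = unitNormal ∘ slope θ h := funext (normal_eq θ h)
  rw [this]
  refine contDiff_unitNormal.comp (contDiff_pi.2 fun i => ?_)
  exact contDiff_const.mul ((contDiff_pderiv hθ i).comp (contDiff_const_smul (h⁻¹ : ℝ)))

/-- The slope is `h ∇θ(x/h)`: it has size `O(h)`, but Lipschitz constant only `O(1)`, as the factor
`h` is used up by the oscillation. The normal is a smooth function of the slope. -/
theorem exists_normal_bounds {θ : V2 → ℝ} (hθ : ContDiff ℝ 2 θ) (hθp : IsPeriodic θ) :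
    ∃ C, 0 < C ∧ ∀ h, 0 < h → h ≤ 1 → (∀ x, ‖normal θ h x - e3‖ ≤ C * h) ∧
      ∀ x z, ‖normal θ h x - normal θ h z‖ ≤ C * ‖x - z‖ := by
  choose M hM0 hM using fun i => (hθp.pderiv i).exists_bound (contDiff_pderiv hθ i).continuous
  choose N hN0 hN using fun i => (hθp.pderiv i).exists_lipschitz (contDiff_pderiv hθ i)
  obtain ⟨K, hK⟩ := (isCompact_closedBall (0 : V2) (∑ i, M i)).exists_bound_of_continuousOn
    (contDiff_unitNormal.continuous_fderiv (by simp)).continuousOn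
  have hL : ∀ p ∈ Metric.closedBall (0 : V2) (∑ i, M i), ∀ q ∈ Metric.closedBall (0 : V2) (∑ i, M i),
      ‖unitNormal p - unitNormal q‖ ≤ K * ‖p - q‖ := fun p hp q hq =>
    (convex_closedBall (0 : V2) _).norm_image_sub_le_of_norm_fderiv_le (𝕜 := ℝ)
      (fun x _ => contDiff_unitNormal.differentiable (by simp) x) hK hq hp
  have hK0 : 0 ≤ K := (norm_nonneg _).trans
    (hK 0 (Metric.mem_closedBall_self (Finset.sum_nonneg fun i _ => (hM0 i).le)))
  have hsl : ∀ h, 0 < h → ∀ x, ‖slope θ h x‖ ≤ (∑ i, M i) * h := by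
    intro h hh x
    refine (pi_norm_le_iff_of_nonneg (by have := Finset.sum_nonneg fun i (_ : i ∈ Finset.univ) => (hM0 i).le; positivity)).2 fun i => ?_
    rw [slope, norm_mul, Real.norm_of_nonneg hh.le, mul_comm]
    gcongr
    exact (hM i _).trans (Finset.single_le_sum (fun i _ => (hM0 i).le) (Finset.mem_univ i))
  have hMs : 0 ≤ ∑ i, M i := Finset.sum_nonneg fun i _ => (hM0 i).le
  have hNs : 0 ≤ ∑ i, N i := Finset.sum_nonneg fun i _ => (hN0 i).le
  have hmem : ∀ h, 0 < h → h ≤ 1 → ∀ x, slope θ h x ∈ Metric.closedBall (0 : V2) (∑ i, M i) := by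
    intro h hh h1 x
    rw [mem_closedBall_zero_iff]
    exact (hsl h hh x).trans (mul_le_of_le_one_right hMs h1)
  refine ⟨K * (∑ i, M i) + K * (∑ i, N i) + 1, by positivity, fun h hh h1 => ⟨fun x => ?_, fun x z => ?_⟩⟩
  · rw [normal_eq, ← unitNormal_zero]
    refine (hL _ (hmem h hh h1 x) 0 (Metric.mem_closedBall_self hMs)).trans ?_
    rw [sub_zero]
    calc K * ‖slope θ h x‖ ≤ K * ((∑ i, M i) * h) := by gcongr; exact hsl h hh x
      _ ≤ _ := by
        have : 0 ≤ K * ∑ i, N i := by positivity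
        nlinarith
  · rw [normal_eq, normal_eq]
    refine (hL _ (hmem h hh h1 x) _ (hmem h hh h1 z)).trans ?_
    have : ‖slope θ h x - slope θ h z‖ ≤ (∑ i, N i) * ‖x - z‖ := by
      refine (pi_norm_le_iff_of_nonneg (by positivity)).2 fun i => ?_
      rw [Pi.sub_apply, slope, slope, ← mul_sub, norm_mul, Real.norm_of_nonneg hh.le]
      have h3 := hN i (h⁻¹ • x) (h⁻¹ • z)
      rw [← smul_sub, norm_smul, Real.norm_of_nonneg (inv_pos.2 hh).le] at h3
      calc _ ≤ h * (N i * (h⁻¹ * ‖x - z‖)) := by gcongr; exact h3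
        _ = N i * ‖x - z‖ := by field_simp
        _ ≤ _ := by
          gcongr
          exact Finset.single_le_sum (fun i _ => (hN0 i).le) (Finset.mem_univ i)
    calc K * ‖slope θ h x - slope θ h z‖ ≤ K * ((∑ i, N i) * ‖x - z‖) := by gcongr
      _ ≤ _ := by
        have : 0 ≤ (K * ∑ i, M i) * ‖x - z‖ := by positivity
        nlinarith [norm_nonneg (x - z)]

/-- The identification of `ℝ³` with `ℝ² × ℝ`. -/
noncomputable def split : V3 →L[ℝ] V2 × ℝ :=
  (ContinuousLinearMap.pi fun i : Fin 2 => ContinuousLinearMap.proj i.castSucc).prod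
    (ContinuousLinearMap.proj 2)

theorem split_fst (z : V3) (i : Fin 2) : (split z).1 i = z i.castSucc := rfl

theorem split_snd (z : V3) : (split z).2 = z 2 := rfl

noncomputable def splitEquiv : V3 ≃ᵐ V2 × ℝ :=
  (MeasurableEquiv.piFinSuccAbove (fun _ : Fin 3 => ℝ) (Fin.last 2)).trans MeasurableEquiv.prodComm

theorem coe_splitEquiv : ⇑splitEquiv = split := by
  funext z
  refine Prod.ext ?_ rfl
  funext i
  change z ((Fin.last 2).succAbove i) = _
  rw [Fin.succAbove_last, split_fst]

theorem measurePreserving_splitEquiv :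
    MeasurePreserving splitEquiv (volume : Measure V3) (volume : Measure (V2 × ℝ)) :=
  (volume_preserving_piFinSuccAbove (fun _ : Fin 3 => ℝ) (Fin.last 2)).trans
    Measure.measurePreserving_swap

theorem surjective_split : Function.Surjective split := by
  rw [← coe_splitEquiv]; exact splitEquiv.surjective

theorem norm_split_fst_le (z : V3) : ‖(split z).1‖ ≤ ‖z‖ :=
  (pi_norm_le_iff_of_nonneg (norm_nonneg _)).2 fun _ => norm_le_pi_norm z _

theorem isOpen_plate {ω : Set V2} (hω : IsOpen ω) (h : ℝ) : IsOpen (plate ω h) :=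
  hω.prod isOpen_Ioo

theorem Theta_split_eq (θ : V2 → ℝ) (h : ℝ) (z : V3) :
    Theta θ h (split z) = z + ((h ^ 2 * θ (h⁻¹ • (split z).1)) • e3 +
      z 2 • (normal θ h (split z).1 - e3)) := by
  ext k
  fin_cases k <;> simp [Theta, e3, split_fst, split_snd] <;> ring

/-- In the thin layer the parametrization is an `O(h)` perturbation of the identity: `h² θ(x/h)` has
slope `O(h)`, the normal is `O(h)`-close to `e₃`, and its `O(1)` variation is multiplied by `|x₃| <
h²`. Both injectivity and the Jacobian estimate follow from this. -/
theorem exists_lipschitz_Theta {θ : V2 → ℝ} (hθ : ContDiff ℝ 2 θ) (hθp : IsPeriodic θ) :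
    ∃ C : NNReal, 0 < C ∧ ∀ h : ℝ, 0 < h → h ≤ 1 →
      LipschitzOnWith (C * Real.toNNReal h) (fun z => Theta θ h (split z) - z) {z | |z 2| < h ^ 2} := by
  obtain ⟨C, hC0, hC⟩ := exists_normal_bounds hθ hθp
  obtain ⟨N, hN0, hN⟩ := hθp.exists_lipschitz (hθ.of_le (by norm_num))
  refine ⟨Real.toNNReal (N + 2 * C), by simp; positivity, fun h hh h1 => ?_⟩
  obtain ⟨hn1, hn2⟩ := hC h hh h1
  refine LipschitzOnWith.of_dist_le_mul fun z hz w hw => ?_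
  have he3 : ‖e3‖ ≤ 1 := by
    refine (pi_norm_le_iff_of_nonneg (by norm_num)).2 fun i => ?_
    fin_cases i <;> simp [e3]
  have hxw : ‖(split z).1 - (split w).1‖ ≤ ‖z - w‖ := by
    have := norm_split_fst_le (z - w)
    rwa [map_sub] at this
  have hzw : |z 2 - w 2| ≤ ‖z - w‖ := norm_le_pi_norm (z - w) 2
  have heq : Theta θ h (split z) - z - (Theta θ h (split w) - w) =
      (h ^ 2 * (θ (h⁻¹ • (split z).1) - θ (h⁻¹ • (split w).1))) • e3 +
      (z 2 - w 2) • (normal θ h (split z).1 - e3) +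
      w 2 • (normal θ h (split z).1 - normal θ h (split w).1) := by
    rw [Theta_split_eq, Theta_split_eq]
    module
  rw [dist_eq_norm, dist_eq_norm, heq]
  push_cast
  rw [Real.coe_toNNReal _ (by positivity), Real.coe_toNNReal _ hh.le]
  have t1 : ‖(h ^ 2 * (θ (h⁻¹ • (split z).1) - θ (h⁻¹ • (split w).1))) • e3‖ ≤ N * h * ‖z - w‖ := by
    rw [norm_smul, norm_mul, Real.norm_of_nonneg (by positivity : 0 ≤ h ^ 2)]
    have := hN (h⁻¹ • (split z).1) (h⁻¹ • (split w).1)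
    rw [← smul_sub, norm_smul, Real.norm_of_nonneg (inv_pos.2 hh).le] at this
    calc _ ≤ h ^ 2 * (N * (h⁻¹ * ‖(split z).1 - (split w).1‖)) * 1 := by
          gcongr; exact this
      _ = N * h * ‖(split z).1 - (split w).1‖ := by field_simp
      _ ≤ _ := by gcongr
  have t2 : ‖(z 2 - w 2) • (normal θ h (split z).1 - e3)‖ ≤ C * h * ‖z - w‖ := by
    rw [norm_smul, Real.norm_eq_abs]
    calc _ ≤ ‖z - w‖ * (C * h) := by gcongr; exact hn1 _
      _ = _ := by ring
  have t3 : ‖w 2 • (normal θ h (split z).1 - normal θ h (split w).1)‖ ≤ C * h * ‖z - w‖ := by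
    rw [norm_smul, Real.norm_eq_abs]
    have hw2 : |w 2| ≤ h := by
      have : |w 2| < h ^ 2 := hw
      nlinarith
    calc _ ≤ h * (C * ‖(split z).1 - (split w).1‖) := by gcongr; exact hn2 _ _
      _ ≤ h * (C * ‖z - w‖) := by gcongr
      _ = _ := by ring
  refine (norm_add₃_le).trans ?_
  linarith

theorem contDiff_Theta_split {θ : V2 → ℝ} (hθ : ContDiff ℝ 2 θ) (h : ℝ) :
    ContDiff ℝ 1 fun z => Theta θ h (split z) := by
  simp only [Theta_split_eq]
  have h1 : ContDiff ℝ 1 fun z => (split z).1 := contDiff_fst.comp split.contDiff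
  have h2 : ContDiff ℝ 1 fun z : V3 => θ (h⁻¹ • (split z).1) :=
    (hθ.of_le (by norm_num)).comp (h1.const_smul _)
  have h3 : ContDiff ℝ 1 fun z : V3 => normal θ h (split z).1 := (contDiff_normal hθ h).comp h1
  have h4 : ContDiff ℝ 1 fun z : V3 => z 2 := contDiff_apply ℝ ℝ 2
  exact contDiff_id.add (((contDiff_const.mul h2).smul contDiff_const).add
    (h4.smul (h3.sub contDiff_const)))

/-- The anisotropic scaling `(x₁, x₂, x₃) ↦ (x₁, x₂, t x₃)`. -/
noncomputable def thicken (t : ℝ) : V3 →L[ℝ] V3 :=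
  LinearMap.toContinuousLinearMap (Matrix.toLin' (Matrix.diagonal ![1, 1, t]))

theorem thicken_apply (t : ℝ) (z : V3) : thicken t z = ![z 0, z 1, t * z 2] := by
  ext i
  fin_cases i <;> simp [thicken, Matrix.mulVec_diagonal]

theorem det_thicken (t : ℝ) : (thicken t).det = t := by
  simp [thicken, ContinuousLinearMap.det, LinearMap.det_toLin', Matrix.det_diagonal, Fin.prod_univ_three]

noncomputable def thickenEquiv (t : ℝ) (ht : t ≠ 0) : V3 ≃L[ℝ] V3 :=
  ContinuousLinearEquiv.equivOfInverse (thicken t) (thicken t⁻¹)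
    (fun z => by ext i; fin_cases i <;> simp [thicken_apply, ht])
    (fun z => by ext i; fin_cases i <;> simp [thicken_apply, ht])

theorem ThetaP_split (θ : V2 → ℝ) (h : ℝ) (z : V3) :
    ThetaP θ h (split z) = Theta θ h (split (thicken (h ^ 2) z)) := by
  rw [ThetaP]
  congr 1
  refine Prod.ext ?_ ?_
  · ext i; fin_cases i <;> simp [thicken_apply, split_fst]
  · simp [thicken_apply, split_snd]

theorem ThetaP_image_plate {ω : Set V2} (θ : V2 → ℝ) {h : ℝ} (hh : 0 < h) :
    ThetaP θ h '' plate ω 1 = shell ω θ h := by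
  have : plate ω h = (fun p : V2 × ℝ => (p.1, h ^ 2 * p.2)) '' plate ω 1 := by
    ext ⟨x, t⟩
    simp only [plate, mem_image, mem_prod, mem_Ioo, Prod.mk.injEq, Prod.exists]
    constructor
    · rintro ⟨hx, h1, h2⟩
      refine ⟨x, t / h ^ 2, ⟨hx, ?_, ?_⟩, rfl, by field_simp⟩
      · rw [lt_div_iff₀ (by positivity)]; linarith
      · rw [div_lt_iff₀ (by positivity)]; linarith
    · rintro ⟨x', t', ⟨hx, h1, h2⟩, rfl, rfl⟩
      have : 0 < h ^ 2 := by positivity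
      refine ⟨hx, by nlinarith, by nlinarith⟩
  rw [shell, this, image_image]
  rfl

/-- A perturbation of the identity with Lipschitz constant `C h < 1` is a homeomorphism of the open
layer onto its open image; it is precomposed with the thickness scaling and restricted to the plate.
-/
theorem exists_chart {θ : V2 → ℝ} (hθ : ContDiff ℝ 2 θ) (hθp : IsPeriodic θ) {ω : Set V2}
    (hω : IsOpen ω) :
    ∃ h₀ > 0, ∀ h, 0 < h → h < h₀ → ∃ T : OpenPartialHomeomorph V3 V3,
      (T : V3 → V3) = (fun z => ThetaP θ h (split z)) ∧ T.source = split ⁻¹' plate ω 1 ∧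
        T.target = shell ω θ h := by
  obtain ⟨C, hC0, hC⟩ := exists_lipschitz_Theta hθ hθp
  refine ⟨min 1 (C : ℝ)⁻¹, lt_min one_pos (inv_pos.2 hC0), fun h hh h1 => ?_⟩
  have hap : ApproximatesLinearOn (fun z => Theta θ h (split z))
      ((ContinuousLinearEquiv.refl ℝ V3 : V3 ≃L[ℝ] V3) : V3 →L[ℝ] V3) {z | |z 2| < h ^ 2} (C * Real.toNNReal h) := by
    rw [ApproximatesLinearOn.approximatesLinearOn_iff_lipschitzOnWith]
    exact hC h hh (h1.le.trans (min_le_left _ _))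
  have hopen : IsOpen {z : V3 | |z 2| < h ^ 2} := isOpen_lt (by fun_prop) continuous_const
  have hc : C * Real.toNNReal h < 1 := by
    rw [← NNReal.coe_lt_coe]
    push_cast
    rw [Real.coe_toNNReal _ hh.le]
    have := h1.trans_le (min_le_right _ _)
    rwa [lt_inv_comm₀ hh (by exact_mod_cast hC0), ← one_div, lt_div_iff₀ hh] at this
  let e := hap.toOpenPartialHomeomorph _ _ (Or.inr (by simpa using hc)) hopen
  have hh2 : h ^ 2 ≠ 0 := by positivity
  let T₀ := (thickenEquiv (h ^ 2) hh2).toHomeomorph.toOpenPartialHomeomorph.trans e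
  have hS : IsOpen (split ⁻¹' plate ω 1) := (isOpen_plate hω 1).preimage split.continuous
  have hcoe : (T₀ : V3 → V3) = fun z => ThetaP θ h (split z) := by
    funext z
    rw [ThetaP_split]
    rfl
  have hsrc : split ⁻¹' plate ω 1 ⊆ T₀.source := by
    intro z hz
    refine ⟨mem_univ _, ?_⟩
    change |thicken (h ^ 2) z 2| < h ^ 2
    have hz2 : z 2 ∈ Ioo (-(1 ^ 2 / 2 : ℝ)) (1 ^ 2 / 2) := hz.2
    have : |z 2| < 1 := abs_lt.2 ⟨by linarith [hz2.1], by linarith [hz2.2]⟩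
    simp only [thicken_apply, Matrix.cons_val, abs_mul, abs_of_pos (by positivity : 0 < h ^ 2)]
    nlinarith [pow_pos hh 2]
  refine ⟨T₀.restrOpen _ hS, hcoe, ?_, ?_⟩
  · rw [OpenPartialHomeomorph.restrOpen_source]
    exact inter_eq_right.2 hsrc
  · rw [← OpenPartialHomeomorph.image_source_eq_target, OpenPartialHomeomorph.restrOpen_source,
      inter_eq_right.2 hsrc]
    change T₀ '' _ = _
    rw [hcoe, ← ThetaP_image_plate θ hh]
    change (ThetaP θ h ∘ split) '' _ = _
    rw [image_comp, image_preimage_eq _ surjective_split]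

/-- The derivative of the parametrization is `O(h)`-close to the identity, where the determinant is
continuous; the scaling of the thickness contributes exactly `h²`. -/
theorem abs_det_fderiv_ThetaP {θ : V2 → ℝ} (hθ : ContDiff ℝ 2 θ) (hθp : IsPeriodic θ) {δ : ℝ}
    (hδ : 0 < δ) :
    ∃ h₀ > 0, ∀ h, 0 < h → h < h₀ → ∀ z : V3, |z 2| < 1 →
      |(fderiv ℝ (fun z => ThetaP θ h (split z)) z).det - h ^ 2| ≤ δ * h ^ 2 := by
  obtain ⟨C, hC0, hC⟩ := exists_lipschitz_Theta hθ hθp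
  have hdet := (ContinuousLinearMap.continuous_det (𝕜 := ℝ) (E := V3)).continuousAt
    (x := ContinuousLinearMap.id ℝ V3)
  obtain ⟨η, hη, H⟩ := Metric.continuousAt_iff.1 hdet δ hδ
  refine ⟨min 1 (η / C), lt_min one_pos (by positivity), fun h hh h1 z hz => ?_⟩
  have hopen : IsOpen {z : V3 | |z 2| < h ^ 2} := isOpen_lt (by fun_prop) continuous_const
  have hmem : thicken (h ^ 2) z ∈ {z : V3 | |z 2| < h ^ 2} := by
    simp only [mem_ofPred_eq, thicken_apply, Matrix.cons_val, abs_mul, abs_of_pos (by positivity : 0 < h ^ 2)]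
    nlinarith [pow_pos hh 2]
  have hd : HasFDerivAt (fun z => Theta θ h (split z)) (fderiv ℝ (fun z => Theta θ h (split z))
      (thicken (h ^ 2) z)) (thicken (h ^ 2) z) :=
    ((contDiff_Theta_split hθ h).differentiable (by simp) _).hasFDerivAt
  have hn := (hd.sub (hasFDerivAt_id _)).le_of_lipschitzOn (hopen.mem_nhds hmem)
    (hC h hh (h1.le.trans (min_le_left _ _)))
  set L := fderiv ℝ (fun z => Theta θ h (split z)) (thicken (h ^ 2) z) with hL
  have hcomp : fderiv ℝ (fun z => ThetaP θ h (split z)) z = L.comp (thicken (h ^ 2)) := by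
    have : (fun z => ThetaP θ h (split z)) = (fun z => Theta θ h (split z)) ∘ thicken (h ^ 2) := by
      funext z; exact ThetaP_split θ h z
    rw [this]
    exact (hd.comp z (thicken (h ^ 2)).hasFDerivAt).fderiv
  have hdc : (L.comp (thicken (h ^ 2))).det = L.det * h ^ 2 := by
    have : (L.comp (thicken (h ^ 2))).det = L.det * (thicken (h ^ 2)).det := LinearMap.det_comp _ _
    rw [this, det_thicken]
  have hclose : dist L (ContinuousLinearMap.id ℝ V3) < η := by
    rw [dist_eq_norm]
    refine hn.trans_lt ?_
    push_cast
    rw [Real.coe_toNNReal _ hh.le, mul_comm]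
    have hC' : (0 : ℝ) < C := by exact_mod_cast hC0
    rw [← lt_div_iff₀ hC']
    exact h1.trans_le (min_le_right _ _)
  have := H hclose
  rw [Real.dist_eq] at this
  have hid : (ContinuousLinearMap.id ℝ V3).det = 1 := by simp [ContinuousLinearMap.det]
  rw [hid] at this
  rw [hcomp, hdc, show L.det * h ^ 2 - h ^ 2 = (L.det - 1) * h ^ 2 by ring, abs_mul,
    abs_of_pos (by positivity : 0 < h ^ 2)]
  gcongr

/-! ### Derivatives of the parametrization, and change of variables between plate and shell. -/

section Pderiv

variable {d : ℕ} {f g : (Fin d → ℝ) → ℝ} {x : Fin d → ℝ}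

theorem pderiv_add (i : Fin d) (hf : DifferentiableAt ℝ f x) (hg : DifferentiableAt ℝ g x) :
    pderiv i (fun x => f x + g x) x = pderiv i f x + pderiv i g x := by
  simp only [pderiv]; rw [fderiv_fun_add hf hg]; rfl

theorem pderiv_mul (i : Fin d) (hf : DifferentiableAt ℝ f x) (hg : DifferentiableAt ℝ g x) :
    pderiv i (fun x => f x * g x) x = f x * pderiv i g x + pderiv i f x * g x := by
  simp only [pderiv]; rw [fderiv_fun_mul hf hg]; simp [mul_comm]

theorem pderiv_const (i : Fin d) (c : ℝ) : pderiv i (fun _ => c) x = 0 := by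
  simp [pderiv]

theorem pderiv_const_mul (i : Fin d) (c : ℝ) (hf : DifferentiableAt ℝ f x) :
    pderiv i (fun x => c * f x) x = c * pderiv i f x := by
  simp only [pderiv]; rw [fderiv_const_mul hf]; rfl

theorem pderiv_apply (i j : Fin d) : pderiv i (fun x => x j) x = if i = j then 1 else 0 := by
  have : HasFDerivAt (fun x : Fin d → ℝ => x j) (ContinuousLinearMap.proj (R := ℝ) (φ := fun _ => ℝ) j) x :=
    (ContinuousLinearMap.proj (R := ℝ) (φ := fun _ : Fin d => ℝ) j).hasFDerivAt
  rw [pderiv, this.fderiv]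
  simp [Pi.single_apply, eq_comm]

theorem pderiv_comp_smul (i : Fin d) (c : ℝ) (hf : DifferentiableAt ℝ f (c • x)) :
    pderiv i (fun x => f (c • x)) x = c * pderiv i f (c • x) := by
  have h1 : HasFDerivAt (fun x => f (c • x)) _ x :=
    hf.hasFDerivAt.comp x ((hasFDerivAt_id x).const_smul c)
  rw [pderiv, h1.fderiv]
  simp [pderiv]

end Pderiv

theorem hasFDerivAt_comp_split_fst {G : V2 → ℝ} {z : V3} (hG : DifferentiableAt ℝ G (split z).1) :
    HasFDerivAt (fun z => G (split z).1)
      ((fderiv ℝ G (split z).1).comp ((ContinuousLinearMap.fst ℝ V2 ℝ).comp split)) z :=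
  hG.hasFDerivAt.comp z ((ContinuousLinearMap.fst ℝ V2 ℝ).comp split).hasFDerivAt

theorem split_single_castSucc (α : Fin 2) : split (Pi.single α.castSucc 1) = (Pi.single α 1, 0) := by
  refine Prod.ext ?_ ?_
  · ext i
    fin_cases α <;> fin_cases i <;> simp [split_fst]
  · fin_cases α <;> simp [split_snd]

theorem split_single_two : split (Pi.single 2 1) = (0, 1) := by
  refine Prod.ext ?_ ?_
  · ext i
    fin_cases i <;> simp [split_fst]
  · simp [split_snd]

theorem pderiv_castSucc_comp_split {G : V2 → ℝ} {z : V3} (hG : DifferentiableAt ℝ G (split z).1)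
    (α : Fin 2) : pderiv α.castSucc (fun z => G (split z).1) z = pderiv α G (split z).1 := by
  rw [pderiv, (hasFDerivAt_comp_split_fst hG).fderiv]
  simp [split_single_castSucc, pderiv]

theorem pderiv_two_comp_split {G : V2 → ℝ} {z : V3} (hG : DifferentiableAt ℝ G (split z).1) :
    pderiv 2 (fun z => G (split z).1) z = 0 := by
  rw [pderiv, (hasFDerivAt_comp_split_fst hG).fderiv]
  simp [split_single_two]

theorem hasFDerivAt_comp_thickness {c : ℝ → ℝ} {z : V3} (hc : DifferentiableAt ℝ c (z 2)) :
    HasFDerivAt (fun z : V3 => c (z 2))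
      (deriv c (z 2) • (ContinuousLinearMap.proj (R := ℝ) (φ := fun _ : Fin 3 => ℝ) 2)) z :=
  hc.hasDerivAt.comp_hasFDerivAt z (ContinuousLinearMap.proj (R := ℝ) (φ := fun _ : Fin 3 => ℝ) 2).hasFDerivAt

theorem pderiv_castSucc_comp_thickness {c : ℝ → ℝ} {z : V3} (hc : DifferentiableAt ℝ c (z 2))
    (α : Fin 2) : pderiv α.castSucc (fun z : V3 => c (z 2)) z = 0 := by
  rw [pderiv, (hasFDerivAt_comp_thickness hc).fderiv]
  fin_cases α <;> simp

theorem pderiv_two_comp_thickness {c : ℝ → ℝ} {z : V3} (hc : DifferentiableAt ℝ c (z 2)) :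
    pderiv 2 (fun z : V3 => c (z 2)) z = deriv c (z 2) := by
  rw [pderiv, (hasFDerivAt_comp_thickness hc).fderiv]
  simp

/-- The `k`-th component of the tangent vector `∂_α (Θ^h ∘ P^h)`. -/
noncomputable def tangent (θ : V2 → ℝ) (h : ℝ) (α : Fin 2) (k : Fin 3) (p : V2 × ℝ) : ℝ :=
  (if α.castSucc = k then 1 else 0) + (if k = 2 then h * pderiv α θ (h⁻¹ • p.1) else 0) +
    h ^ 2 * p.2 * pderiv α (fun x => normal θ h x k) p.1

theorem ThetaP_apply (θ : V2 → ℝ) (h : ℝ) (z : V3) (k : Fin 3) :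
    ThetaP θ h (split z) k = (if k = 2 then h ^ 2 * θ (h⁻¹ • (split z).1) else z k) +
      h ^ 2 * (normal θ h (split z).1 k * z 2) := by
  fin_cases k <;> simp [ThetaP, Theta, split_fst, split_snd] <;> ring

theorem contDiff_normal_apply {θ : V2 → ℝ} (hθ : ContDiff ℝ 2 θ) (h : ℝ) (k : Fin 3) :
    ContDiff ℝ 1 fun x => normal θ h x k :=
  contDiff_pi.1 (contDiff_normal hθ h) k

theorem pderiv_ThetaP {θ : V2 → ℝ} (hθ : ContDiff ℝ 2 θ) (h : ℝ) (z : V3) (k : Fin 3) :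
    (∀ α : Fin 2, pderiv α.castSucc (fun z => ThetaP θ h (split z) k) z = tangent θ h α k (split z)) ∧
      pderiv 2 (fun z => ThetaP θ h (split z) k) z = h ^ 2 * normal θ h (split z).1 k := by
  have hn : ∀ x, DifferentiableAt ℝ (fun x => normal θ h x k) x :=
    (contDiff_normal_apply hθ h k).differentiable (by simp)
  have hns : DifferentiableAt ℝ (fun z => normal θ h (split z).1 k) z :=
    (hasFDerivAt_comp_split_fst (hn (split z).1)).differentiableAt
  have h2 : DifferentiableAt ℝ (fun z : V3 => z 2) z := by fun_prop
  have hθd : ∀ x, DifferentiableAt ℝ θ x := hθ.differentiable (by simp)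
  have hθs₀ : DifferentiableAt ℝ (fun x : V2 => θ (h⁻¹ • x)) (split z).1 :=
    (hθd _).comp _ (differentiableAt_id.const_smul h⁻¹)
  have hθs : DifferentiableAt ℝ (fun x : V2 => h ^ 2 * θ (h⁻¹ • x)) (split z).1 :=
    hθs₀.const_mul _
  have h1 : DifferentiableAt ℝ (fun z : V3 => if k = 2 then h ^ 2 * θ (h⁻¹ • (split z).1) else z k) z := by
    split_ifs
    · exact (hasFDerivAt_comp_split_fst hθs).differentiableAt
    · fun_prop
  simp only [ThetaP_apply]
  constructor
  · intro α
    rw [pderiv_add _ h1 ((hns.fun_mul h2).const_mul _), pderiv_const_mul _ _ (hns.fun_mul h2),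
      pderiv_mul _ hns h2, pderiv_castSucc_comp_split (hn _), tangent, pderiv_apply]
    by_cases hk : k = 2
    · subst hk
      have hα : α.castSucc ≠ 2 := by fin_cases α <;> simp
      simp only [if_true, hα, if_false]
      rw [pderiv_castSucc_comp_split hθs, pderiv_const_mul _ _ hθs₀,
        pderiv_comp_smul _ _ (hθd _), split_snd]
      field_simp
      ring
    · have hα : α.castSucc ≠ 2 := by fin_cases α <;> simp
      simp only [hk, if_false, pderiv_apply, hα, split_snd]
      ring
  · rw [pderiv_add _ h1 ((hns.fun_mul h2).const_mul _), pderiv_const_mul _ _ (hns.fun_mul h2),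
      pderiv_mul _ hns h2, pderiv_two_comp_split (hn _), pderiv_apply]
    by_cases hk : k = 2
    · subst hk
      simp only [if_true]
      rw [pderiv_two_comp_split hθs]
      ring
    · simp only [hk, if_false, pderiv_apply, Ne.symm hk]
      simp

/-- The scales for which the parametrization `Θ^h ∘ P^h` of the shell is a diffeomorphism. -/
structure GoodScale (ω : Set V2) (θ : V2 → ℝ) (h : ℝ) : Prop where
  pos : 0 < h
  chart : ∃ T : OpenPartialHomeomorph V3 V3, (T : V3 → V3) = (fun z => ThetaP θ h (split z)) ∧
    T.source = split ⁻¹' plate ω 1 ∧ T.target = shell ω θ h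
  det : ∀ z : V3, |z 2| < 1 →
    |(fderiv ℝ (fun z => ThetaP θ h (split z)) z).det - h ^ 2| ≤ 1 / 2 * h ^ 2

theorem eventually_goodScale {θ : V2 → ℝ} (hθ : ContDiff ℝ 2 θ) (hθp : IsPeriodic θ) {ω : Set V2}
    (hω : IsOpen ω) {h : ℕ → ℝ} (hpos : ∀ n, 0 < h n) (hlim : Tendsto h atTop (𝓝 0)) :
    ∀ᶠ n in atTop, GoodScale ω θ (h n) := by
  obtain ⟨a, ha, hA⟩ := exists_chart hθ hθp hω
  obtain ⟨b, hb, hB⟩ := abs_det_fderiv_ThetaP hθ hθp (by norm_num : (0 : ℝ) < 1 / 2)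
  filter_upwards [hlim.eventually (gt_mem_nhds ha), hlim.eventually (gt_mem_nhds hb)]
    with n h1 h2
  exact ⟨hpos n, hA _ (hpos n) h1, hB _ (hpos n) h2⟩

theorem mem_plate_one {ω : Set V2} {p : V2 × ℝ} :
    p ∈ plate ω 1 ↔ p.1 ∈ ω ∧ p.2 ∈ Ioo (-(1 / 2) : ℝ) (1 / 2) := by
  simp [plate]

theorem abs_lt_one_of_mem_plate {ω : Set V2} {z : V3} (hz : split z ∈ plate ω 1) : |z 2| < 1 := by
  have h2 := (mem_plate_one.1 hz).2
  rw [split_snd] at h2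
  exact abs_lt.2 ⟨by linarith [h2.1], by linarith [h2.2]⟩

theorem setIntegral_plate {ω : Set V2} (F : V2 × ℝ → ℝ) :
    ∫ p in plate ω 1, F p = ∫ z in split ⁻¹' plate ω 1, F (split z) := by
  have := measurePreserving_splitEquiv.setIntegral_preimage_emb splitEquiv.measurableEmbedding F
    (plate ω 1)
  rw [coe_splitEquiv] at this
  exact this.symm

theorem contDiff_ThetaP_split {θ : V2 → ℝ} (hθ : ContDiff ℝ 2 θ) (h : ℝ) :
    ContDiff ℝ 1 fun z => ThetaP θ h (split z) := by
  simp only [ThetaP_split]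
  exact (contDiff_Theta_split hθ h).comp (thicken (h ^ 2)).contDiff

section GoodScale

variable {ω : Set V2} {θ : V2 → ℝ} {h : ℝ}

theorem GoodScale.injOn (hg : GoodScale ω θ h) :
    InjOn (fun z => ThetaP θ h (split z)) (split ⁻¹' plate ω 1) := by
  obtain ⟨T, h1, h2, -⟩ := hg.chart
  rw [← h1, ← h2]; exact T.injOn

theorem GoodScale.isOpen_source (hg : GoodScale ω θ h) : IsOpen (split ⁻¹' plate ω 1) := by
  obtain ⟨T, -, hT, -⟩ := hg.chart
  rw [← hT]; exact T.open_source

theorem GoodScale.image_source (hg : GoodScale ω θ h) :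
    (fun z => ThetaP θ h (split z)) '' (split ⁻¹' plate ω 1) = shell ω θ h := by
  obtain ⟨T, h1, h2, h3⟩ := hg.chart
  rw [← h1, ← h2, ← h3, T.image_source_eq_target]

theorem hasFDerivWithinAt_ThetaP (hθ : ContDiff ℝ 2 θ) (s : Set V3) (z : V3) :
    HasFDerivWithinAt (fun z => ThetaP θ h (split z))
      (fderiv ℝ (fun z => ThetaP θ h (split z)) z) s z :=
  ((contDiff_ThetaP_split hθ h).differentiable (by simp) z).hasFDerivAt.hasFDerivWithinAt

theorem GoodScale.det_bounds (hg : GoodScale ω θ h) {z : V3} (hz : split z ∈ plate ω 1) :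
    1 / 2 * h ^ 2 ≤ (fderiv ℝ (fun z => ThetaP θ h (split z)) z).det ∧
      (fderiv ℝ (fun z => ThetaP θ h (split z)) z).det ≤ 2 * h ^ 2 := by
  have := abs_le.1 (hg.det z (abs_lt_one_of_mem_plate hz))
  have := hg.pos
  constructor <;> nlinarith [pow_pos hg.pos 2]

theorem lintegral_plate (F : V2 × ℝ → ℝ≥0∞) :
    ∫⁻ p in plate ω 1, F p = ∫⁻ z in split ⁻¹' plate ω 1, F (split z) := by
  have := measurePreserving_splitEquiv.setLIntegral_comp_preimage_emb
    splitEquiv.measurableEmbedding F (plate ω 1)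
  rw [coe_splitEquiv] at this
  exact this.symm

theorem volume_plate_ne_top (hωb : Bornology.IsBounded ω) : volume (plate ω 1) ≠ ⊤ := by
  rw [plate]
  exact (hωb.prod (Metric.isBounded_Ioo _ _)).measure_lt_top.ne

theorem GoodScale.volume_shell_ne_top (hg : GoodScale ω θ h) (hθ : ContDiff ℝ 2 θ)
    (hωb : Bornology.IsBounded ω) : volume (shell ω θ h) ≠ ⊤ := by
  rw [← hg.image_source, ← lintegral_abs_det_fderiv_eq_addHaar_image volume
    hg.isOpen_source.measurableSet (fun z _ => hasFDerivWithinAt_ThetaP hθ _ z) hg.injOn]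
  refine ne_top_of_le_ne_top ?_ (setLIntegral_mono' hg.isOpen_source.measurableSet
    (g := fun _ => ENNReal.ofReal (2 * h ^ 2)) fun z hz => ?_)
  · have h1 := lintegral_plate (ω := ω) fun _ => 1
    simp only [lintegral_one, Measure.restrict_apply_univ] at h1
    rw [setLIntegral_const, ← h1]
    exact ENNReal.mul_ne_top ENNReal.ofReal_ne_top (volume_plate_ne_top hωb)
  · have := hg.det_bounds hz
    rw [abs_of_nonneg (by have := pow_pos hg.pos 2; linarith)]
    exact ENNReal.ofReal_le_ofReal this.2

theorem GoodScale.integrableOn_comp (hg : GoodScale ω θ h) (hθ : ContDiff ℝ 2 θ) {f : V3 → ℝ}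
    (hf : IntegrableOn f (shell ω θ h)) : IntegrableOn (fun p => f (ThetaP θ h p)) (plate ω 1) := by
  rw [← hg.image_source, integrableOn_image_iff_integrableOn_abs_det_fderiv_smul volume
    hg.isOpen_source.measurableSet (fun z _ => hasFDerivWithinAt_ThetaP hθ _ z) hg.injOn] at hf
  rw [← measurePreserving_splitEquiv.integrableOn_comp_preimage splitEquiv.measurableEmbedding,
    coe_splitEquiv]
  have hc : Continuous fun z => (fderiv ℝ (fun z => ThetaP θ h (split z)) z).det :=
    ContinuousLinearMap.continuous_det.comp ((contDiff_ThetaP_split hθ h).continuous_fderiv (by simp))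
  have hb : ∀ᵐ z ∂(volume.restrict (split ⁻¹' plate ω 1)),
      ‖|(fderiv ℝ (fun z => ThetaP θ h (split z)) z).det|⁻¹‖ ≤ (1 / 2 * h ^ 2)⁻¹ := by
    filter_upwards [ae_restrict_mem hg.isOpen_source.measurableSet] with z hz
    have := hg.det_bounds hz
    have hp := pow_pos hg.pos 2
    rw [Real.norm_of_nonneg (by positivity), abs_of_nonneg (by linarith)]
    gcongr
    exact this.1
  refine (Integrable.bdd_mul hf (hc.abs.measurable.inv.aestronglyMeasurable) hb).congr ?_
  filter_upwards [ae_restrict_mem hg.isOpen_source.measurableSet] with z hz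
  have := hg.det_bounds hz
  have hp := pow_pos hg.pos 2
  rw [smul_eq_mul]
  exact inv_mul_cancel_left₀ (by rw [abs_ne_zero]; linarith) _

/-- The area formula for an injective map holds for arbitrary `F`, so nothing has to be known about
the measurability of `W` along the gradient. -/
theorem GoodScale.le_lintegral_shell (hg : GoodScale ω θ h) (hθ : ContDiff ℝ 2 θ) {δ : ℝ}
    (hdet : ∀ z : V3, |z 2| < 1 →
      |(fderiv ℝ (fun z => ThetaP θ h (split z)) z).det - h ^ 2| ≤ δ * h ^ 2) (F : V3 → ℝ≥0∞) :
    ENNReal.ofReal ((1 - δ) * h ^ 2) * ∫⁻ p in plate ω 1, F (ThetaP θ h p) ≤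
      ∫⁻ x in shell ω θ h, F x := by
  rw [← hg.image_source, lintegral_image_eq_lintegral_abs_det_fderiv_mul volume
    hg.isOpen_source.measurableSet (fun z _ => hasFDerivWithinAt_ThetaP hθ _ z) hg.injOn,
    lintegral_plate, ← lintegral_const_mul' _ _ ENNReal.ofReal_ne_top]
  refine setLIntegral_mono' hg.isOpen_source.measurableSet fun z hz => ?_
  gcongr
  refine le_trans ?_ (le_abs_self _)
  have := abs_le.1 (hdet z (abs_lt_one_of_mem_plate hz))
  linarith [this.1]

end GoodScale

/-! ### Weak derivatives of the deformation in plate coordinates. -/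

noncomputable def unsplit (p : V2 × ℝ) : V3 := ![p.1 0, p.1 1, p.2]

theorem continuous_unsplit : Continuous unsplit := by
  refine continuous_pi fun i => ?_
  fin_cases i <;> simp [unsplit] <;> fun_prop

theorem unsplit_split (z : V3) : unsplit (split z) = z := by
  ext i; fin_cases i <;> simp [unsplit, split_fst, split_snd]

theorem split_unsplit (p : V2 × ℝ) : split (unsplit p) = p := by
  refine Prod.ext ?_ ?_
  · ext i; fin_cases i <;> simp [unsplit, split_fst]
  · simp [unsplit, split_snd]

section Product

variable {ω : Set V2} {φ : V2 → ℝ} {c : ℝ → ℝ}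

theorem tsupport_product_subset (hφc : HasCompactSupport φ) (hcc : HasCompactSupport c) :
    tsupport (fun z : V3 => φ (split z).1 * c (z 2)) ⊆ unsplit '' (tsupport φ ×ˢ tsupport c) := by
  refine closure_minimal (fun z hz => ?_)
    ((hφc.isCompact.prod hcc.isCompact).image continuous_unsplit).isClosed
  refine ⟨split z, ⟨?_, ?_⟩, unsplit_split z⟩
  · exact subset_tsupport _ (left_ne_zero_of_mul hz)
  · exact subset_tsupport _ (right_ne_zero_of_mul hz)

theorem hasCompactSupport_product (hφc : HasCompactSupport φ) (hcc : HasCompactSupport c) :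
    HasCompactSupport (fun z : V3 => φ (split z).1 * c (z 2)) :=
  ((hφc.isCompact.prod hcc.isCompact).image continuous_unsplit).of_isClosed_subset
    (isClosed_tsupport _) (tsupport_product_subset hφc hcc)

theorem tsupport_product_subset_plate (hφc : HasCompactSupport φ) (hcc : HasCompactSupport c)
    (hφω : tsupport φ ⊆ ω) (hcI : tsupport c ⊆ Ioo (-(1 / 2)) (1 / 2)) :
    tsupport (fun z : V3 => φ (split z).1 * c (z 2)) ⊆ split ⁻¹' plate ω 1 := by
  refine (tsupport_product_subset hφc hcc).trans ?_
  rintro _ ⟨p, ⟨h1, h2⟩, rfl⟩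
  rw [mem_preimage, split_unsplit, mem_plate_one]
  exact ⟨hφω h1, hcI h2⟩

theorem contDiff_product (hφ : ContDiff ℝ 1 φ) (hc : ContDiff ℝ 1 c) :
    ContDiff ℝ 1 (fun z : V3 => φ (split z).1 * c (z 2)) :=
  (hφ.comp (contDiff_fst.comp split.contDiff)).mul (hc.comp (contDiff_apply ℝ ℝ 2))

end Product

section

variable {ω : Set V2} {θ : V2 → ℝ} {h : ℝ} {f : V3 → ℝ} {g : V3 → V3} {φ : V2 → ℝ} {c : ℝ → ℝ}

theorem GoodScale.integral_tangent_of_compact (hg : GoodScale ω θ h) (hθ : ContDiff ℝ 2 θ)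
    (hωb : Bornology.IsBounded ω) (hf : HasWeakGrad (shell ω θ h) f g)
    (hφ : ContDiff ℝ 1 φ) (hφc : HasCompactSupport φ) (hφω : tsupport φ ⊆ ω)
    (hc : ContDiff ℝ 1 c) (hcc : HasCompactSupport c) (hcI : tsupport c ⊆ Ioo (-(1 / 2)) (1 / 2)) :
    (∀ α, ∫ p in plate ω 1, f (ThetaP θ h p) * (pderiv α φ p.1 * c p.2) =
      - ∑ k, ∫ p in plate ω 1, g (ThetaP θ h p) k * (tangent θ h α k p * (φ p.1 * c p.2))) ∧
    ∫ p in plate ω 1, f (ThetaP θ h p) * (φ p.1 * deriv c p.2) =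
      - ∑ k, ∫ p in plate ω 1, g (ThetaP θ h p) k * (h ^ 2 * normal θ h p.1 k * (φ p.1 * c p.2)) := by
  obtain ⟨T, hT, hTs, hTt⟩ := hg.chart
  have hdet : ∀ p ∈ T.source, (fderiv ℝ T p).det ≠ 0 := by
    intro p hp
    rw [hTs] at hp
    rw [hT]
    have := hg.det_bounds hp
    have := pow_pos hg.pos 2
    linarith
  have key := HasWeakGrad.integral_comp_chart (T := T) (f := f) (g := g)
    (hT ▸ (contDiff_ThetaP_split hθ h).contDiffOn) hdet (hTt ▸ hg.volume_shell_ne_top hθ hωb)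
    (hTt ▸ hf) (contDiff_product hφ hc) (hasCompactSupport_product hφc hcc)
    (hTs ▸ tsupport_product_subset_plate hφc hcc hφω hcI)
  have hφs : ∀ z : V3, DifferentiableAt ℝ (fun z => φ (split z).1) z := fun z =>
    (hasFDerivAt_comp_split_fst (hφ.differentiable (by simp) _)).differentiableAt
  have hcs : ∀ z : V3, DifferentiableAt ℝ (fun z : V3 => c (z 2)) z := fun z =>
    (hasFDerivAt_comp_thickness (hc.differentiable (by simp) _)).differentiableAt
  constructor
  · intro α
    have h1 := key α.castSucc
    simp only [hT, hTs, pderiv_mul _ (hφs _) (hcs _), (pderiv_ThetaP hθ _ _ _).1,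
      pderiv_castSucc_comp_split (hφ.differentiable (by simp) _),
      pderiv_castSucc_comp_thickness (hc.differentiable (by simp) _), mul_zero, zero_add] at h1
    simp only [setIntegral_plate]
    exact h1
  · have h1 := key 2
    simp only [hT, hTs, pderiv_mul _ (hφs _) (hcs _), (pderiv_ThetaP hθ _ _ _).2,
      pderiv_two_comp_split (hφ.differentiable (by simp) _),
      pderiv_two_comp_thickness (hc.differentiable (by simp) _), zero_mul, add_zero] at h1
    simp only [setIntegral_plate]
    exact h1

end

/-- The primitive of `-t` that vanishes at `± 1 / 2`. -/
noncomputable def bubble (t : ℝ) : ℝ := 1 / 8 - t ^ 2 / 2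

theorem bubble_pos_iff {t : ℝ} : 0 < bubble t ↔ t ∈ Ioo (-(1 / 2) : ℝ) (1 / 2) := by
  rw [bubble, mem_Ioo]
  constructor
  · intro h
    constructor <;> nlinarith
  · rintro ⟨h1, h2⟩
    nlinarith

theorem contDiff_bubble : ContDiff ℝ 1 bubble := by
  unfold bubble; fun_prop

theorem hasDerivAt_bubble (t : ℝ) : HasDerivAt bubble (-t) t := by
  have : HasDerivAt bubble _ t := ((hasDerivAt_pow 2 t).div_const 2).const_sub (1 / 8)
  refine this.congr_deriv ?_
  norm_num

/-- Cut-off functions in the thickness variable. -/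
noncomputable def cutoff (j : ℕ) (t : ℝ) : ℝ := Real.smoothTransition (j * bubble t - 1)

theorem contDiff_cutoff (j : ℕ) : ContDiff ℝ 1 (cutoff j) :=
  Real.smoothTransition.contDiff.comp ((contDiff_const.mul contDiff_bubble).sub contDiff_const)

theorem tsupport_subset_of_bubble {c : ℝ → ℝ} {j : ℕ} (hc : ∀ t, (j : ℝ) * bubble t < 1 → c t = 0) :
    HasCompactSupport c ∧ tsupport c ⊆ Ioo (-(1 / 2)) (1 / 2) := by
  have hsub : tsupport c ⊆ {t | 1 ≤ (j : ℝ) * bubble t} := by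
    refine closure_minimal (fun t ht => ?_)
      (isClosed_le continuous_const (continuous_const.mul contDiff_bubble.continuous))
    by_contra h
    exact ht (hc t (not_le.1 h))
  have hI : tsupport c ⊆ Ioo (-(1 / 2)) (1 / 2) := fun t ht => by
    have h1 := hsub ht
    rw [← bubble_pos_iff]
    have h2 : 1 ≤ (j : ℝ) * bubble t := h1
    by_contra h3
    have : (j : ℝ) * bubble t ≤ 0 := mul_nonpos_of_nonneg_of_nonpos (Nat.cast_nonneg j) (not_lt.1 h3)
    linarith
  exact ⟨isCompact_Icc.of_isClosed_subset (isClosed_tsupport _) (hI.trans Ioo_subset_Icc_self), hI⟩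

theorem cutoff_eq_zero {j : ℕ} {t : ℝ} (h : (j : ℝ) * bubble t < 1) : cutoff j t = 0 :=
  Real.smoothTransition.zero_of_nonpos (by linarith)

theorem tendsto_cutoff {t : ℝ} (ht : t ∈ Ioo (-(1 / 2) : ℝ) (1 / 2)) :
    Tendsto (fun j => cutoff j t) atTop (𝓝 1) := by
  have hb := bubble_pos_iff.2 ht
  refine tendsto_const_nhds.congr' ?_
  have := (tendsto_natCast_atTop_atTop (R := ℝ)).atTop_mul_const hb
  filter_upwards [this.eventually_ge_atTop 2] with j hj
  exact (Real.smoothTransition.one_of_one_le (by linarith)).symm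

theorem abs_cutoff_le (j : ℕ) (t : ℝ) : |cutoff j t| ≤ 1 := by
  rw [cutoff, abs_of_nonneg (Real.smoothTransition.nonneg _)]
  exact Real.smoothTransition.le_one _

/-- A smooth function vanishing on `(-∞, 1]`, with derivative one on `(2, ∞)`. -/
noncomputable def ramp (r : ℝ) : ℝ := r * Real.smoothTransition (r - 1)

theorem contDiff_ramp : ContDiff ℝ 1 ramp :=
  contDiff_id.mul (Real.smoothTransition.contDiff.comp (contDiff_id.sub contDiff_const))

theorem ramp_eq_zero {r : ℝ} (hr : r ≤ 1) : ramp r = 0 := by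
  rw [ramp, Real.smoothTransition.zero_of_nonpos (by linarith), mul_zero]

theorem deriv_ramp_of_two_lt {r : ℝ} (hr : 2 < r) : deriv ramp r = 1 := by
  have : ramp =ᶠ[𝓝 r] id := by
    filter_upwards [lt_mem_nhds hr] with s hs
    rw [ramp, Real.smoothTransition.one_of_one_le (by linarith), mul_one, id]
  rw [this.deriv_eq, deriv_id]

theorem exists_bound_deriv_ramp : ∃ M, 0 ≤ M ∧ ∀ r, |deriv ramp r| ≤ M := by
  obtain ⟨M, hM⟩ := (isCompact_Icc (a := (0 : ℝ)) (b := 3)).exists_bound_of_continuousOn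
    (contDiff_ramp.continuous_deriv (by simp)).continuousOn
  refine ⟨max M 1, by positivity, fun r => ?_⟩
  rcases lt_or_ge r 0 with h0 | h0
  · have : ramp =ᶠ[𝓝 r] fun _ => 0 := by
      filter_upwards [gt_mem_nhds h0] with s hs
      exact ramp_eq_zero (by linarith)
    rw [this.deriv_eq, deriv_const]; simp
  rcases lt_or_ge 3 r with h3 | h3
  · rw [deriv_ramp_of_two_lt (by linarith)]; simp
  · exact (hM r ⟨h0, h3⟩).trans (le_max_left _ _)

theorem abs_ramp_sub_le {r : ℝ} (hr : 0 ≤ r) : |ramp r| ≤ r := by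
  rw [ramp, abs_mul, abs_of_nonneg hr, abs_of_nonneg (Real.smoothTransition.nonneg _)]
  exact mul_le_of_le_one_right hr (Real.smoothTransition.le_one _)

/-- Compactly supported approximations of `bubble`. -/
noncomputable def bubbleApprox (j : ℕ) (t : ℝ) : ℝ := ((j : ℝ) + 1)⁻¹ * ramp (((j : ℝ) + 1) * bubble t)

theorem contDiff_bubbleApprox (j : ℕ) : ContDiff ℝ 1 (bubbleApprox j) :=
  contDiff_const.mul (contDiff_ramp.comp (contDiff_const.mul contDiff_bubble))

/-- The factors `j + 1` cancel, so the derivatives are bounded uniformly in `j` and eventually equal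
`-t` at each interior point. This allows `bubble`, whose support reaches the faces `t = ±1/2`, as a
profile in the weak formulation. -/
theorem deriv_bubbleApprox (j : ℕ) (t : ℝ) :
    deriv (bubbleApprox j) t = deriv ramp (((j : ℝ) + 1) * bubble t) * (-t) := by
  have h1 : HasDerivAt ramp (deriv ramp (((j : ℝ) + 1) * bubble t)) (((j : ℝ) + 1) * bubble t) :=
    (contDiff_ramp.differentiable (by simp) _).hasDerivAt
  have h2 := (h1.comp t ((hasDerivAt_bubble t).const_mul ((j : ℝ) + 1))).const_mul ((j : ℝ) + 1)⁻¹
  have h3 : deriv (bubbleApprox j) t = _ := h2.deriv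
  rw [h3]
  field_simp

section

variable {ω : Set V2} {θ : V2 → ℝ} {h : ℝ} {f : V3 → ℝ} {g : V3 → V3} {φ : V2 → ℝ}

theorem tendsto_integral_mul_of_bounded {X : Type*} [MeasurableSpace X] {μ : Measure X} {F : X → ℝ}
    (hF : Integrable F μ) {b : ℕ → X → ℝ} {b₀ : X → ℝ} {M : ℝ}
    (hm : ∀ j, AEStronglyMeasurable (b j) μ) (hb : ∀ j, ∀ᵐ x ∂μ, |b j x| ≤ M)
    (hlim : ∀ᵐ x ∂μ, Tendsto (fun j => b j x) atTop (𝓝 (b₀ x))) :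
    Tendsto (fun j => ∫ x, F x * b j x ∂μ) atTop (𝓝 (∫ x, F x * b₀ x ∂μ)) := by
  refine tendsto_integral_of_dominated_convergence (fun x => ‖F x‖ * M)
    (fun j => hF.1.mul (hm j)) (hF.norm.mul_const M) (fun j => ?_) ?_
  · filter_upwards [hb j] with x hx
    rw [norm_mul]
    gcongr
    exact hx
  · filter_upwards [hlim] with x hx using hx.const_mul _

theorem measurableSet_plate (hω : IsOpen ω) : MeasurableSet (plate ω 1) :=
  (isOpen_plate hω 1).measurableSet

theorem continuous_tangent (hθ : ContDiff ℝ 2 θ) (h : ℝ) (α : Fin 2) (k : Fin 3) :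
    Continuous (tangent θ h α k) := by
  unfold tangent
  have h1 : Continuous fun p : V2 × ℝ => pderiv α θ (h⁻¹ • p.1) :=
    (contDiff_pderiv hθ α).continuous.comp (by fun_prop)
  have h2 : Continuous fun p : V2 × ℝ => pderiv α (fun x => normal θ h x k) p.1 :=
    (continuous_pderiv (contDiff_normal_apply hθ h k) α).comp continuous_fst
  refine (continuous_const.add ?_).add (by fun_prop)
  split_ifs <;> fun_prop

theorem bounded_on_plate {b : V2 × ℝ → ℝ} (hb : Continuous b) (hωb : Bornology.IsBounded ω) :
    ∃ M, ∀ p ∈ plate ω 1, |b p| ≤ M := by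
  have hc : IsCompact (closure (plate ω 1)) := by
    rw [plate]
    exact (hωb.prod (Metric.isBounded_Ioo _ _)).isCompact_closure
  obtain ⟨M, hM⟩ := hc.exists_bound_of_continuousOn hb.continuousOn
  exact ⟨M, fun p hp => hM p (subset_closure hp)⟩

/-- Testing the weak derivative of `f ∘ Θ^h ∘ P^h` along the mid-surface against `φ(x) c(t)`. -/
theorem GoodScale.integral_tangent (hg : GoodScale ω θ h) (hθ : ContDiff ℝ 2 θ)
    (hω : IsOpen ω) (hωb : Bornology.IsBounded ω) (hf : HasWeakGrad (shell ω θ h) f g)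
    (hφ : ContDiff ℝ 1 φ) (hφc : HasCompactSupport φ) (hφω : tsupport φ ⊆ ω)
    {c : ℝ → ℝ} (hc : ContDiff ℝ 1 c) (α : Fin 2) :
    ∫ p in plate ω 1, f (ThetaP θ h p) * (pderiv α φ p.1 * c p.2) =
      - ∑ k, ∫ p in plate ω 1, g (ThetaP θ h p) k * (tangent θ h α k p * (φ p.1 * c p.2)) := by
  have hfin : IsFiniteMeasure (volume.restrict (shell ω θ h)) :=
    ⟨by simpa using (hg.volume_shell_ne_top hθ hωb).lt_top⟩
  have hfi := hg.integrableOn_comp hθ (hf.memLp.integrable (by norm_num))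
  have hgi := fun k => hg.integrableOn_comp hθ ((hf.memLp_grad k).integrable (by norm_num))
  -- A tangential derivative never falls on the thickness cut-off, so the cut-off can be removed by
  -- dominated convergence and `c` need not vanish on the faces.
  have hlim : ∀ {F : V2 × ℝ → ℝ} {b : V2 × ℝ → ℝ}, IntegrableOn F (plate ω 1) → Continuous b →
      Tendsto (fun j => ∫ p in plate ω 1, F p * (b p * cutoff j p.2)) atTop
        (𝓝 (∫ p in plate ω 1, F p * b p)) := by
    intro F b hF hb
    obtain ⟨M, hM⟩ := bounded_on_plate hb hωb
    refine tendsto_integral_mul_of_bounded (M := M) hF (fun j => ?_) (fun j => ?_) ?_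
    · exact (hb.mul ((contDiff_cutoff j).continuous.comp continuous_snd)).aestronglyMeasurable
    · filter_upwards [ae_restrict_mem (measurableSet_plate hω)] with p hp
      rw [abs_mul]
      exact (mul_le_of_le_one_right (abs_nonneg _) (abs_cutoff_le _ _)).trans (hM p hp)
    · filter_upwards [ae_restrict_mem (measurableSet_plate hω)] with p hp
      simpa using (tendsto_cutoff (mem_plate_one.1 hp).2).const_mul (b p)
  have hcφ : Continuous fun p : V2 × ℝ => pderiv α φ p.1 * c p.2 :=
    ((continuous_pderiv hφ α).comp continuous_fst).mul (hc.continuous.comp continuous_snd)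
  have hcg : ∀ k, Continuous fun p : V2 × ℝ => tangent θ h α k p * (φ p.1 * c p.2) := fun k =>
    (continuous_tangent hθ h α k).mul
      ((hφ.continuous.comp continuous_fst).mul (hc.continuous.comp continuous_snd))
  have l1 := hlim hfi hcφ
  have l2 := (tendsto_finsetSum Finset.univ fun k _ => hlim (hgi k) (hcg k)).neg
  refine tendsto_nhds_unique l1 (l2.congr fun j => ?_)
  have hz := tsupport_subset_of_bubble (c := fun t => c t * cutoff j t) (j := j) fun t ht => by
    rw [cutoff_eq_zero ht, mul_zero]
  have := (hg.integral_tangent_of_compact hθ hωb hf hφ hφc hφω (hc.mul (contDiff_cutoff j))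
    hz.1 hz.2).1 α
  simp only [← mul_assoc] at this ⊢
  exact this.symm

/-- Testing the weak derivative of `f ∘ Θ^h ∘ P^h` across the thickness against `φ(x) s(t)`. -/
theorem GoodScale.integral_normal (hg : GoodScale ω θ h) (hθ : ContDiff ℝ 2 θ)
    (hω : IsOpen ω) (hωb : Bornology.IsBounded ω) (hf : HasWeakGrad (shell ω θ h) f g)
    (hφ : ContDiff ℝ 1 φ) (hφc : HasCompactSupport φ) (hφω : tsupport φ ⊆ ω) :
    ∫ p in plate ω 1, f (ThetaP θ h p) * (φ p.1 * p.2) =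
      ∑ k, ∫ p in plate ω 1, g (ThetaP θ h p) k * (h ^ 2 * normal θ h p.1 k * (φ p.1 * bubble p.2)) := by
  have hfin : IsFiniteMeasure (volume.restrict (shell ω θ h)) :=
    ⟨by simpa using (hg.volume_shell_ne_top hθ hωb).lt_top⟩
  have hfi := hg.integrableOn_comp hθ (hf.memLp.integrable (by norm_num))
  have hgi := fun k => hg.integrableOn_comp hθ ((hf.memLp_grad k).integrable (by norm_num))
  obtain ⟨B, hB0, hB⟩ := exists_bound_deriv_ramp
  have hj : Tendsto (fun j : ℕ => (j : ℝ) + 1) atTop atTop :=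
    tendsto_atTop_add_const_right _ _ tendsto_natCast_atTop_atTop
  have l1 : Tendsto (fun j => ∫ p in plate ω 1, f (ThetaP θ h p) * (φ p.1 * deriv (bubbleApprox j) p.2))
      atTop (𝓝 (∫ p in plate ω 1, f (ThetaP θ h p) * (φ p.1 * -p.2))) := by
    obtain ⟨M, hM⟩ := bounded_on_plate (ω := ω) (b := fun p => φ p.1)
      (hφ.continuous.comp continuous_fst) hωb
    refine tendsto_integral_mul_of_bounded (M := M * (B * 1)) hfi (fun j => ?_) (fun j => ?_) ?_
    · exact ((hφ.continuous.comp continuous_fst).mul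
        (((contDiff_bubbleApprox j).continuous_deriv (by simp)).comp continuous_snd)).aestronglyMeasurable
    · filter_upwards [ae_restrict_mem (measurableSet_plate hω)] with p hp
      rw [deriv_bubbleApprox, abs_mul, abs_mul, abs_neg]
      have h2 := (mem_plate_one.1 hp).2
      have h3 : |p.2| ≤ 1 := abs_le.2 ⟨by linarith [h2.1], by linarith [h2.2]⟩
      have h4 := (abs_nonneg _).trans (hM p hp)
      gcongr
      · exact hM p hp
      · exact hB _
    · filter_upwards [ae_restrict_mem (measurableSet_plate hω)] with p hp
      refine Tendsto.const_mul _ (tendsto_const_nhds.congr' ?_)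
      filter_upwards [(hj.atTop_mul_const (bubble_pos_iff.2 (mem_plate_one.1 hp).2)).eventually_gt_atTop 2]
        with j hj2
      rw [deriv_bubbleApprox, deriv_ramp_of_two_lt hj2, one_mul]
  have l2 : ∀ k, Tendsto (fun j => ∫ p in plate ω 1, g (ThetaP θ h p) k *
      (h ^ 2 * normal θ h p.1 k * (φ p.1 * bubbleApprox j p.2)))
      atTop (𝓝 (∫ p in plate ω 1, g (ThetaP θ h p) k *
        (h ^ 2 * normal θ h p.1 k * (φ p.1 * bubble p.2)))) := by
    intro k
    have hcn : Continuous fun p : V2 × ℝ => h ^ 2 * normal θ h p.1 k :=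
      continuous_const.mul ((contDiff_normal_apply hθ h k).continuous.comp continuous_fst)
    have hcφ : Continuous fun p : V2 × ℝ => φ p.1 := hφ.continuous.comp continuous_fst
    obtain ⟨M, hM⟩ := bounded_on_plate (ω := ω) (hcn.mul hcφ) hωb
    refine tendsto_integral_mul_of_bounded (M := M * 1) (hgi k) (fun j => ?_) (fun j => ?_) ?_
    · exact (hcn.mul (hcφ.mul
        ((contDiff_bubbleApprox j).continuous.comp continuous_snd))).aestronglyMeasurable
    · filter_upwards [ae_restrict_mem (measurableSet_plate hω)] with p hp
      rw [← mul_assoc, abs_mul]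
      have h2 := bubble_pos_iff.2 (mem_plate_one.1 hp).2
      have h4 := (abs_nonneg _).trans (hM p hp)
      gcongr
      · exact hM p hp
      · have h5 : bubble p.2 ≤ 1 := by rw [bubble]; nlinarith [sq_nonneg p.2]
        rw [bubbleApprox, abs_mul, abs_of_pos (by positivity : (0 : ℝ) < ((j : ℝ) + 1)⁻¹)]
        calc _ ≤ ((j : ℝ) + 1)⁻¹ * (((j : ℝ) + 1) * bubble p.2) := by
              gcongr; exact abs_ramp_sub_le (by positivity)
          _ = bubble p.2 := by field_simp
          _ ≤ 1 := h5
    · filter_upwards [ae_restrict_mem (measurableSet_plate hω)] with p hp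
      refine Tendsto.const_mul _ (Tendsto.const_mul _ (tendsto_const_nhds.congr' ?_))
      filter_upwards [(hj.atTop_mul_const (bubble_pos_iff.2 (mem_plate_one.1 hp).2)).eventually_gt_atTop 2]
        with j hj2
      rw [bubbleApprox, ramp, Real.smoothTransition.one_of_one_le (by linarith)]
      field_simp
  have l3 := (tendsto_finsetSum Finset.univ fun k _ => l2 k).neg
  have huniq := tendsto_nhds_unique l1 (l3.congr fun j => ?_)
  · simp only [mul_neg, integral_neg, neg_inj] at huniq
    exact huniq
  -- `bubbleApprox j` is built with the factor `j + 1`, hence the shifted index.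
  · have hz := tsupport_subset_of_bubble (c := bubbleApprox j) (j := j + 1) fun t ht => by
      push_cast at ht
      rw [bubbleApprox, ramp_eq_zero ht.le, mul_zero]
    exact (hg.integral_tangent_of_compact hθ hωb hf hφ hφc hφω (contDiff_bubbleApprox j) hz.1 hz.2).2.symm

end

/-! ### Test functions for two-scale convergence: passage to the torus, averaging, density. -/

section Torus

theorem isOpenQuotientMap_toTorus : IsOpenQuotientMap toTorus :=
  IsOpenQuotientMap.piMap fun _ => QuotientAddGroup.isOpenQuotientMap_mk

theorem IsPeriodic.eq_of_toTorus_eq {f : V2 → ℝ} (hf : IsPeriodic f) {y z : V2}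
    (h : toTorus y = toTorus z) : f y = f z := by
  have : ∀ i, ∃ n : ℤ, (n : ℝ) = y i - z i := by
    intro i
    have h1 : ((y i - z i : ℝ) : UnitAddCircle) = 0 := by
      rw [AddCircle.coe_sub, sub_eq_zero]
      exact congrFun h i
    obtain ⟨n, hn⟩ := (AddCircle.coe_eq_zero_iff _).1 h1
    exact ⟨n, by simpa using hn⟩
  choose n hn using this
  rw [← hf.add_int z n]
  congr 1
  ext i
  simp [hn]

/-- The function on the torus induced by a periodic function. -/
noncomputable def torusLift (f : V2 → ℝ) (t : UnitAddTorus (Fin 2)) : ℝ :=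
  f (Function.surjInv isOpenQuotientMap_toTorus.surjective t)

theorem IsPeriodic.torusLift_toTorus {f : V2 → ℝ} (hf : IsPeriodic f) (y : V2) :
    torusLift f (toTorus y) = f y :=
  hf.eq_of_toTorus_eq (Function.surjInv_eq _ _)

theorem cell_ae_eq : cell =ᵐ[volume] {x : V2 | ∀ i, x i ∈ Ioc (0 : ℝ) (0 + 1)} := by
  have h1 : {x : V2 | ∀ i, x i ∈ Ioc (0 : ℝ) (0 + 1)} = Set.pi univ fun i => Ioc ((0 : V2) i) ((1 : V2) i) := by
    ext x; simp [Set.mem_pi]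
  rw [h1, cell]
  exact (Measure.univ_pi_Ioc_ae_eq_Icc (μ := fun _ => (volume : Measure ℝ))).symm

theorem IsPeriodic.setIntegral_cell_add {f : V2 → ℝ} (hf : IsPeriodic f) (a : V2) :
    ∫ z in cell, f (a + z) = ∫ z in cell, f z := by
  have h1 := UnitAddTorus.integral_preimage (torusLift f) a
  have h2 := UnitAddTorus.integral_preimage (torusLift f) (0 : V2)
  have h3 : ∀ x : V2, torusLift f (fun i => ((x i : ℝ) : UnitAddCircle)) = f x := hf.torusLift_toTorus
  simp only [h3] at h1 h2
  rw [setIntegral_congr_set cell_ae_eq, setIntegral_congr_set cell_ae_eq]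
  simp only [Pi.zero_apply] at h2
  rw [← h2, h1]
  have h4 := (measurePreserving_add_left (volume : Measure V2) a).setIntegral_preimage_emb
    (MeasurableEquiv.addLeft a).measurableEmbedding f {x : V2 | ∀ i, x i ∈ Ioc (a i) (a i + 1)}
  rw [← h4]
  congr 2
  ext x
  simp only [mem_ofPred_eq, mem_preimage, Pi.add_apply, mem_Ioc, zero_add]
  exact forall_congr' fun i => by constructor <;> rintro ⟨h1, h2⟩ <;> constructor <;> linarith

end Torus

/-- Continuous functions of `(x, y)`, periodic in `y`, whose support in `x` is compact in `ω`. -/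
structure OscFn (ω : Set V2) (ψ : V2 → V2 → ℝ) : Prop where
  continuous : Continuous fun p : V2 × V2 => ψ p.1 p.2
  periodic : ∀ x, IsPeriodic (ψ x)
  support : ∃ K, IsCompact K ∧ K ⊆ ω ∧ ∀ x ∉ K, ∀ y, ψ x y = 0

section OscFn

variable {ω : Set V2} {ψ χ : V2 → V2 → ℝ}

theorem OscFn.exists_bound (hψ : OscFn ω ψ) : ∃ M, 0 < M ∧ ∀ x y, |ψ x y| ≤ M := by
  obtain ⟨K, hK, -, h0⟩ := hψ.support
  obtain ⟨M, hM⟩ := (hK.prod isCompact_cell).exists_bound_of_continuousOn hψ.continuous.continuousOn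
  refine ⟨max M 1, by positivity, fun x y => ?_⟩
  by_cases hx : x ∈ K
  · rw [← (hψ.periodic x).fract]
    exact (hM (x, _) ⟨hx, fract_mem_cell y⟩).trans (le_max_left _ _)
  · rw [h0 x hx, abs_zero]; positivity

theorem OscFn.mul (hψ : OscFn ω ψ) (hχ : OscFn ω χ) : OscFn ω fun x y => ψ x y * χ x y := by
  obtain ⟨K, hK, hKω, h0⟩ := hψ.support
  exact ⟨hψ.continuous.mul hχ.continuous, fun x i y => by rw [hψ.periodic x i, hχ.periodic x i],
    K, hK, hKω, fun x hx y => by rw [h0 x hx, zero_mul]⟩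

theorem OscFn.periodic_mul (hψ : OscFn ω ψ) {b : V2 → ℝ} (hb : Continuous b) (hbp : IsPeriodic b) :
    OscFn ω fun x y => b y * ψ x y := by
  obtain ⟨K, hK, hKω, h0⟩ := hψ.support
  exact ⟨(hb.comp continuous_snd).mul hψ.continuous, fun x i y => by rw [hψ.periodic x i, hbp i],
    K, hK, hKω, fun x hx y => by rw [h0 x hx, mul_zero]⟩

theorem OscFn.hasCompactSupport (hψ : OscFn ω ψ) (h : ℝ) :
    HasCompactSupport (fun x => ψ x (h⁻¹ • x)) ∧ tsupport (fun x => ψ x (h⁻¹ • x)) ⊆ ω := by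
  obtain ⟨K, hK, hKω, h0⟩ := hψ.support
  have : tsupport (fun x => ψ x (h⁻¹ • x)) ⊆ K := closure_minimal (fun x hx => by
    by_contra hxK
    exact hx (h0 x hxK _)) hK.isClosed
  exact ⟨hK.of_isClosed_subset (isClosed_tsupport _) this, this.trans hKω⟩

theorem OscFn.continuous_osc (hψ : OscFn ω ψ) (h : ℝ) : Continuous fun x => ψ x (h⁻¹ • x) :=
  hψ.continuous.comp (by fun_prop : Continuous fun x : V2 => (x, h⁻¹ • x))

/-- The definition tests with maps into the continuous functions on the torus. A jointly continuous
function, periodic in `y`, descends to `V2 × torus` (the product of the identity with an open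
quotient map is a quotient map), and currying gives a continuous, compactly supported map of that
kind. -/
theorem TwoScale.tendsto_osc {h : ℕ → ℝ} {f : ℕ → V2 → ℝ} {f₀ : V2 × V2 → ℝ}
    (hf : TwoScale ω h f f₀) (hψ : OscFn ω ψ) :
    Tendsto (fun n => ∫ x in ω, f n x * ψ x ((h n)⁻¹ • x)) atTop
      (𝓝 (∫ p in ω ×ˢ cell, f₀ p * ψ p.1 p.2)) := by
  have hj : Continuous fun p : V2 × UnitAddTorus (Fin 2) => torusLift (ψ p.1) p.2 := by
    rw [(IsOpenQuotientMap.id.prodMap isOpenQuotientMap_toTorus).isQuotientMap.continuous_iff]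
    refine hψ.continuous.congr fun p => ?_
    exact ((hψ.periodic p.1).torusLift_toTorus p.2).symm
  let J : C(V2 × UnitAddTorus (Fin 2), ℝ) := ⟨_, hj⟩
  have hJ : ∀ x y, J.curry x (toTorus y) = ψ x y := fun x y => (hψ.periodic x).torusLift_toTorus y
  have hc : HasCompactSupport fun x => J.curry x := by
    obtain ⟨K, hK, -, h0⟩ := hψ.support
    refine HasCompactSupport.intro hK fun x hx => ?_
    ext t
    exact h0 x hx _
  have hm : MemLp (fun x => J.curry x) 2 (volume.restrict ω) :=
    (J.curry.continuous.memLp_of_hasCompactSupport hc)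
  simpa only [hJ] using hf.2.2 (fun x => J.curry x) hm

end OscFn

/-- Smooth admissible test functions for two-scale convergence. -/
structure TestFn (ω : Set V2) (ψ : V2 → V2 → ℝ) : Prop extends OscFn ω ψ where
  smooth : ContDiff ℝ ((⊤ : ℕ∞) : WithTop ℕ∞) fun p : V2 × V2 => ψ p.1 p.2

section TestFn

variable {ω : Set V2} {ψ χ : V2 → V2 → ℝ}

theorem TestFn.contDiff_osc (hψ : TestFn ω ψ) (h : ℝ) :
    ContDiff ℝ ((⊤ : ℕ∞) : WithTop ℕ∞) fun x => ψ x (h⁻¹ • x) :=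
  hψ.smooth.comp (contDiff_id.prodMk (contDiff_const_smul (h⁻¹ : ℝ)))

theorem TestFn.exists_fderiv_bound (hψ : TestFn ω ψ) :
    ∃ M, 0 < M ∧ ∀ p, ‖fderiv ℝ (fun p : V2 × V2 => ψ p.1 p.2) p‖ ≤ M := by
  obtain ⟨K, hK, hKω, h0⟩ := hψ.support
  have : OscFn ω fun x y => ‖fderiv ℝ (fun p : V2 × V2 => ψ p.1 p.2) (x, y)‖ := by
    refine ⟨(hψ.smooth.continuous_fderiv (by simp)).norm, fun x i y => ?_, K, hK, hKω, fun x hx y => ?_⟩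
    · have := fderiv_comp_add_right (𝕜 := ℝ) (f := fun p : V2 × V2 => ψ p.1 p.2) (x := (x, y))
        ((0, Pi.single i 1) : V2 × V2)
      simp only [Prod.fst_add, Prod.snd_add, add_zero, hψ.periodic _ i _, Prod.mk_add_mk] at this
      rw [← this]
    · have : (fun p : V2 × V2 => ψ p.1 p.2) =ᶠ[𝓝 (x, y)] fun _ => 0 := by
        filter_upwards [(hK.isClosed.isOpen_compl.preimage continuous_fst).mem_nhds hx] with p hp
        exact h0 _ hp _
      rw [this.fderiv_eq]
      simp
  obtain ⟨M, hM0, hM⟩ := this.exists_bound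
  exact ⟨M, hM0, fun p => by simpa using hM p.1 p.2⟩

theorem TestFn.exists_pderiv_bound (hψ : TestFn ω ψ) :
    ∃ M, 0 < M ∧ ∀ h, 0 < h → h ≤ 1 → ∀ α x, |pderiv α (fun x => ψ x (h⁻¹ • x)) x| ≤ M * h⁻¹ := by
  obtain ⟨M, hM0, hM⟩ := hψ.exists_fderiv_bound
  refine ⟨M, hM0, fun h hh h1 α x => ?_⟩
  have hd : HasFDerivAt (fun x => ψ x (h⁻¹ • x)) _ x :=
    HasFDerivAt.comp (g := fun p : V2 × V2 => ψ p.1 p.2) (f := fun x => (x, h⁻¹ • x)) x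
      ((hψ.smooth.differentiable (by simp) _).hasFDerivAt)
      ((hasFDerivAt_id x).prodMk ((hasFDerivAt_id x).const_smul h⁻¹))
  rw [pderiv, hd.fderiv, ContinuousLinearMap.comp_apply]
  have hi : 1 ≤ h⁻¹ := (one_le_inv₀ hh).2 h1
  rw [← Real.norm_eq_abs]
  refine ((fderiv ℝ (fun p : V2 × V2 => ψ p.1 p.2) (x, h⁻¹ • x)).le_opNorm _).trans ?_
  gcongr
  · exact hM _
  · simp only [ContinuousLinearMap.prod_apply, _root_.smul_apply,
      ContinuousLinearMap.id_apply]
    have hs : ‖(Pi.single α 1 : V2)‖ ≤ 1 := (pi_norm_le_iff_of_nonneg zero_le_one).2 fun i => by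
      by_cases hi : i = α
      · subst hi; simp
      · simp [hi]
    rw [Prod.norm_def, norm_smul, Real.norm_of_nonneg (by positivity)]
    exact max_le (hs.trans hi) (mul_le_of_le_one_right (by positivity) hs)

theorem TestFn.add (hψ : TestFn ω ψ) (hχ : TestFn ω χ) : TestFn ω fun x y => ψ x y + χ x y := by
  obtain ⟨K, hK, hKω, h0⟩ := hψ.support
  obtain ⟨L, hL, hLω, hL0⟩ := hχ.support
  exact ⟨⟨hψ.continuous.add hχ.continuous, fun x i y => by rw [hψ.periodic x i, hχ.periodic x i],
    K ∪ L, hK.union hL, union_subset hKω hLω, fun x hx y => by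
      rw [h0 x fun h => hx (Or.inl h), hL0 x fun h => hx (Or.inr h), add_zero]⟩,
    hψ.smooth.add hχ.smooth⟩

theorem TestFn.const_mul (hψ : TestFn ω ψ) (c : ℝ) : TestFn ω fun x y => c * ψ x y := by
  obtain ⟨K, hK, hKω, h0⟩ := hψ.support
  exact ⟨⟨continuous_const.mul hψ.continuous, fun x i y => by rw [hψ.periodic x i],
    K, hK, hKω, fun x hx y => by rw [h0 x hx, mul_zero]⟩, contDiff_const.mul hψ.smooth⟩

theorem TestFn.zero : TestFn ω fun _ _ => 0 :=
  ⟨⟨continuous_const, fun _ _ _ => rfl, ∅, isCompact_empty, empty_subset _, fun _ _ _ => rfl⟩,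
    contDiff_const⟩

theorem TestFn.mul (hψ : TestFn ω ψ) (hχ : TestFn ω χ) : TestFn ω fun x y => ψ x y * χ x y :=
  ⟨hψ.toOscFn.mul hχ.toOscFn, hψ.smooth.mul hχ.smooth⟩

end TestFn

theorem volume_cell : volume cell = 1 := by
  rw [cell, Real.volume_Icc_pi]
  simp

section Averaging

variable {ω : Set V2} {ψ : V2 → V2 → ℝ}

theorem TestFn.abs_shift_sub_le (hψ : TestFn ω ψ) : ∃ M, 0 < M ∧ ∀ x a y,
    |ψ (x + a) y - ψ x y| ≤ M * ‖a‖ := by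
  obtain ⟨M, hM0, hM⟩ := hψ.exists_fderiv_bound
  refine ⟨M, hM0, fun x a y => ?_⟩
  have := convex_univ.norm_image_sub_le_of_norm_fderiv_le (𝕜 := ℝ)
    (f := fun p : V2 × V2 => ψ p.1 p.2) (fun p _ => hψ.smooth.differentiable (by simp) p)
    (fun p _ => hM p) (mem_univ (x, y)) (mem_univ (x + a, y))
  simpa [Prod.norm_def] using this

/-- Averaging of oscillating test functions. -/
theorem TestFn.tendsto_average (hψ : TestFn ω ψ) {h : ℕ → ℝ} (hpos : ∀ n, 0 < h n)
    (hlim : Tendsto h atTop (𝓝 0)) :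
    Tendsto (fun n => ∫ x in ω, ψ x ((h n)⁻¹ • x)) atTop (𝓝 (∫ p in ω ×ˢ cell, ψ p.1 p.2)) := by
  obtain ⟨K, hK, hKω, h0⟩ := hψ.support
  obtain ⟨M, hM0, hM⟩ := hψ.abs_shift_sub_le
  have hfc : IsFiniteMeasure (volume.restrict cell) := ⟨by simp [volume_cell]⟩
  obtain ⟨r, hr⟩ := hK.isBounded.subset_closedBall 0
  have hprod : (volume : Measure V2).prod (volume.restrict cell) =
      (volume : Measure (V2 × V2)).restrict (univ ×ˢ cell) := by
    have := Measure.prod_restrict (μ := (volume : Measure V2)) (ν := (volume : Measure V2)) univ cell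
    rwa [Measure.restrict_univ] at this
  have hJ : ∫ p in ω ×ˢ cell, ψ p.1 p.2 = ∫ x, ∫ z in cell, ψ x z := by
    have hi : Integrable (fun p : V2 × V2 => ψ p.1 p.2) (volume.prod (volume.restrict cell)) := by
      rw [hprod]
      refine IntegrableOn.of_forall_sdiff_eq_zero (s := K ×ˢ cell)
        (hψ.continuous.continuousOn.integrableOn_compact (hK.prod isCompact_cell))
        (MeasurableSet.univ.prod isCompact_cell.measurableSet) fun p hp => ?_
      exact h0 _ (fun h => hp.2 ⟨h, hp.1.2⟩) _
    rw [← integral_prod _ hi, hprod]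
    refine (setIntegral_eq_of_subset_of_forall_sdiff_eq_zero (f := fun p : V2 × V2 => ψ p.1 p.2)
      (MeasurableSet.univ.prod isCompact_cell.measurableSet) (prod_mono (subset_univ _) subset_rfl)
      fun p hp => ?_).symm
    exact h0 _ (fun h => hp.2 ⟨hKω h, hp.1.2⟩) _
  have hball : (volume : Measure V2) (Metric.closedBall 0 (r + 1)) ≠ ⊤ := measure_closedBall_lt_top.ne
  -- The radius `r + 1` leaves room for the shifts by `h z` with `h ≤ 1` and `z` in the cell.
  set C := M * (volume : Measure V2).real (Metric.closedBall 0 (r + 1)) with hC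
  have hest : ∀ n, h n ≤ 1 → |(∫ x in ω, ψ x ((h n)⁻¹ • x)) - ∫ p in ω ×ˢ cell, ψ p.1 p.2| ≤ C * h n := by
    intro n hn1
    have hn := hpos n
    have hI : ∫ x in ω, ψ x ((h n)⁻¹ • x) = ∫ x, ψ x ((h n)⁻¹ • x) :=
      setIntegral_eq_integral_of_forall_compl_eq_zero fun x hx => h0 x (fun h => hx (hKω h)) _
    -- Translating by `h z` moves the fast variable by `z` and the slow one only by `h z`, at a cost
    -- `O(h)`. Averaging over `z` in the cell then produces the mean over a full period.
    have hsh : ∀ z, ∫ x, ψ x ((h n)⁻¹ • x) = ∫ x, ψ (x + h n • z) ((h n)⁻¹ • x + z) := by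
      intro z
      rw [← integral_add_right_eq_self (μ := volume) (fun x => ψ x ((h n)⁻¹ • x)) (h n • z)]
      congr 1
      funext x
      rw [smul_add, smul_smul, inv_mul_cancel₀ hn.ne', one_smul]
    have hc1 : ∀ z, Continuous fun x => ψ (x + h n • z) ((h n)⁻¹ • x + z) := fun z =>
      hψ.continuous.comp (by fun_prop : Continuous fun x : V2 => (x + h n • z, (h n)⁻¹ • x + z))
    have hc2 : ∀ z, Continuous fun x => ψ x ((h n)⁻¹ • x + z) := fun z =>
      hψ.continuous.comp (by fun_prop : Continuous fun x : V2 => (x, (h n)⁻¹ • x + z))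
    have hz1 : ∀ z ∈ cell, ∀ x ∉ Metric.closedBall (0 : V2) (r + 1), ∀ y, ψ (x + h n • z) y = 0 := by
      intro z hz x hx y
      refine h0 _ (fun hxK => hx ?_) _
      have h2 := hr hxK
      rw [mem_closedBall_zero_iff] at h2 ⊢
      have hzn : ‖z‖ ≤ 1 := (pi_norm_le_iff_of_nonneg zero_le_one).2 fun i => by
        rw [Real.norm_eq_abs, abs_le]
        exact ⟨by linarith [hz.1 i, (show (0 : V2) i = 0 from rfl)], hz.2 i⟩
      have h3 : ‖h n • z‖ ≤ 1 := by
        rw [norm_smul, Real.norm_of_nonneg hn.le]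
        nlinarith [norm_nonneg z]
      have := norm_sub_le (x + h n • z) (h n • z)
      rw [add_sub_cancel_right] at this
      linarith
    have hz2 : ∀ x ∉ Metric.closedBall (0 : V2) (r + 1), ∀ y, ψ x y = 0 := by
      intro x hx y
      refine h0 _ (fun hxK => hx ?_) _
      have h2 := hr hxK
      rw [mem_closedBall_zero_iff] at h2 ⊢
      linarith
    have hcmp : ∀ z ∈ cell, |(∫ x, ψ x ((h n)⁻¹ • x)) - ∫ x, ψ x ((h n)⁻¹ • x + z)| ≤ C * h n := by
      intro z hz
      rw [hsh z, ← setIntegral_eq_integral_of_forall_compl_eq_zero (fun x hx => hz1 z hz x hx _),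
        ← setIntegral_eq_integral_of_forall_compl_eq_zero
          (s := Metric.closedBall (0 : V2) (r + 1)) (f := fun x => ψ x ((h n)⁻¹ • x + z))
          (fun x hx => hz2 x hx _),
        ← integral_sub ((hc1 z).continuousOn.integrableOn_compact (isCompact_closedBall _ _))
          ((hc2 z).continuousOn.integrableOn_compact (isCompact_closedBall _ _))]
      have hzn : ‖z‖ ≤ 1 := (pi_norm_le_iff_of_nonneg zero_le_one).2 fun i => by
        rw [Real.norm_eq_abs, abs_le]
        exact ⟨by linarith [hz.1 i, (show (0 : V2) i = 0 from rfl)], hz.2 i⟩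
      have hle := norm_setIntegral_le_of_norm_le_const (μ := volume) (C := M * h n)
        (f := fun x => ψ (x + h n • z) ((h n)⁻¹ • x + z) - ψ x ((h n)⁻¹ • x + z)) hball.lt_top
        fun x _ => ?_
      · refine hle.trans_eq ?_
        rw [hC]; ring
      refine (hM _ _ _).trans ?_
      rw [norm_smul, Real.norm_of_nonneg hn.le]
      gcongr
      exact mul_le_of_le_one_right hn.le hzn
    have hi2 : Integrable (fun p : V2 × V2 => ψ p.1 ((h n)⁻¹ • p.1 + p.2))
        (volume.prod (volume.restrict cell)) := by
      rw [hprod]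
      refine IntegrableOn.of_forall_sdiff_eq_zero (s := K ×ˢ cell)
        (Continuous.continuousOn (hψ.continuous.comp (by fun_prop : Continuous fun p : V2 × V2 =>
          (p.1, (h n)⁻¹ • p.1 + p.2))) |>.integrableOn_compact (hK.prod isCompact_cell))
        (MeasurableSet.univ.prod isCompact_cell.measurableSet) fun p hp => ?_
      exact h0 _ (fun h => hp.2 ⟨h, hp.1.2⟩) _
    have hswap : ∫ x, ∫ z in cell, ψ x z = ∫ z in cell, ∫ x, ψ x ((h n)⁻¹ • x + z) := by
      rw [← integral_integral_swap (f := fun x z => ψ x ((h n)⁻¹ • x + z)) hi2]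
      congr 1
      funext x
      exact ((hψ.periodic x).setIntegral_cell_add _).symm
    have hconst : ∫ x, ψ x ((h n)⁻¹ • x) = ∫ z in cell, ∫ x, ψ x ((h n)⁻¹ • x) := by
      simp [Measure.real, volume_cell]
    rw [hI, hJ, hswap, hconst, ← integral_sub (integrable_const _) hi2.integral_prod_right]
    have hle := norm_setIntegral_le_of_norm_le_const (μ := volume) (C := C * h n) (s := cell)
      (f := fun z => (∫ x, ψ x ((h n)⁻¹ • x)) - ∫ x, ψ x ((h n)⁻¹ • x + z)) (by simp [volume_cell])
      fun z hz => hcmp z hz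
    refine hle.trans_eq ?_
    simp [Measure.real, volume_cell]
  rw [tendsto_iff_norm_sub_tendsto_zero]
  refine squeeze_zero' (Eventually.of_forall fun n => norm_nonneg _)
    (g := fun n => C * h n) ?_ (by simpa using hlim.const_mul C)
  filter_upwards [hlim.eventually (gt_mem_nhds one_pos)] with n hn using hest n hn.le

end Averaging

section Density

/-- The periodization in the second variable. -/
noncomputable def periodization (g : V2 × V2 → ℝ) (x y : V2) : ℝ :=
  ∑ᶠ k : Fin 2 → ℤ, g (x, y + fun i => (k i : ℝ))

variable {ω : Set V2} {g : V2 × V2 → ℝ}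

/-- A nonzero integer translate of a point of the closed cell misses the open cell, so only `k = 0`
contributes, even on the boundary. -/
theorem periodization_eq (hs : ∀ p, g p ≠ 0 → ∀ i, p.2 i ∈ Ioo (0 : ℝ) 1) (x : V2) {y : V2}
    (hy : y ∈ cell) : periodization g x y = g (x, y) := by
  rw [periodization, finsum_eq_single _ 0]
  · congr 2
    ext i
    simp
  · intro k hk
    by_contra hne
    obtain ⟨i, hi⟩ := Function.ne_iff.1 hk
    have h1 := hs _ hne i
    simp only [Pi.add_apply, mem_Ioo] at h1
    have h2 : 0 ≤ y i := hy.1 i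
    have h3 : y i ≤ 1 := hy.2 i
    rcases lt_or_gt_of_ne hi with hlt | hgt
    · have h4 : k i ≤ -1 := by simp at hlt; omega
      have h5 : (k i : ℝ) ≤ -1 := by exact_mod_cast h4
      linarith
    · have h4 : 1 ≤ k i := by simp at hgt; omega
      have h5 : (1 : ℝ) ≤ k i := by exact_mod_cast h4
      linarith

theorem periodization_periodic (g : V2 × V2 → ℝ) (x : V2) : IsPeriodic (periodization g x) := by
  intro i y
  simp only [periodization]
  rw [← finsum_comp_equiv (Equiv.addRight (Pi.single i 1 : Fin 2 → ℤ))
    (f := fun k : Fin 2 → ℤ => g (x, y + fun i => (k i : ℝ)))]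
  refine finsum_congr fun k => ?_
  congr 2
  ext j
  by_cases hj : j = i
  · subst hj; simp; ring
  · simp [hj]

theorem locallyFinite_translates (hs : ∀ p, g p ≠ 0 → ∀ i, p.2 i ∈ Ioo (0 : ℝ) 1) :
    LocallyFinite fun k : Fin 2 → ℤ =>
      Function.support fun p : V2 × V2 => g (p.1, p.2 + fun i => (k i : ℝ)) := by
  intro p₀
  refine ⟨Metric.ball p₀ 1, Metric.ball_mem_nhds _ one_pos,
    (Set.finite_Icc (fun i => ⌊-(p₀.2 i) - 1⌋) (fun i => ⌈2 - p₀.2 i⌉)).subset ?_⟩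
  rintro k ⟨p, hp, hpb⟩
  have hd : ∀ i, |p.2 i - p₀.2 i| < 1 := by
    intro i
    rw [Metric.mem_ball, dist_eq_norm] at hpb
    exact ((norm_le_pi_norm (p - p₀).2 i).trans (norm_snd_le _)).trans_lt hpb
  have h1 := hs _ hp
  constructor
  · intro i
    have h2 := h1 i
    simp only [Pi.add_apply, mem_Ioo] at h2
    have h3 := abs_lt.1 (hd i)
    rw [← Int.cast_le (R := ℝ)]
    refine (Int.floor_le _).trans ?_
    linarith
  · intro i
    have h2 := h1 i
    simp only [Pi.add_apply, mem_Ioo] at h2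
    have h3 := abs_lt.1 (hd i)
    rw [← Int.cast_le (R := ℝ)]
    refine le_trans ?_ (Int.le_ceil _)
    linarith

theorem testFn_periodization (hg : ContDiff ℝ ((⊤ : ℕ∞) : WithTop ℕ∞) g) (hc : HasCompactSupport g)
    (hsub : tsupport g ⊆ ω ×ˢ {y | ∀ i, y i ∈ Ioo (0 : ℝ) 1}) : TestFn ω (periodization g) := by
  have hs : ∀ p, g p ≠ 0 → ∀ i, p.2 i ∈ Ioo (0 : ℝ) 1 := fun p hp =>
    (hsub (subset_tsupport _ hp)).2
  have hsm : ContDiff ℝ ((⊤ : ℕ∞) : WithTop ℕ∞) fun p : V2 × V2 => periodization g p.1 p.2 := by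
    simp only [periodization]
    rw [← contMDiff_iff_contDiff]
    refine contMDiff_finsum (fun k => ?_) (locallyFinite_translates hs)
    rw [contMDiff_iff_contDiff]
    exact hg.comp (contDiff_fst.prodMk (contDiff_snd.add contDiff_const))
  refine ⟨⟨hsm.continuous, periodization_periodic g, Prod.fst '' tsupport g,
    hc.isCompact.image continuous_fst, ?_, fun x hx y => ?_⟩, hsm⟩
  · rintro _ ⟨p, hp, rfl⟩
    exact (hsub hp).1
  · refine finsum_eq_zero_of_forall_eq_zero fun k => ?_
    by_contra h
    exact hx ⟨_, subset_tsupport _ h, rfl⟩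

theorem TestFn.memLp {ψ : V2 → V2 → ℝ} (hψ : TestFn ω ψ) (hωb : Bornology.IsBounded ω) :
    MemLp (fun p : V2 × V2 => ψ p.1 p.2) 2 (volume.restrict (ω ×ˢ cell)) := by
  have : IsFiniteMeasure (volume.restrict (ω ×ˢ cell)) :=
    ⟨by simpa using (hωb.prod isCompact_cell.isBounded).measure_lt_top⟩
  obtain ⟨M, -, hM⟩ := hψ.exists_bound
  exact MemLp.of_bound hψ.continuous.aestronglyMeasurable M (Eventually.of_forall fun p => hM p.1 p.2)

/-- By the Hilbert space criterion for density: an element orthogonal to all test functions is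
orthogonal to every smooth function with compact support in `ω` times the open cell, since such a
function agrees on the cell with its periodization. It therefore vanishes there, and the boundary of
the cell is negligible. -/
theorem exists_testFn_eLpNorm_sub_le (hω : IsOpen ω) (hωb : Bornology.IsBounded ω)
    {f : V2 × V2 → ℝ} (hf : MemLp f 2 (volume.restrict (ω ×ˢ cell))) {ε : ℝ≥0∞} (hε : ε ≠ 0) :
    ∃ ψ, TestFn ω ψ ∧ eLpNorm (fun p => f p - ψ p.1 p.2) 2 (volume.restrict (ω ×ˢ cell)) ≤ ε := by
  set μ := (volume : Measure (V2 × V2)).restrict (ω ×ˢ cell) with hμ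
  have hfin : IsFiniteMeasure μ :=
    ⟨by simpa [hμ] using (hωb.prod isCompact_cell.isBounded).measure_lt_top⟩
  let S : Submodule ℝ (Lp ℝ 2 μ) :=
    { carrier := {F | ∃ ψ, TestFn ω ψ ∧ F =ᵐ[μ] fun p => ψ p.1 p.2}
      add_mem' := by
        rintro F G ⟨ψ, hψ, h1⟩ ⟨χ, hχ, h2⟩
        refine ⟨_, hψ.add hχ, ?_⟩
        filter_upwards [Lp.coeFn_add F G, h1, h2] with p h3 h4 h5
        rw [h3, Pi.add_apply, h4, h5]
      zero_mem' := ⟨_, TestFn.zero, Lp.coeFn_zero _ _ _⟩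
      smul_mem' := by
        rintro c F ⟨ψ, hψ, h1⟩
        refine ⟨_, hψ.const_mul c, ?_⟩
        filter_upwards [Lp.coeFn_smul c F, h1] with p h3 h4
        rw [h3, Pi.smul_apply, h4, smul_eq_mul] }
  have hU : IsOpen (ω ×ˢ {y : V2 | ∀ i, y i ∈ Ioo (0 : ℝ) 1}) := by
    refine hω.prod ?_
    have : {y : V2 | ∀ i, y i ∈ Ioo (0 : ℝ) 1} = Set.pi univ fun _ => Ioo (0 : ℝ) 1 := by
      ext; simp [Set.mem_pi]
    rw [this]
    exact isOpen_set_pi finite_univ fun _ _ => isOpen_Ioo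
  have hUsub : ω ×ˢ {y : V2 | ∀ i, y i ∈ Ioo (0 : ℝ) 1} ⊆ ω ×ˢ cell :=
    prod_mono subset_rfl fun y hy => ⟨fun i => (hy i).1.le, fun i => (hy i).2.le⟩
  have hUae : (ω ×ˢ {y : V2 | ∀ i, y i ∈ Ioo (0 : ℝ) 1} : Set (V2 × V2)) =ᵐ[volume] ω ×ˢ cell := by
    refine Measure.set_prod_ae_eq (ae_eq_refl _) ?_
    have : {y : V2 | ∀ i, y i ∈ Ioo (0 : ℝ) 1} = Set.pi univ fun i => Ioo ((0 : V2) i) ((1 : V2) i) := by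
      ext; simp [Set.mem_pi]
    rw [this, cell]
    exact Measure.univ_pi_Ioo_ae_eq_Icc (μ := fun _ => (volume : Measure ℝ))
  have hdense : S.topologicalClosure = ⊤ := by
    rw [Submodule.topologicalClosure_eq_top_iff, Submodule.eq_bot_iff]
    intro F hF
    rw [Submodule.mem_orthogonal'] at hF
    have hFi : Integrable F μ := (Lp.memLp F).integrable (by norm_num)
    have hz := hU.ae_eq_zero_of_integral_contDiff_smul_eq_zero (μ := volume) (f := F)
      (IntegrableOn.locallyIntegrableOn (hFi.mono_measure (Measure.restrict_mono hUsub le_rfl))) ?_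
    · refine (Lp.eq_zero_iff_ae_eq_zero).2 ?_
      have h3 : ∀ᵐ p ∂(volume.restrict (ω ×ˢ {y : V2 | ∀ i, y i ∈ Ioo (0 : ℝ) 1})), F p = 0 :=
        (ae_restrict_iff' hU.measurableSet).2 hz
      rwa [Measure.restrict_congr_set hUae] at h3
    · intro g hg hgc hgs
      have hs : ∀ p, g p ≠ 0 → ∀ i, p.2 i ∈ Ioo (0 : ℝ) 1 := fun p hp =>
        (hgs (subset_tsupport _ hp)).2
      have hT := testFn_periodization hg hgc hgs
      have h1 := hF ((hT.memLp hωb).toLp _) ⟨_, hT, MemLp.coeFn_toLp _⟩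
      rw [L2.inner_def] at h1
      rw [← h1, ← setIntegral_eq_integral_of_forall_compl_eq_zero (s := ω ×ˢ cell)]
      · refine integral_congr_ae ?_
        filter_upwards [MemLp.coeFn_toLp (hT.memLp hωb), ae_restrict_mem
          (hω.measurableSet.prod isCompact_cell.measurableSet)] with p hp hpm
        rw [hp, periodization_eq hs _ hpm.2]
        simp
      · intro p hp
        rw [image_eq_zero_of_notMem_tsupport fun h => hp (hUsub (hgs h)), zero_smul]
  have hmem : hf.toLp f ∈ S.topologicalClosure := by rw [hdense]; trivial
  obtain ⟨F, ⟨ψ, hψ, hF⟩, hd⟩ := EMetric.mem_closure_iff.1 hmem ε (pos_iff_ne_zero.2 hε)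
  refine ⟨ψ, hψ, ?_⟩
  rw [Lp.edist_def] at hd
  refine (le_of_eq ?_).trans hd.le
  refine eLpNorm_congr_ae ?_
  filter_upwards [hf.coeFn_toLp, hF] with p h1 h2
  rw [Pi.sub_apply, h1, h2]

end Density

/-! ### Moments of the scaled strain in the thickness variable. -/

section PlateIntegrals

variable {ω : Set V2}

theorem plate_one_eq : plate ω 1 = ω ×ˢ Ioo (-(1 / 2) : ℝ) (1 / 2) := by
  simp [plate]

theorem setIntegral_thickness (b : ℝ → ℝ) :
    ∫ t in Ioo (-(1 / 2) : ℝ) (1 / 2), b t = ∫ t in (-1 / 2 : ℝ)..(1 / 2), b t := by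
  rw [intervalIntegral.integral_of_le (by norm_num), integral_Ioc_eq_integral_Ioo]
  norm_num

theorem setIntegral_plate_mul (a : V2 → ℝ) (b : ℝ → ℝ) :
    ∫ p in plate ω 1, a p.1 * b p.2 = (∫ x in ω, a x) * ∫ t in (-1 / 2 : ℝ)..(1 / 2), b t := by
  rw [plate_one_eq, ← setIntegral_thickness]
  exact setIntegral_prod_mul a b ω _

theorem integrableOn_plate_comp_fst {a : V2 → ℝ} (ha : IntegrableOn a ω) :
    IntegrableOn (fun p : V2 × ℝ => a p.1) (plate ω 1) := by
  rw [plate_one_eq, IntegrableOn, Measure.volume_eq_prod, ← Measure.prod_restrict]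
  have : IsFiniteMeasure ((volume : Measure ℝ).restrict (Ioo (-(1 / 2) : ℝ) (1 / 2))) :=
    ⟨by simp⟩
  exact ha.comp_fst _

theorem setIntegral_plate_fubini {f : V2 × ℝ → ℝ} (hf : IntegrableOn f (plate ω 1)) :
    ∫ p in plate ω 1, f p = ∫ x in ω, ∫ t in (-1 / 2 : ℝ)..(1 / 2), f (x, t) := by
  rw [plate_one_eq] at hf ⊢
  rw [Measure.volume_eq_prod, setIntegral_prod _ hf]
  simp only [setIntegral_thickness]

theorem IntegrableOn.mul_continuous_plate {f b : V2 × ℝ → ℝ} (hω : IsOpen ω)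
    (hωb : Bornology.IsBounded ω) (hf : IntegrableOn f (plate ω 1)) (hb : Continuous b) :
    IntegrableOn (fun p => f p * b p) (plate ω 1) := by
  obtain ⟨M, hM⟩ := bounded_on_plate hb hωb
  refine Integrable.mul_bdd (c := M) hf hb.aestronglyMeasurable ?_
  filter_upwards [ae_restrict_mem (measurableSet_plate hω)] with p hp using hM p hp

theorem IntegrableOn.mul_continuous_base {f b : V2 → ℝ} (hω : IsOpen ω)
    (hωb : Bornology.IsBounded ω) (hf : IntegrableOn f ω) (hb : Continuous b) :
    IntegrableOn (fun x => f x * b x) ω := by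
  obtain ⟨M, hM⟩ := hωb.isCompact_closure.exists_bound_of_continuousOn hb.continuousOn
  refine Integrable.mul_bdd (c := M) hf hb.aestronglyMeasurable ?_
  filter_upwards [ae_restrict_mem hω.measurableSet] with p hp using hM p (subset_closure hp)

theorem integral_thickness_moments :
    ∫ _ in (-1 / 2 : ℝ)..(1 / 2), (1 : ℝ) = 1 ∧ ∫ t in (-1 / 2 : ℝ)..(1 / 2), t = 0 ∧
      ∫ t in (-1 / 2 : ℝ)..(1 / 2), t ^ 2 = 1 / 12 ∧
      ∫ t in (-1 / 2 : ℝ)..(1 / 2), bubble t = 1 / 12 := by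
  refine ⟨by norm_num, by norm_num, by norm_num [integral_pow], ?_⟩
  simp only [bubble]
  rw [intervalIntegral.integral_sub (by simp) (by
    apply Continuous.intervalIntegrable; fun_prop), intervalIntegral.integral_div]
  norm_num [integral_pow]

end PlateIntegrals

/-- The coefficients of the in-plane tangent vector on the mid-surface. -/
noncomputable def baseTangent (θ : V2 → ℝ) (h : ℝ) (α : Fin 2) (k : Fin 3) (x : V2) : ℝ :=
  (if α.castSucc = k then 1 else 0) + (if k = 2 then h * pderiv α θ (h⁻¹ • x) else 0)

theorem tangent_eq (θ : V2 → ℝ) (h : ℝ) (α : Fin 2) (k : Fin 3) (p : V2 × ℝ) :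
    tangent θ h α k p = baseTangent θ h α k p.1 +
      h ^ 2 * p.2 * pderiv α (fun x => normal θ h x k) p.1 := rfl

theorem continuous_baseTangent {θ : V2 → ℝ} (hθ : ContDiff ℝ 2 θ) (h : ℝ) (α : Fin 2) (k : Fin 3) :
    Continuous (baseTangent θ h α k) := by
  unfold baseTangent
  have h1 : Continuous fun x : V2 => pderiv α θ (h⁻¹ • x) :=
    (contDiff_pderiv hθ α).continuous.comp (by fun_prop)
  refine continuous_const.add ?_
  split_ifs <;> fun_prop

/-- `h⁻⁴ (∇y ∘ Θ^h ∘ P^h - R)`. -/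
noncomputable def increment (θ : V2 → ℝ) (h : ℝ) (Dy : V3 → M3) (R : V2 → M3) (p : V2 × ℝ) : M3 :=
  (h ^ 4)⁻¹ • (Dy (ThetaP θ h p) - R p.1)

section Moments

variable {ω : Set V2} {θ : V2 → ℝ} {h : ℝ} {y : V3 → V3} {Dy : V3 → M3} {R : V2 → M3}
  {DR : V2 → Fin 3 → Fin 3 → V2} {φ : V2 → ℝ}

theorem HasWeakGrad.integrableOn {d : ℕ} {U : Set (Fin d → ℝ)} {f : (Fin d → ℝ) → ℝ}
    {g : (Fin d → ℝ) → Fin d → ℝ} (hf : HasWeakGrad U f g) (hU : volume U ≠ ⊤) :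
    IntegrableOn f U ∧ ∀ i, IntegrableOn (fun x => g x i) U := by
  have : IsFiniteMeasure (volume.restrict U) := ⟨by simpa using hU.lt_top⟩
  exact ⟨hf.memLp.integrable (by norm_num), fun i => (hf.memLp_grad i).integrable (by norm_num)⟩

theorem increment_apply (hh : 0 < h) (p : V2 × ℝ) (i k : Fin 3) :
    Dy (ThetaP θ h p) i k = R p.1 i k + h ^ 4 * increment θ h Dy R p i k := by
  simp only [increment, Matrix.smul_apply, Matrix.sub_apply, smul_eq_mul]
  field_simp
  ring

theorem integral_coord_mul_pderiv (hφ : ContDiff ℝ 1 φ) (hφc : HasCompactSupport φ)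
    (hφω : tsupport φ ⊆ ω) (α β : Fin 2) :
    ∫ x in ω, x β * pderiv α φ x = - ∫ x in ω, (if β = α then 1 else 0) * φ x := by
  rw [setIntegral_eq_integral_of_forall_compl_eq_zero fun x hx => by
      rw [image_eq_zero_of_notMem_tsupport fun h => hx (hφω (tsupport_pderiv_subset φ α h)), mul_zero],
    setIntegral_eq_integral_of_forall_compl_eq_zero fun x hx => by
      rw [image_eq_zero_of_notMem_tsupport fun h => hx (hφω h), mul_zero]]
  have hc := continuous_pderiv hφ α
  have hcc := hasCompactSupport_pderiv hφc α
  have hp : ∀ x : V2, fderiv ℝ (fun x : V2 => x β) x (Pi.single α 1) = if β = α then 1 else 0 := by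
    intro x
    have := pderiv_apply (x := x) α β
    rw [pderiv] at this
    rw [this]
    simp [eq_comm]
  have := integral_mul_fderiv_eq_neg_fderiv_mul_of_integrable (μ := volume) (f := fun x : V2 => x β)
    (g := φ) (v := Pi.single α 1) ?_ ?_ ?_ (fun x _ => by fun_prop)
    (fun x _ => hφ.differentiable (by simp) x)
  · simpa only [hp, ← pderiv.eq_1] using this
  · simp only [hp]
    exact (continuous_const.mul hφ.continuous).integrable_of_hasCompactSupport hφc.mul_left
  · exact ((continuous_apply β).mul hc).integrable_of_hasCompactSupport hcc.mul_left
  · exact ((continuous_apply β).mul hφ.continuous).integrable_of_hasCompactSupport hφc.mul_left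

variable (hg : GoodScale ω θ h) (hθ : ContDiff ℝ 2 θ) (hω : IsOpen ω) (hωb : Bornology.IsBounded ω)
  (hy : ∀ i, HasWeakGrad (shell ω θ h) (fun x => y x i) (fun x => Dy x i))
  (hDR : ∀ i j, HasWeakGrad ω (fun x => R x i j) (fun x => DR x i j))

include hg hθ hωb hy hDR in
theorem integrableOn_increment (i k : Fin 3) :
    IntegrableOn (fun p => increment θ h Dy R p i k) (plate ω 1) := by
  have h1 := hg.integrableOn_comp hθ (((hy i).integrableOn (hg.volume_shell_ne_top hθ hωb)).2 k)
  have h2 := integrableOn_plate_comp_fst ((hDR i k).integrableOn hωb.measure_lt_top.ne).1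
  exact (Integrable.sub h1 h2).const_mul _

include hg hθ hω hωb hy hDR in
theorem sum_integral_gradient (i : Fin 3) {b : Fin 3 → V2 × ℝ → ℝ} (hb : ∀ k, Continuous (b k)) :
    ∑ k, ∫ p in plate ω 1, Dy (ThetaP θ h p) i k * b k p =
      (∑ k, ∫ p in plate ω 1, R p.1 i k * b k p) +
        h ^ 4 * ∑ k, ∫ p in plate ω 1, increment θ h Dy R p i k * b k p := by
  rw [Finset.mul_sum, ← Finset.sum_add_distrib]
  refine Finset.sum_congr rfl fun k _ => ?_
  have h2 := integrableOn_plate_comp_fst ((hDR i k).integrableOn hωb.measure_lt_top.ne).1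
  have h3 := integrableOn_increment hg hθ hωb hy hDR i k
  rw [← integral_const_mul, ← integral_add (IntegrableOn.mul_continuous_plate hω hωb h2 (hb k))
    ((IntegrableOn.mul_continuous_plate hω hωb h3 (hb k)).const_mul _)]
  congr 1
  funext p
  have := increment_apply (θ := θ) (Dy := Dy) (R := R) hg.pos p i k
  simp only [this]
  ring

include hg hθ hω hωb hy hDR in
/-- The gradient of the in-plane displacement, tested with `φ`. -/
theorem integral_inPlane_gradient {Duh : V2 → M2} (β α : Fin 2)
    (hDuh : HasWeakGrad ω (fun x => inPlane θ h y R x β) (fun x => Duh x β))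
    (hφ : ContDiff ℝ ((⊤ : ℕ∞) : WithTop ℕ∞) φ) (hφc : HasCompactSupport φ) (hφω : tsupport φ ⊆ ω) :
    ∫ x in ω, Duh x β α * φ x =
      (∫ x in ω, (h ^ 4)⁻¹ * (R x - 1) β.castSucc α.castSucc * φ x) -
      (∫ x in ω, (h ^ 2)⁻¹ * DR x β.castSucc 2 α * (theta0 θ (h⁻¹ • x) * φ x)) +
      ∑ k, ∫ p in plate ω 1, increment θ h Dy R p β.castSucc k * (tangent θ h α k p * φ p.1) := by
  have hh := hg.pos
  have hφ1 : ContDiff ℝ 1 φ := hφ.of_le (by exact_mod_cast le_top)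
  have hRi := fun i j => ((hDR i j).integrableOn hωb.measure_lt_top.ne).1
  have hDRi := fun i j => ((hDR i j).integrableOn hωb.measure_lt_top.ne).2
  have hθ0 : ContDiff ℝ 1 fun x => theta0 θ (h⁻¹ • x) := by
    unfold theta0
    exact ((hθ.of_le (by norm_num)).comp (contDiff_const_smul (h⁻¹ : ℝ))).sub contDiff_const
  have hθ0d : ∀ x, pderiv α (fun x => theta0 θ (h⁻¹ • x)) x = h⁻¹ * pderiv α θ (h⁻¹ • x) := by
    intro x
    have h1 : DifferentiableAt ℝ (theta0 θ) (h⁻¹ • x) :=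
      (hθ.differentiable (by simp) _).sub_const _
    rw [pderiv_comp_smul _ _ h1]
    have h2 : theta0 θ = fun y => θ y - ∫ z in cell, θ z := rfl
    rw [h2, pderiv, fderiv_sub_const, pderiv]
  have hcp := continuous_pderiv hφ1 α
  -- the displacement
  have e0 := hDuh.integral_eq φ hφ hφc hφω α
  have hyi := hg.integrableOn_comp hθ ((hy β.castSucc).integrableOn (hg.volume_shell_ne_top hθ hωb)).1
  have hyφ : IntegrableOn (fun p => y (ThetaP θ h p) β.castSucc * pderiv α φ p.1) (plate ω 1) :=
    IntegrableOn.mul_continuous_plate hω hωb hyi (hcp.comp continuous_fst)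
  have e1 : ∫ p in plate ω 1, y (ThetaP θ h p) β.castSucc * pderiv α φ p.1 =
      ∫ x in ω, (∫ t in (-1 / 2 : ℝ)..(1 / 2), y (ThetaP θ h (x, t)) β.castSucc) * pderiv α φ x := by
    rw [setIntegral_plate_fubini hyφ]
    simp only [intervalIntegral.integral_mul_const]
  have hYi : IntegrableOn (fun x => (∫ t in (-1 / 2 : ℝ)..(1 / 2), y (ThetaP θ h (x, t)) β.castSucc) *
      pderiv α φ x) ω := by
    refine IntegrableOn.mul_continuous_base hω hωb ?_ hcp
    rw [plate_one_eq, IntegrableOn, Measure.volume_eq_prod, ← Measure.prod_restrict] at hyi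
    refine hyi.integral_prod_left.congr (Eventually.of_forall fun x => ?_)
    exact setIntegral_thickness _
  have hxi : IntegrableOn (fun x : V2 => x β * pderiv α φ x) ω :=
    IntegrableOn.mul_continuous_base hω hωb
      ((continuous_apply β).continuousOn.integrableOn_compact hωb.isCompact_closure |>.mono_set
        subset_closure) hcp
  have hRθi : IntegrableOn (fun x => R x β.castSucc 2 * (theta0 θ (h⁻¹ • x) * pderiv α φ x)) ω :=
    IntegrableOn.mul_continuous_base hω hωb (hRi _ _) (hθ0.continuous.mul hcp)
  have e2 : ∫ x in ω, inPlane θ h y R x β * pderiv α φ x = (h ^ 4)⁻¹ *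
      ((∫ p in plate ω 1, y (ThetaP θ h p) β.castSucc * pderiv α φ p.1) -
        (∫ x in ω, x β * pderiv α φ x) -
        h ^ 2 * ∫ x in ω, R x β.castSucc 2 * (theta0 θ (h⁻¹ • x) * pderiv α φ x)) := by
    have hYx : IntegrableOn (fun x => (∫ t in (-1 / 2 : ℝ)..(1 / 2),
        y (ThetaP θ h (x, t)) β.castSucc) * pderiv α φ x - x β * pderiv α φ x) ω := hYi.sub hxi
    rw [e1, ← integral_const_mul (h ^ 2), ← integral_sub hYi hxi,
      ← integral_sub hYx (hRθi.const_mul _), ← integral_const_mul]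
    congr 1
    funext x
    rw [inPlane]
    ring
  -- the curvature correction
  have e3 := (hDR β.castSucc 2).integral_eq_of_contDiff_one hω hωb.measure_lt_top.ne
    (hθ0.mul hφ1) (hφc.mul_left) ((tsupport_mul_subset_right).trans hφω) α
  have hRdθ : IntegrableOn (fun x => R x β.castSucc 2 * (h * pderiv α θ (h⁻¹ • x) * φ x)) ω :=
    IntegrableOn.mul_continuous_base hω hωb (hRi _ _)
      ((continuous_const.mul ((contDiff_pderiv hθ α).continuous.comp (by fun_prop))).mul hφ.continuous)
  -- Differentiating `h² θ₀(x/h)` leaves `h ∂_α θ(x/h)`; this term cancels against the vertical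
  -- component of the tangent vector in `e6`.
  have e4 : h ^ 2 * ∫ x in ω, R x β.castSucc 2 * pderiv α (fun x => theta0 θ (h⁻¹ • x) * φ x) x =
      h ^ 2 * (∫ x in ω, R x β.castSucc 2 * (theta0 θ (h⁻¹ • x) * pderiv α φ x)) +
      ∫ x in ω, R x β.castSucc 2 * (h * pderiv α θ (h⁻¹ • x) * φ x) := by
    rw [← integral_const_mul, ← integral_const_mul, ← integral_add (hRθi.const_mul _) hRdθ]
    congr 1
    funext x
    rw [pderiv_mul _ (hθ0.differentiable (by simp) x) (hφ1.differentiable (by simp) x), hθ0d]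
    field_simp
  -- the deformation gradient
  have e5 := hg.integral_tangent hθ hω hωb (hy β.castSucc) hφ1 hφc hφω (c := fun _ => 1)
    contDiff_const α
  simp only [mul_one] at e5
  rw [sum_integral_gradient hg hθ hω hωb hy hDR β.castSucc
    (b := fun k p => tangent θ h α k p * φ p.1)
    (fun k => (continuous_tangent hθ h α k).mul (hφ.continuous.comp continuous_fst))] at e5
  -- `R` does not depend on `t`, so the part of the tangent vector that is linear in `t` integrates
  -- to zero.
  have e6 : ∑ k, ∫ p in plate ω 1, R p.1 β.castSucc k * (tangent θ h α k p * φ p.1) =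
      (∫ x in ω, R x β.castSucc α.castSucc * φ x) +
      ∫ x in ω, R x β.castSucc 2 * (h * pderiv α θ (h⁻¹ • x) * φ x) := by
    have hk : ∀ k, ∫ p in plate ω 1, R p.1 β.castSucc k * (tangent θ h α k p * φ p.1) =
        ∫ x in ω, R x β.castSucc k * (baseTangent θ h α k x * φ x) := by
      intro k
      have c1 : IntegrableOn (fun x => R x β.castSucc k * (baseTangent θ h α k x * φ x)) ω :=
        IntegrableOn.mul_continuous_base hω hωb (hRi _ _)
          ((continuous_baseTangent hθ h α k).mul hφ.continuous)
      have c2 : IntegrableOn (fun x => R x β.castSucc k *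
          (h ^ 2 * pderiv α (fun x => normal θ h x k) x * φ x)) ω :=
        IntegrableOn.mul_continuous_base hω hωb (hRi _ _)
          ((continuous_const.mul (continuous_pderiv (contDiff_normal_apply hθ h k) α)).mul hφ.continuous)
      have c3 := setIntegral_plate_mul (ω := ω) (fun x => R x β.castSucc k * (baseTangent θ h α k x * φ x))
        fun _ => 1
      have c4 := setIntegral_plate_mul (ω := ω) (fun x => R x β.castSucc k *
          (h ^ 2 * pderiv α (fun x => normal θ h x k) x * φ x)) fun t => t
      rw [integral_thickness_moments.1, mul_one] at c3
      rw [integral_thickness_moments.2.1, mul_zero] at c4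
      refine Eq.trans ?_ ((congrArg₂ (· + ·) c3 c4).trans (add_zero _))
      rw [← integral_add (by simpa only [mul_one] using (integrableOn_plate_comp_fst c1).integrable)
        (IntegrableOn.mul_continuous_plate hω hωb (integrableOn_plate_comp_fst c2) continuous_snd)]
      congr 1
      funext p
      rw [tangent_eq]
      ring
    have ht : IntegrableOn (fun x => R x β.castSucc 2 * (h * pderiv α θ (h⁻¹ • x) * φ x)) ω := hRdθ
    simp only [hk, Fin.sum_univ_three]
    fin_cases α <;> simp [baseTangent]
  have e7 : ∫ x in ω, (h ^ 4)⁻¹ * (R x - 1) β.castSucc α.castSucc * φ x = (h ^ 4)⁻¹ *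
      ((∫ x in ω, R x β.castSucc α.castSucc * φ x) - ∫ x in ω, (if β = α then 1 else 0) * φ x) := by
    have hci : IntegrableOn (fun x => (if β = α then 1 else 0) * φ x) ω :=
      ((continuous_const.mul hφ.continuous).integrable_of_hasCompactSupport
        hφc.mul_left).integrableOn
    rw [← integral_sub (IntegrableOn.mul_continuous_base hω hωb (hRi _ _) hφ.continuous) hci,
      ← integral_const_mul]
    congr 1
    funext x
    simp only [Matrix.sub_apply, Matrix.one_apply, Fin.castSucc_inj]
    ring
  have e8 : ∫ x in ω, (h ^ 2)⁻¹ * DR x β.castSucc 2 α * (theta0 θ (h⁻¹ • x) * φ x) =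
      (h ^ 2)⁻¹ * ∫ x in ω, DR x β.castSucc 2 α * (theta0 θ (h⁻¹ • x) * φ x) := by
    rw [← integral_const_mul]
    simp only [mul_assoc]
  rw [integral_coord_mul_pderiv hφ1 hφc hφω] at e2
  rw [e7, e8]
  rw [e6] at e5
  set X := ∫ x in ω, Duh x β α * φ x
  rw [e2] at e0
  have h4 : h ^ 4 ≠ 0 := by positivity
  have h24 : h ^ 4 * (h ^ 2)⁻¹ = h ^ 2 := by
    field_simp
  refine mul_left_cancel₀ h4 ?_
  rw [mul_add, mul_sub, mul_inv_cancel_left₀ h4, ← mul_assoc (h ^ 4) (h ^ 2)⁻¹, h24]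
  have e9 := congrArg (h ^ 4 * ·) e0
  beta_reduce at e9
  rw [mul_inv_cancel_left₀ h4] at e9
  have e10 := congrArg (h ^ 2 * ·) e3
  beta_reduce at e10
  linarith

include hg hθ hω hωb hy hDR in
/-- The first moment of the scaled strain in the thickness variable. -/
theorem sum_integral_first_moment (i : Fin 3) (α : Fin 2)
    (hφ : ContDiff ℝ 2 φ) (hφc : HasCompactSupport φ) (hφω : tsupport φ ⊆ ω) :
    ∑ k, ∫ p in plate ω 1, increment θ h Dy R p i k * (tangent θ h α k p * (φ p.1 * p.2)) =
      1 / 12 * (∑ k, ∫ x in ω, (h ^ 2)⁻¹ * DR x i k α * (normal θ h x k * φ x)) -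
      h ^ 2 * ∑ k, ∫ p in plate ω 1, increment θ h Dy R p i k *
        (normal θ h p.1 k * (pderiv α φ p.1 * bubble p.2)) := by
  have hh := hg.pos
  have hφ1 : ContDiff ℝ 1 φ := hφ.of_le (by norm_num)
  have hφ' : ContDiff ℝ 1 (pderiv α φ) := contDiff_pderiv hφ α
  have hRi := fun i j => ((hDR i j).integrableOn hωb.measure_lt_top.ne).1
  have hn := fun k => contDiff_normal_apply hθ h k
  have hbub := contDiff_bubble.continuous
  have e1 := hg.integral_tangent hθ hω hωb (hy i) hφ1 hφc hφω (c := fun t => t) contDiff_id α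
  rw [sum_integral_gradient hg hθ hω hωb hy hDR i
    (b := fun k p => tangent θ h α k p * (φ p.1 * p.2))
    (fun k => (continuous_tangent hθ h α k).mul
      ((hφ.continuous.comp continuous_fst).mul continuous_snd))] at e1
  -- The integral of `f ∂_α φ t` is computed twice: `e1` moves `∂_α` onto the deformation, while
  -- `e2` writes `t` as `-bubble'` and integrates across the thickness. Equating the two eliminates
  -- the deformation itself.
  have e2 := hg.integral_normal hθ hω hωb (hy i) hφ' (hasCompactSupport_pderiv hφc α)
    ((tsupport_pderiv_subset φ α).trans hφω)
  rw [sum_integral_gradient hg hθ hω hωb hy hDR i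
    (b := fun k p => h ^ 2 * normal θ h p.1 k * (pderiv α φ p.1 * bubble p.2))
    (fun k => (continuous_const.mul ((hn k).continuous.comp continuous_fst)).mul
      ((hφ'.continuous.comp continuous_fst).mul (hbub.comp continuous_snd)))] at e2
  have m1 : ∀ k, ∫ p in plate ω 1, R p.1 i k * (tangent θ h α k p * (φ p.1 * p.2)) =
      h ^ 2 / 12 * ∫ x in ω, R x i k * (pderiv α (fun x => normal θ h x k) x * φ x) := by
    intro k
    have c1 : IntegrableOn (fun x => R x i k * (baseTangent θ h α k x * φ x)) ω :=
      IntegrableOn.mul_continuous_base hω hωb (hRi _ _)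
        ((continuous_baseTangent hθ h α k).mul hφ.continuous)
    have c2 : IntegrableOn (fun x => R x i k *
        (pderiv α (fun x => normal θ h x k) x * φ x)) ω :=
      IntegrableOn.mul_continuous_base hω hωb (hRi _ _)
        ((continuous_pderiv (hn k) α).mul hφ.continuous)
    have c3 := setIntegral_plate_mul (ω := ω) (fun x => R x i k * (baseTangent θ h α k x * φ x))
      fun t => t
    have c4 := setIntegral_plate_mul (ω := ω) (fun x => R x i k *
        (pderiv α (fun x => normal θ h x k) x * φ x)) fun t => t ^ 2
    rw [integral_thickness_moments.2.1, mul_zero] at c3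
    rw [integral_thickness_moments.2.2.1] at c4
    rw [show ∀ a : ℝ, h ^ 2 / 12 * a = h ^ 2 * (a * (1 / 12)) by intro a; ring, ← c4,
      ← zero_add (h ^ 2 * _), ← c3, ← integral_const_mul, ← integral_add
      (IntegrableOn.mul_continuous_plate hω hωb (integrableOn_plate_comp_fst c1) continuous_snd)
      ((IntegrableOn.mul_continuous_plate hω hωb (integrableOn_plate_comp_fst c2)
        (by fun_prop : Continuous fun p : V2 × ℝ => p.2 ^ 2)).const_mul _)]
    congr 1
    funext p
    rw [tangent_eq]
    ring
  have m2 : ∀ k, ∫ p in plate ω 1, R p.1 i k *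
      (h ^ 2 * normal θ h p.1 k * (pderiv α φ p.1 * bubble p.2)) =
      h ^ 2 / 12 * ∫ x in ω, R x i k * (normal θ h x k * pderiv α φ x) := by
    intro k
    have c4 := setIntegral_plate_mul (ω := ω) (fun x => R x i k *
        (normal θ h x k * pderiv α φ x)) bubble
    rw [integral_thickness_moments.2.2.2] at c4
    rw [show ∀ a : ℝ, h ^ 2 / 12 * a = h ^ 2 * (a * (1 / 12)) by intro a; ring, ← c4,
      ← integral_const_mul]
    congr 1
    funext p
    ring
  have m3 : ∀ k, ∫ p in plate ω 1, increment θ h Dy R p i k *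
      (h ^ 2 * normal θ h p.1 k * (pderiv α φ p.1 * bubble p.2)) = h ^ 2 *
      ∫ p in plate ω 1, increment θ h Dy R p i k *
        (normal θ h p.1 k * (pderiv α φ p.1 * bubble p.2)) := by
    intro k
    rw [← integral_const_mul]
    congr 1
    funext p
    ring
  -- The `R`-parts of `e1` and `e2` carry the same factor `h²/12` and combine into the derivative of
  -- `n φ`, which is then moved onto `R`.
  have m4 : ∀ k, (∫ x in ω, R x i k * (normal θ h x k * pderiv α φ x)) +
      (∫ x in ω, R x i k * (pderiv α (fun x => normal θ h x k) x * φ x)) =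
      - ∫ x in ω, DR x i k α * (normal θ h x k * φ x) := by
    intro k
    have c1 : IntegrableOn (fun x => R x i k * (normal θ h x k * pderiv α φ x)) ω :=
      IntegrableOn.mul_continuous_base hω hωb (hRi _ _) ((hn k).continuous.mul hφ'.continuous)
    have c2 : IntegrableOn (fun x => R x i k *
        (pderiv α (fun x => normal θ h x k) x * φ x)) ω :=
      IntegrableOn.mul_continuous_base hω hωb (hRi _ _)
        ((continuous_pderiv (hn k) α).mul hφ.continuous)
    rw [← (hDR i k).integral_eq_of_contDiff_one hω hωb.measure_lt_top.ne
      ((hn k).mul hφ1) (hφc.mul_left) ((tsupport_mul_subset_right).trans hφω) α,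
      ← integral_add c1 c2]
    congr 1
    funext x
    rw [pderiv_mul _ ((hn k).differentiable (by simp) x) (hφ1.differentiable (by simp) x)]
    ring
  have m5 : ∀ k, ∫ x in ω, (h ^ 2)⁻¹ * DR x i k α * (normal θ h x k * φ x) =
      (h ^ 2)⁻¹ * ∫ x in ω, DR x i k α * (normal θ h x k * φ x) := by
    intro k
    rw [← integral_const_mul]
    simp only [mul_assoc]
  have m6 := Finset.sum_congr rfl fun k (_ : k ∈ Finset.univ) => m4 k
  rw [Finset.sum_add_distrib, Finset.sum_neg_distrib] at m6
  simp only [m1, m2, m3, m5, ← Finset.mul_sum] at e1 e2 ⊢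
  rw [e1] at e2
  set A := ∑ k, ∫ p in plate ω 1, increment θ h Dy R p i k * (tangent θ h α k p * (φ p.1 * p.2))
  set B := ∑ k, ∫ p in plate ω 1, increment θ h Dy R p i k *
        (normal θ h p.1 k * (pderiv α φ p.1 * bubble p.2))
  set D := ∑ k, ∫ x in ω, DR x i k α * (normal θ h x k * φ x)
  have h2 : h ^ 2 ≠ 0 := by positivity
  have h4 : h ^ 4 ≠ 0 := by positivity
  refine mul_left_cancel₀ h4 ?_
  have : h ^ 4 * (1 / 12 * ((h ^ 2)⁻¹ * D) - h ^ 2 * B) = h ^ 2 / 12 * D - h ^ 4 * (h ^ 2 * B) := by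
    field_simp
  rw [this, ← neg_eq_iff_eq_neg.2 m6]
  linarith

end Moments

/-! ### Products of bounded and vanishing sequences in `L²`, and averaging against a fixed `L²`
factor. -/

section SquareIntegrable

variable {X : Type*} [MeasurableSpace X] {μ : Measure X}

theorem integral_abs_mul_le {f g : X → ℝ} (hf : MemLp f 2 μ) (hg : MemLp g 2 μ) :
    ∫ x, |f x * g x| ∂μ ≤ (eLpNorm f 2 μ).toReal * (eLpNorm g 2 μ).toReal := by
  have h1 : MemLp (f • g) 1 μ := hg.smul hf
  have h2 : eLpNorm (f • g) 1 μ ≤ eLpNorm f 2 μ * eLpNorm g 2 μ :=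
    eLpNorm_smul_le_mul_eLpNorm hg.1 hf.1
  have h3 : ∫ x, |f x * g x| ∂μ = (eLpNorm (f • g) 1 μ).toReal := by
    rw [eLpNorm_one_eq_lintegral_enorm, ← integral_norm_eq_lintegral_enorm h1.1]
    rfl
  rw [h3, ← ENNReal.toReal_mul]
  exact ENNReal.toReal_mono (ENNReal.mul_ne_top hf.2.ne hg.2.ne) h2

theorem tendsto_integral_abs_mul_zero {f g : ℕ → X → ℝ} {C : ℝ≥0∞} (hC : C ≠ ⊤)
    (hf : ∀ᶠ n in atTop, MemLp (f n) 2 μ ∧ eLpNorm (f n) 2 μ ≤ C)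
    (hg : ∀ᶠ n in atTop, MemLp (g n) 2 μ)
    (hg0 : Tendsto (fun n => eLpNorm (g n) 2 μ) atTop (𝓝 0)) :
    Tendsto (fun n => ∫ x, |f n x * g n x| ∂μ) atTop (𝓝 0) := by
  have h1 : Tendsto (fun n => C.toReal * (eLpNorm (g n) 2 μ).toReal) atTop (𝓝 0) := by
    simpa using ((ENNReal.tendsto_toReal ENNReal.zero_ne_top).comp hg0).const_mul C.toReal
  refine squeeze_zero' (Eventually.of_forall fun n => integral_nonneg fun x => abs_nonneg _) ?_ h1
  filter_upwards [hf, hg] with n hn hgn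
  refine (integral_abs_mul_le hn.1 hgn).trans ?_
  gcongr
  exact hn.2

theorem tendsto_integral_mul_zero {f g : ℕ → X → ℝ} {C : ℝ≥0∞} (hC : C ≠ ⊤)
    (hf : ∀ᶠ n in atTop, MemLp (f n) 2 μ ∧ eLpNorm (f n) 2 μ ≤ C)
    (hg : ∀ᶠ n in atTop, MemLp (g n) 2 μ)
    (hg0 : Tendsto (fun n => eLpNorm (g n) 2 μ) atTop (𝓝 0)) :
    Tendsto (fun n => ∫ x, f n x * g n x ∂μ) atTop (𝓝 0) :=
  squeeze_zero_norm (fun _ => norm_integral_le_integral_norm _)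
    (tendsto_integral_abs_mul_zero hC hf hg hg0)

theorem integrable_mul_of_memLp {f g : X → ℝ} (hf : MemLp f 2 μ) (hg : MemLp g 2 μ) :
    Integrable (fun x => f x * g x) μ :=
  hf.integrable_mul hg

theorem abs_integral_mul_sub_le {f g φ : X → ℝ} (hf : MemLp f 2 μ) (hg : MemLp g 2 μ)
    (hφ : MemLp φ 2 μ) : |(∫ x, f x * φ x ∂μ) - ∫ x, g x * φ x ∂μ| ≤
      (eLpNorm (fun x => f x - g x) 2 μ).toReal * (eLpNorm φ 2 μ).toReal := by
  rw [← integral_sub (integrable_mul_of_memLp hf hφ) (integrable_mul_of_memLp hg hφ)]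
  refine le_trans ?_ (integral_abs_mul_le (hf.sub hg) hφ)
  refine (abs_integral_le_integral_abs).trans_eq ?_
  simp only [sub_mul]

theorem memLp_and_tendsto_of_bound [IsFiniteMeasure μ] {g : ℕ → X → ℝ} {δ : ℕ → ℝ}
    (hm : ∀ n, AEStronglyMeasurable (g n) μ) (hb : ∀ᶠ n in atTop, ∀ᵐ x ∂μ, |g n x| ≤ δ n)
    (hδ : Tendsto δ atTop (𝓝 0)) :
    (∀ᶠ n in atTop, MemLp (g n) 2 μ) ∧ Tendsto (fun n => eLpNorm (g n) 2 μ) atTop (𝓝 0) := by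
  constructor
  · filter_upwards [hb] with n hn using MemLp.of_bound (hm n) _ hn
  · have h1 : Tendsto (fun n => μ univ ^ (2 : ℝ≥0∞).toReal⁻¹ * ENNReal.ofReal (δ n)) atTop (𝓝 0) := by
      have := ENNReal.Tendsto.const_mul (a := μ univ ^ (2 : ℝ≥0∞).toReal⁻¹)
        (ENNReal.tendsto_ofReal hδ) (Or.inr (by finiteness))
      simpa using this
    refine tendsto_of_tendsto_of_tendsto_of_le_of_le' tendsto_const_nhds h1
      (Eventually.of_forall fun n => zero_le) ?_
    filter_upwards [hb] with n hn using eLpNorm_le_of_ae_bound hn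

end SquareIntegrable

section Averaging

variable {ω : Set V2} {ψ : V2 → V2 → ℝ} {f : V2 → ℝ} {h : ℕ → ℝ}

theorem memLp_comp_fst (hf : MemLp f 2 (volume.restrict ω)) :
    MemLp (fun p : V2 × V2 => f p.1) 2 (volume.restrict (ω ×ˢ cell)) := by
  have : IsFiniteMeasure (volume.restrict cell) := ⟨by simp [volume_cell]⟩
  rw [Measure.volume_eq_prod, ← Measure.prod_restrict]
  exact hf.comp_fst _

theorem eLpNorm_comp_fst (hf : AEStronglyMeasurable f (volume.restrict ω)) :
    eLpNorm (fun p : V2 × V2 => f p.1) 2 (volume.restrict (ω ×ˢ cell)) =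
      eLpNorm f 2 (volume.restrict ω) := by
  have : IsProbabilityMeasure (volume.restrict cell) := ⟨by simp [volume_cell]⟩
  rw [Measure.volume_eq_prod, ← Measure.prod_restrict]
  exact eLpNorm_comp_measurePreserving hf measurePreserving_fst

theorem TestFn.osc_memLp (hψ : TestFn ω ψ) (hωb : Bornology.IsBounded ω) (r : ℝ) :
    MemLp (fun x => ψ x (r⁻¹ • x)) 2 (volume.restrict ω) := by
  have : IsFiniteMeasure (volume.restrict ω) := ⟨by simpa using hωb.measure_lt_top⟩
  obtain ⟨M, -, hM⟩ := hψ.exists_bound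
  exact MemLp.of_bound (hψ.continuous_osc r).aestronglyMeasurable M (Eventually.of_forall fun x => hM x _)

theorem TestFn.exists_osc_eLpNorm_le (hψ : TestFn ω ψ) (hωb : Bornology.IsBounded ω) :
    ∃ C : ℝ≥0∞, C ≠ ⊤ ∧ ∀ r : ℝ, eLpNorm (fun x => ψ x (r⁻¹ • x)) 2 (volume.restrict ω) ≤ C := by
  obtain ⟨M, -, hM⟩ := hψ.exists_bound
  have := hωb.measure_lt_top (μ := volume)
  refine ⟨_, ?_, fun r => eLpNorm_le_of_ae_bound (Eventually.of_forall fun x => hM x (r⁻¹ • x))⟩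
  simp only [Measure.restrict_apply_univ]
  finiteness

theorem TestFn.fst_mul (hψ : TestFn ω ψ) (hf : ContDiff ℝ ((⊤ : ℕ∞) : WithTop ℕ∞) f) :
    TestFn ω fun x y => f x * ψ x y := by
  obtain ⟨K, hK, hKω, h0⟩ := hψ.support
  exact ⟨⟨(hf.continuous.comp continuous_fst).mul hψ.continuous, fun x i y => by
      rw [hψ.periodic x i], K, hK, hKω, fun x hx y => by rw [h0 x hx, mul_zero]⟩,
    (hf.comp contDiff_fst).mul hψ.smooth⟩

/-- The class of test functions is stable under multiplication by smooth functions of `x`. An `L²`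
factor is approximated by such functions, with an error uniform in `n` because the oscillating test
functions are bounded in `L²`. -/
theorem TestFn.tendsto_average_mul (hψ : TestFn ω ψ) (hωb : Bornology.IsBounded ω)
    (hpos : ∀ n, 0 < h n) (hlim : Tendsto h atTop (𝓝 0)) (hf : MemLp f 2 (volume.restrict ω)) :
    Tendsto (fun n => ∫ x in ω, f x * ψ x ((h n)⁻¹ • x)) atTop
      (𝓝 (∫ p in ω ×ˢ cell, f p.1 * ψ p.1 p.2)) := by
  have : IsFiniteMeasure (volume.restrict ω) := ⟨by simpa using hωb.measure_lt_top⟩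
  obtain ⟨C, hC, hψC⟩ := hψ.exists_osc_eLpNorm_le hωb
  rw [Metric.tendsto_atTop]
  intro ε hε
  set L := C.toReal + (eLpNorm (fun p : V2 × V2 => ψ p.1 p.2) 2 (volume.restrict (ω ×ˢ cell))).toReal
    with hL
  have hL0 : 0 ≤ L := by positivity
  set δ := ε / 2 / (L + 1) with hδ
  have hδ0 : 0 < δ := by positivity
  obtain ⟨g, hgc, hg, hgf⟩ := hf.exist_eLpNorm_sub_le (by norm_num) (by norm_num) hδ0
  have hgm : MemLp g 2 (volume.restrict ω) := by
    exact hg.continuous.memLp_of_hasCompactSupport hgc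
  have hav := (hψ.fst_mul hg).tendsto_average hpos hlim
  obtain ⟨N, hN⟩ := Metric.tendsto_atTop.1 hav (ε / 2) (by positivity)
  refine ⟨N, fun n hn => ?_⟩
  have hd : (eLpNorm (fun x => f x - g x) 2 (volume.restrict ω)).toReal ≤ δ :=
    ENNReal.toReal_le_of_le_ofReal hδ0.le hgf
  have e1 : |(∫ x in ω, f x * ψ x ((h n)⁻¹ • x)) - ∫ x in ω, g x * ψ x ((h n)⁻¹ • x)| ≤ δ * C.toReal := by
    refine (abs_integral_mul_sub_le hf hgm (hψ.osc_memLp hωb _)).trans ?_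
    gcongr
    exact hψC _
  have e2 : |(∫ p in ω ×ˢ cell, f p.1 * ψ p.1 p.2) - ∫ p in ω ×ˢ cell, g p.1 * ψ p.1 p.2| ≤
      δ * (eLpNorm (fun p : V2 × V2 => ψ p.1 p.2) 2 (volume.restrict (ω ×ˢ cell))).toReal := by
    refine (abs_integral_mul_sub_le (memLp_comp_fst hf) (memLp_comp_fst hgm) (hψ.memLp hωb)).trans ?_
    have := eLpNorm_comp_fst (hf.sub hgm).1
    simp only [Pi.sub_apply] at this
    rw [this]
    gcongr
    exact hd
  have e3 := hN n hn
  rw [Real.dist_eq] at e3 ⊢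
  have e4 : δ * L < ε / 2 := by
    rw [hδ, div_mul_eq_mul_div, div_lt_iff₀ (by positivity)]
    nlinarith
  rw [hL] at e4
  rw [abs_lt] at e3 ⊢
  rw [abs_le] at e1 e2
  constructor <;> linarith

end Averaging

/-! ### Two-scale limits of the moments. -/

/-- The slope term is `h` times a bounded function, and the thickness term is `h² t` times a
derivative of the normal, which is bounded by the uniform Lipschitz constant. -/
theorem exists_tangent_bound {θ : V2 → ℝ} (hθ : ContDiff ℝ 2 θ) (hθp : IsPeriodic θ) :
    ∃ C, 0 < C ∧ ∀ h, 0 < h → h ≤ 1 → ∀ α k, ∀ p : V2 × ℝ, |p.2| ≤ 1 →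
      |tangent θ h α k p - (if α.castSucc = k then 1 else 0)| ≤ C * h := by
  obtain ⟨C, hC, hCn⟩ := exists_normal_bounds hθ hθp
  choose M hM0 hM using fun i => (hθp.pderiv i).exists_bound (contDiff_pderiv hθ i).continuous
  refine ⟨∑ i, M i + C, by have := hM0 0; have := hM0 1; rw [Fin.sum_univ_two]; positivity,
    fun h hh h1 α k p hp => ?_⟩
  have hn : |pderiv α (fun x => normal θ h x k) p.1| ≤ C := by
    have hl : LipschitzWith (Real.toNNReal C) fun x => normal θ h x k := by
      refine LipschitzWith.of_dist_le_mul fun x z => ?_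
      rw [dist_eq_norm, dist_eq_norm, Real.coe_toNNReal _ hC.le]
      exact (norm_le_pi_norm (normal θ h x - normal θ h z) k).trans ((hCn h hh h1).2 x z)
    have h2 := norm_fderiv_le_of_lipschitz ℝ hl (x₀ := p.1)
    rw [Real.coe_toNNReal _ hC.le] at h2
    rw [pderiv, ← Real.norm_eq_abs]
    refine ((fderiv ℝ (fun x => normal θ h x k) p.1).le_opNorm _).trans ?_
    have hs : ‖(Pi.single α 1 : V2)‖ ≤ 1 := (pi_norm_le_iff_of_nonneg zero_le_one).2 fun i => by
      by_cases hi : i = α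
      · subst hi; simp
      · simp [hi]
    calc _ ≤ C * 1 := by gcongr
      _ = C := mul_one C
  have h3 : |if k = 2 then h * pderiv α θ (h⁻¹ • p.1) else 0| ≤ (∑ i, M i) * h := by
    have h4 : |pderiv α θ (h⁻¹ • p.1)| ≤ ∑ i, M i :=
      (hM α _).trans (Finset.single_le_sum (fun i _ => (hM0 i).le) (Finset.mem_univ α))
    have h5 : 0 ≤ ∑ i, M i := (abs_nonneg _).trans h4
    split_ifs
    · rw [abs_mul, abs_of_pos hh, mul_comm]
      gcongr
    · rw [abs_zero]; positivity
  have h4 : |h ^ 2 * p.2 * pderiv α (fun x => normal θ h x k) p.1| ≤ C * h := by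
    rw [abs_mul, abs_mul, abs_of_pos (by positivity : 0 < h ^ 2)]
    calc h ^ 2 * |p.2| * |pderiv α (fun x => normal θ h x k) p.1| ≤ h ^ 2 * 1 * C := by gcongr
      _ ≤ C * h := by nlinarith [mul_pos hC hh]
  rw [tangent, show ∀ a b c : ℝ, a + b + c - a = b + c by intros; ring, add_mul]
  exact (abs_add_le _ _).trans (add_le_add h3 h4)

theorem abs_snd_le_of_mem_plate {ω : Set V2} {p : V2 × ℝ} (hp : p ∈ plate ω 1) : |p.2| ≤ 1 := by
  rw [mem_plate_one] at hp
  rw [abs_le]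
  constructor <;> linarith [hp.2.1, hp.2.2]

theorem continuous_theta0 {θ : V2 → ℝ} (hθ : ContDiff ℝ 2 θ) : Continuous (theta0 θ) :=
  hθ.continuous.sub continuous_const

theorem IsPeriodic.theta0 {θ : V2 → ℝ} (hθp : IsPeriodic θ) : IsPeriodic (theta0 θ) := fun i y => by
  simp only [WrinkledPlate.theta0, hθp i y]

section Limits

variable {ω : Set V2} {θ : V2 → ℝ} {h : ℕ → ℝ} {y : ℕ → V3 → V3} {Dy : ℕ → V3 → M3}
  {R : ℕ → V2 → M3} {DR : ℕ → V2 → Fin 3 → Fin 3 → V2} {u : V2 → V2} {v : V2 → ℝ} {Dv : V2 → V2}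
  {A : V2 → M3} {ψ : V2 → V2 → ℝ}

theorem isFiniteMeasure_plate (hωb : Bornology.IsBounded ω) :
    IsFiniteMeasure (volume.restrict (plate ω 1)) :=
  ⟨by simpa using (volume_plate_ne_top hωb).lt_top⟩

theorem memLp_plate_comp_fst {f : V2 → ℝ} (hf : MemLp f 2 (volume.restrict ω)) :
    MemLp (fun p : V2 × ℝ => f p.1) 2 (volume.restrict (plate ω 1)) := by
  have : IsFiniteMeasure (volume.restrict (Ioo (-(1 / 2) : ℝ) (1 / 2))) := ⟨by simp⟩
  rw [plate_one_eq, Measure.volume_eq_prod, ← Measure.prod_restrict]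
  exact hf.comp_fst _

variable (hωb : Bornology.IsBounded ω) (hpos : ∀ n, 0 < h n)
  (hDR : ∀ n i j, HasWeakGrad ω (fun x => R n x i j) (fun x => DR n x i j))
  (hcomp : CompactSequence ω θ h y Dy R DR u v Dv A)

include hωb hpos hDR hcomp in
theorem exists_increment_bound : ∃ C : ℝ≥0∞, C ≠ ⊤ ∧ ∀ n i k,
    MemLp (fun p => increment θ (h n) (Dy n) (R n) p i k) 2 (volume.restrict (plate ω 1)) ∧
    eLpNorm (fun p => increment θ (h n) (Dy n) (R n) p i k) 2 (volume.restrict (plate ω 1)) ≤ C := by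
  have := isFiniteMeasure_plate hωb
  obtain ⟨C, hC⟩ := hcomp.grad_near
  refine ⟨ENNReal.ofReal C, ENNReal.ofReal_ne_top, fun n i k => ?_⟩
  have hh := hpos n
  have h1 : MemLp (fun p : V2 × ℝ => Dy n (ThetaP θ (h n) p) i k - R n p.1 i k) 2
      (volume.restrict (plate ω 1)) := by
    -- The bound `grad_near` on the norm carries no measurability; that comes from the membership in
    -- `L²` contained in `grad_limit`.
    have h2 := ((((hcomp.grad_limit i k).1 n).const_mul (h n ^ 2)).add
      (memLp_const ((1 : M3) i k))).sub (memLp_plate_comp_fst (hDR n i k).memLp)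
    refine h2.ae_eq (Eventually.of_forall fun p => ?_)
    simp only [Pi.sub_apply, Pi.add_apply]
    field_simp
    ring
  refine ⟨h1.const_mul _, ?_⟩
  have h3 := eLpNorm_const_smul ((h n ^ 4)⁻¹) (fun p : V2 × ℝ => Dy n (ThetaP θ (h n) p) i k - R n p.1 i k)
    2 (volume.restrict (plate ω 1))
  refine (le_of_eq h3).trans ?_
  refine (mul_le_mul_right (hC n i k) _).trans ?_
  rw [Real.enorm_of_nonneg (by positivity), ← ENNReal.ofReal_mul (by positivity)]
  refine ENNReal.ofReal_le_ofReal (le_of_eq ?_)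
  field_simp

variable (hω : IsOpen ω) (hθ : ContDiff ℝ 2 θ) (hθp : IsPeriodic θ) (hlim : Tendsto h atTop (𝓝 0))

include hωb hpos hDR hcomp hω hθ hθp hlim in
/-- The tangent vectors may be replaced by the coordinate vectors in the limit. -/
theorem tendsto_sum_increment_tangent_sub (i : Fin 3) (α : Fin 2) {b : ℕ → V2 × ℝ → ℝ} {M : ℝ}
    (hb : ∀ n, Continuous (b n)) (hbM : ∀ n p, p ∈ plate ω 1 → |b n p| ≤ M) :
    Tendsto (fun n => (∑ k, ∫ p in plate ω 1, increment θ (h n) (Dy n) (R n) p i k *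
      (tangent θ (h n) α k p * b n p)) -
      ∫ p in plate ω 1, increment θ (h n) (Dy n) (R n) p i α.castSucc * b n p) atTop (𝓝 0) := by
  have := isFiniteMeasure_plate hωb
  obtain ⟨C, hC, hinc⟩ := exists_increment_bound hωb hpos hDR hcomp
  obtain ⟨T, hT, hTb⟩ := exists_tangent_bound hθ hθp
  set g : Fin 3 → ℕ → V2 × ℝ → ℝ := fun k n p =>
    (tangent θ (h n) α k p - (if α.castSucc = k then 1 else 0)) * b n p with hg
  have hgc : ∀ k n, Continuous (g k n) := fun k n =>
    ((continuous_tangent hθ (h n) α k).sub continuous_const).mul (hb n)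
  have hgb : ∀ k, ∀ᶠ n in atTop, ∀ᵐ p ∂(volume.restrict (plate ω 1)), |g k n p| ≤ T * h n * M := by
    intro k
    filter_upwards [hlim.eventually (gt_mem_nhds one_pos)] with n hn
    filter_upwards [ae_restrict_mem (measurableSet_plate hω)] with p hp
    rw [hg, abs_mul]
    have h1 := hTb (h n) (hpos n) hn.le α k p (abs_snd_le_of_mem_plate hp)
    exact mul_le_mul h1 (hbM n p hp) (abs_nonneg _) ((abs_nonneg _).trans h1)
  have hgt : ∀ k, _ := fun k => memLp_and_tendsto_of_bound (g := g k) (δ := fun n => T * h n * M)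
    (fun n => (hgc k n).aestronglyMeasurable) (hgb k) (by simpa using (hlim.const_mul T).mul_const M)
  have hk : ∀ k, Tendsto (fun n => ∫ p in plate ω 1, increment θ (h n) (Dy n) (R n) p i k * g k n p)
      atTop (𝓝 0) := fun k =>
    tendsto_integral_mul_zero hC (Eventually.of_forall fun n => hinc n i k) (hgt k).1 (hgt k).2
  have hsum := tendsto_finsetSum Finset.univ fun k _ => hk k
  rw [Finset.sum_const_zero] at hsum
  refine hsum.congr' ?_
  filter_upwards [eventually_all.2 fun k => (hgt k).1] with n hn
  have hbm : MemLp (b n) 2 (volume.restrict (plate ω 1)) :=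
    MemLp.of_bound (hb n).aestronglyMeasurable M (by
      filter_upwards [ae_restrict_mem (measurableSet_plate hω)] with p hp using hbM n p hp)
  have h1 : ∫ p in plate ω 1, increment θ (h n) (Dy n) (R n) p i α.castSucc * b n p =
      ∑ k, ∫ p in plate ω 1, increment θ (h n) (Dy n) (R n) p i k *
        ((if α.castSucc = k then 1 else 0) * b n p) := by
    rw [Finset.sum_eq_single α.castSucc (fun k _ hk => by simp [Ne.symm hk]) (by simp)]
    simp
  rw [h1, ← Finset.sum_sub_distrib]
  refine Finset.sum_congr rfl fun k _ => ?_
  have h2 : Integrable (fun p => increment θ (h n) (Dy n) (R n) p i k * g k n p) _ :=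
    integrable_mul_of_memLp (hinc n i k).1 (hn k)
  have h3 := integrable_mul_of_memLp (hinc n i k).1 (hbm.const_mul (if α.castSucc = k then 1 else 0))
  rw [eq_sub_iff_add_eq, ← integral_add h2 h3]
  congr 1
  funext p
  simp only [hg]
  ring

end Limits

section Limits

variable {ω : Set V2} {θ : V2 → ℝ} {h : ℕ → ℝ} {y : ℕ → V3 → V3} {Dy : ℕ → V3 → M3}
  {R : ℕ → V2 → M3} {DR : ℕ → V2 → Fin 3 → Fin 3 → V2} {u : V2 → V2} {v : V2 → ℝ} {Dv : V2 → V2}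
  {A : V2 → M3} {ψ : V2 → V2 → ℝ} {Duh : ℕ → V2 → M2} {Du : V2 → M2} {D2v : V2 → M2}
  {Du₁ D2v₁ : V2 × V2 → M2}

variable (hω : IsOpen ω) (hωb : Bornology.IsBounded ω) (hθ : ContDiff ℝ 2 θ) (hθp : IsPeriodic θ)
  (hpos : ∀ n, 0 < h n) (hlim : Tendsto h atTop (𝓝 0))
  (hy : ∀ᶠ n in atTop, ∀ i, HasWeakGrad (shell ω θ (h n)) (fun x => y n x i) (fun x => Dy n x i))
  (hDR : ∀ n i j, HasWeakGrad ω (fun x => R n x i j) (fun x => DR n x i j))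
  (hcomp : CompactSequence ω θ h y Dy R DR u v Dv A)

include hω hωb hθ hθp hpos hlim hy hDR hcomp in
-- The limit concerns a sum because only the symmetric part of `h⁻⁴(R - I)` is controlled; its skew
-- part enters at order `h⁻²`, so the two summands need not converge separately.
theorem tendsto_increment_in_plane (hψ : TestFn ω ψ) (β α : Fin 2)
    (hDuh : ∀ n, HasWeakGrad ω (fun x => inPlane θ (h n) (y n) (R n) x β) (fun x => Duh n x β))
    (hts_u : TwoScale ω h (fun n x => Duh n x β α) (fun p => Du p.1 β α + Du₁ p β α))
    (hts_R : TwoScale ω h (fun n x => (h n ^ 2)⁻¹ * DR n x β.castSucc 2 α)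
      (fun p => -(D2v p.1 β α) - D2v₁ p β α)) :
    Tendsto (fun n => (∫ p in plate ω 1, increment θ (h n) (Dy n) (R n) p β.castSucc α.castSucc *
        ψ p.1 ((h n)⁻¹ • p.1)) +
      ∫ x in ω, (h n ^ 4)⁻¹ * (R n x - 1) β.castSucc α.castSucc * ψ x ((h n)⁻¹ • x)) atTop
      (𝓝 ((∫ p in ω ×ˢ cell, (Du p.1 β α + Du₁ p β α) * ψ p.1 p.2) +
        ∫ p in ω ×ˢ cell, (-(D2v p.1 β α) - D2v₁ p β α) * (theta0 θ p.2 * ψ p.1 p.2))) := by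
  obtain ⟨M, hM0, hM⟩ := hψ.exists_bound
  have h1 := hts_u.tendsto_osc hψ.toOscFn
  have h2 := hts_R.tendsto_osc (hψ.toOscFn.periodic_mul (continuous_theta0 hθ) hθp.theta0)
  have h3 := tendsto_sum_increment_tangent_sub hωb hpos hDR hcomp hω hθ hθp hlim β.castSucc α
    (b := fun n p => ψ p.1 ((h n)⁻¹ • p.1)) (M := M)
    (fun n => (hψ.continuous_osc (h n)).comp continuous_fst) fun n p _ => hM _ _
  have h4 := (h1.add h2).sub h3
  rw [sub_zero] at h4
  refine h4.congr' ?_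
  filter_upwards [eventually_goodScale hθ hθp hω hpos hlim, hy] with n hg hyn
  have h5 := integral_inPlane_gradient hg hθ hω hωb hyn (hDR n) β α (hDuh n) (hψ.contDiff_osc (h n))
    (hψ.toOscFn.hasCompactSupport (h n)).1 (hψ.toOscFn.hasCompactSupport (h n)).2
  rw [h5]
  ring

include hω hωb hθ hθp hpos hlim hy hDR hcomp in
-- In the first-moment identity the normal tends uniformly to `e₃`, which selects the column
-- `R_{β3}`. The remaining term has the factor `h²` against a test derivative of size `h⁻¹`, hence
-- vanishes.
theorem tendsto_increment_moment (hψ : TestFn ω ψ) (β α : Fin 2)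
    (hts_R : TwoScale ω h (fun n x => (h n ^ 2)⁻¹ * DR n x β.castSucc 2 α)
      (fun p => -(D2v p.1 β α) - D2v₁ p β α)) :
    Tendsto (fun n => ∫ p in plate ω 1, increment θ (h n) (Dy n) (R n) p β.castSucc α.castSucc *
        (ψ p.1 ((h n)⁻¹ • p.1) * p.2)) atTop
      (𝓝 (1 / 12 * ∫ p in ω ×ˢ cell, (-(D2v p.1 β α) - D2v₁ p β α) * ψ p.1 p.2)) := by
  have := isFiniteMeasure_plate hωb
  have : IsFiniteMeasure (volume.restrict ω) := ⟨by simpa using hωb.measure_lt_top⟩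
  obtain ⟨M, hM0, hM⟩ := hψ.exists_bound
  obtain ⟨P, hP0, hP⟩ := hψ.exists_pderiv_bound
  obtain ⟨N, hN0, hN⟩ := exists_normal_bounds hθ hθp
  obtain ⟨C, hC, hinc⟩ := exists_increment_bound hωb hpos hDR hcomp
  obtain ⟨D, hD⟩ := hcomp.rotation_grad
  have hn1 := hlim.eventually (gt_mem_nhds one_pos)
  have h2 := hts_R.tendsto_osc hψ.toOscFn
  have h3 := tendsto_sum_increment_tangent_sub hωb hpos hDR hcomp hω hθ hθp hlim β.castSucc α
    (b := fun n p => ψ p.1 ((h n)⁻¹ • p.1) * p.2) (M := M)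
    (fun n => ((hψ.continuous_osc (h n)).comp continuous_fst).mul continuous_snd) fun n p hp => by
      rw [abs_mul]
      calc _ ≤ M * 1 := mul_le_mul (hM _ _) (abs_snd_le_of_mem_plate hp) (abs_nonneg _) hM0.le
        _ = M := mul_one M
  -- the normal is close to the third basis vector
  have hDb : ∀ n k, MemLp (fun x => (h n ^ 2)⁻¹ * DR n x β.castSucc k α) 2 (volume.restrict ω) ∧
      eLpNorm (fun x => (h n ^ 2)⁻¹ * DR n x β.castSucc k α) 2 (volume.restrict ω) ≤ ENNReal.ofReal D := by
    intro n k
    have hh := hpos n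
    refine ⟨((hDR n _ k).memLp_grad α).const_mul _, ?_⟩
    have h3 := eLpNorm_const_smul ((h n ^ 2)⁻¹) (fun x => DR n x β.castSucc k α) 2 (volume.restrict ω)
    refine (le_of_eq h3).trans ((mul_le_mul_right (hD n _ k α) _).trans ?_)
    rw [Real.enorm_of_nonneg (by positivity), ← ENNReal.ofReal_mul (by positivity)]
    refine ENNReal.ofReal_le_ofReal (le_of_eq ?_)
    field_simp
  have hnc : ∀ n k, Continuous fun x => normal θ (h n) x k := fun n k =>
    (contDiff_normal_apply hθ (h n) k).continuous
  have hne : ∀ k n, h n < 1 → ∀ x, |normal θ (h n) x k - e3 k| ≤ N * h n := fun k n hn x =>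
    (norm_le_pi_norm (normal θ (h n) x - e3) k).trans ((hN (h n) (hpos n) hn.le).1 x)
  have h4 : ∀ k, Tendsto (fun n => ∫ x in ω, (h n ^ 2)⁻¹ * DR n x β.castSucc k α *
      ((normal θ (h n) x k - e3 k) * ψ x ((h n)⁻¹ • x))) atTop (𝓝 0) := by
    intro k
    obtain ⟨c1, c2⟩ := memLp_and_tendsto_of_bound (μ := volume.restrict ω)
      (g := fun n x => (normal θ (h n) x k - e3 k) * ψ x ((h n)⁻¹ • x)) (δ := fun n => N * h n * M)
      (fun n => (((hnc n k).sub continuous_const).mul (hψ.continuous_osc (h n))).aestronglyMeasurable)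
      (by
        filter_upwards [hn1] with n hn
        refine Eventually.of_forall fun x => ?_
        rw [abs_mul]
        exact mul_le_mul (hne k n hn x) (hM _ _) (abs_nonneg _) (by have := hpos n; positivity))
      (by simpa using (hlim.const_mul N).mul_const M)
    exact tendsto_integral_mul_zero ENNReal.ofReal_ne_top (Eventually.of_forall fun n => hDb n k) c1 c2
  -- the term with the normal derivative
  have h5 : ∀ k, Tendsto (fun n => ∫ p in plate ω 1, increment θ (h n) (Dy n) (R n) p β.castSucc k *
      (h n ^ 2 * (normal θ (h n) p.1 k * (pderiv α (fun x => ψ x ((h n)⁻¹ • x)) p.1 * bubble p.2))))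
      atTop (𝓝 0) := by
    intro k
    obtain ⟨c1, c2⟩ := memLp_and_tendsto_of_bound (μ := volume.restrict (plate ω 1))
      (g := fun n p => h n ^ 2 * (normal θ (h n) p.1 k *
        (pderiv α (fun x => ψ x ((h n)⁻¹ • x)) p.1 * bubble p.2)))
      (δ := fun n => h n * ((N + 1) * (P * 1)))
      (fun n => ((continuous_const.mul (((hnc n k).comp continuous_fst).mul
        (((continuous_pderiv ((hψ.contDiff_osc (h n)).of_le (by exact_mod_cast le_top)) α).comp
          continuous_fst).mul
          (contDiff_bubble.continuous.comp continuous_snd)))).aestronglyMeasurable))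
      (by
        filter_upwards [hn1] with n hn
        filter_upwards [ae_restrict_mem (measurableSet_plate hω)] with p hp
        have hh := hpos n
        have b1 : |normal θ (h n) p.1 k| ≤ N + 1 := by
          have e1 := hne k n hn p.1
          have e2 : |e3 k| ≤ 1 := by fin_cases k <;> simp [e3]
          have e3' := abs_add_le (normal θ (h n) p.1 k - e3 k) (e3 k)
          rw [sub_add_cancel] at e3'
          nlinarith
        have b2 := hP (h n) hh hn.le α p.1
        have b3 : |bubble p.2| ≤ 1 := by
          have := abs_snd_le_of_mem_plate hp
          have := sq_abs p.2 ▸ pow_le_one₀ (n := 2) (abs_nonneg p.2) this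
          rw [bubble, abs_le]
          constructor <;> nlinarith [sq_nonneg p.2]
        rw [abs_mul, abs_mul, abs_mul, abs_of_pos (by positivity : 0 < h n ^ 2)]
        calc h n ^ 2 * (|normal θ (h n) p.1 k| *
              (|pderiv α (fun x => ψ x ((h n)⁻¹ • x)) p.1| * |bubble p.2|))
            ≤ h n ^ 2 * ((N + 1) * (P * (h n)⁻¹ * 1)) := by gcongr
          _ = h n * ((N + 1) * (P * 1)) := by field_simp)
      (by simpa using hlim.mul_const ((N + 1) * (P * 1)))
    exact tendsto_integral_mul_zero hC (Eventually.of_forall fun n => hinc n _ k) c1 c2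
  have h4s := tendsto_finsetSum Finset.univ fun k _ => h4 k
  have h5s := tendsto_finsetSum Finset.univ fun k _ => h5 k
  rw [Finset.sum_const_zero] at h4s h5s
  have h6 := (((h2.add h4s).const_mul (1 / 12)).sub h5s).sub h3
  rw [sub_zero, sub_zero, add_zero] at h6
  refine h6.congr' ?_
  filter_upwards [eventually_goodScale hθ hθp hω hpos hlim, hy] with n hg hyn
  have e1 := sum_integral_first_moment hg hθ hω hωb hyn (hDR n) β.castSucc α
    ((hψ.contDiff_osc (h n)).of_le (WithTop.coe_le_coe.2 (le_top : (2 : ℕ∞) ≤ ⊤)))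
    (hψ.toOscFn.hasCompactSupport (h n)).1 (hψ.toOscFn.hasCompactSupport (h n)).2
  have e2 : h n ^ 2 * ∑ k, ∫ p in plate ω 1, increment θ (h n) (Dy n) (R n) p β.castSucc k *
        (normal θ (h n) p.1 k * (pderiv α (fun x => ψ x ((h n)⁻¹ • x)) p.1 * bubble p.2)) =
      ∑ k, ∫ p in plate ω 1, increment θ (h n) (Dy n) (R n) p β.castSucc k *
      (h n ^ 2 * (normal θ (h n) p.1 k * (pderiv α (fun x => ψ x ((h n)⁻¹ • x)) p.1 * bubble p.2))) := by
    rw [Finset.mul_sum]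
    refine Finset.sum_congr rfl fun k _ => ?_
    rw [← integral_const_mul]
    congr 1
    funext p
    ring
  have e3' : ∑ k, ∫ x in ω, (h n ^ 2)⁻¹ * DR n x β.castSucc k α *
        (normal θ (h n) x k * ψ x ((h n)⁻¹ • x)) =
      (∫ x in ω, (h n ^ 2)⁻¹ * DR n x β.castSucc 2 α * ψ x ((h n)⁻¹ • x)) +
      ∑ k, ∫ x in ω, (h n ^ 2)⁻¹ * DR n x β.castSucc k α *
      ((normal θ (h n) x k - e3 k) * ψ x ((h n)⁻¹ • x)) := by
    have f1 : ∫ x in ω, (h n ^ 2)⁻¹ * DR n x β.castSucc 2 α * ψ x ((h n)⁻¹ • x) =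
        ∑ k, ∫ x in ω, (h n ^ 2)⁻¹ * DR n x β.castSucc k α * (e3 k * ψ x ((h n)⁻¹ • x)) := by
      rw [Finset.sum_eq_single 2 (fun k _ hk => by simp [e3, hk]) (by simp)]
      simp [e3]
    rw [f1, ← Finset.sum_add_distrib]
    refine Finset.sum_congr rfl fun k _ => ?_
    have hm : ∀ b : V2 → ℝ, Continuous b →
        Integrable (fun x => (h n ^ 2)⁻¹ * DR n x β.castSucc k α * b x) (volume.restrict ω) :=
      fun b hb => IntegrableOn.mul_continuous_base hω hωb ((hDb n k).1.integrable (by norm_num)) hb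
    rw [← integral_add (hm (fun x => e3 k * ψ x ((h n)⁻¹ • x))
        (continuous_const.mul (hψ.continuous_osc (h n))))
      (hm (fun x => (normal θ (h n) x k - e3 k) * ψ x ((h n)⁻¹ • x))
        (((hnc n k).sub continuous_const).mul (hψ.continuous_osc (h n))))]
    congr 1
    funext x
    ring
  rw [e2, e3'] at e1
  rw [e1]
  ring

include hωb hpos hlim hcomp in
theorem tendsto_symPart_rotation (hψ : TestFn ω ψ) (β α : Fin 2) :
    Tendsto (fun n => ∫ x in ω, (h n ^ 4)⁻¹ * symPart (R n x - 1) β.castSucc α.castSucc *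
        ψ x ((h n)⁻¹ • x)) atTop
      (𝓝 (∫ p in ω ×ˢ cell, 1 / 2 * (A p.1 * A p.1) β.castSucc α.castSucc * ψ p.1 p.2)) := by
  obtain ⟨h1, h2, h3⟩ := hcomp.sym_limit β.castSucc α.castSucc
  obtain ⟨C, hC, hψC⟩ := hψ.exists_osc_eLpNorm_le hωb
  have h4 := hψ.tendsto_average_mul hωb hpos hlim h2
  have h5 := tendsto_integral_mul_zero hC
    (Eventually.of_forall fun n => ⟨hψ.osc_memLp hωb (h n), hψC (h n)⟩)
    (Eventually.of_forall fun n => (h1 n).sub h2) h3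
  have h6 := h4.add h5
  rw [add_zero] at h6
  refine h6.congr fun n => ?_
  rw [← integral_add (integrable_mul_of_memLp h2 (hψ.osc_memLp hωb (h n)))
    (integrable_mul_of_memLp (hψ.osc_memLp hωb (h n)) ((h1 n).sub h2))]
  congr 1
  funext x
  simp only [Pi.sub_apply]
  ring

end Limits

/-! ### Limits of linear forms of the strain. -/

section Pairing

variable {X : Type*} [MeasurableSpace X] {μ : Measure X}

theorem integral_pairing_mul {G : X → M2} {φ : X → ℝ} (l : M2) (hG : ∀ i j, MemLp (fun p => G p i j) 2 μ)
    (hφ : MemLp φ 2 μ) :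
    ∫ p, pairing l (G p) * φ p ∂μ = ∑ i, ∑ j, l i j * ∫ p, G p i j * φ p ∂μ := by
  have hi : ∀ i j, Integrable (fun p => l i j * (G p i j * φ p)) μ := fun i j =>
    (integrable_mul_of_memLp (hG i j) hφ).const_mul _
  simp only [← integral_const_mul]
  rw [Finset.sum_congr rfl fun i _ => (integral_finsetSum _ fun j _ => hi i j).symm,
    ← integral_finsetSum _ fun i _ => integrable_finsetSum _ fun j _ => hi i j]
  congr 1
  funext p
  simp only [pairing, Finset.sum_mul]
  refine Finset.sum_congr rfl fun i _ => Finset.sum_congr rfl fun j _ => by ring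

theorem memLp_pairing {G : X → M2} (l : M2) (hG : ∀ i j, MemLp (fun p => G p i j) 2 μ) :
    MemLp (fun p => pairing l (G p)) 2 μ :=
  memLp_finsetSum _ fun i _ => memLp_finsetSum _ fun j _ => (hG i j).const_mul _

end Pairing

section Strain

variable {ω : Set V2} {θ : V2 → ℝ} {h : ℕ → ℝ} {y : ℕ → V3 → V3} {Dy : ℕ → V3 → M3}
  {R : ℕ → V2 → M3} {DR : ℕ → V2 → Fin 3 → Fin 3 → V2} {u : V2 → V2} {v : V2 → ℝ} {Dv : V2 → V2}
  {A : V2 → M3} {ψ : V2 → V2 → ℝ} {Duh : ℕ → V2 → M2} {Du : V2 → M2} {D2v : V2 → M2}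
  {Du₁ D2v₁ : V2 × V2 → M2}

/-- The in-plane strain before symmetrization. -/
noncomputable def rawStrain (θ : V2 → ℝ) (Du : V2 → M2) (Du₁ : V2 × V2 → M2) (A : V2 → M3)
    (D2v : V2 → M2) (D2v₁ : V2 × V2 → M2) (p : V2 × V2) : M2 :=
  Du p.1 + Du₁ p - theta0 θ p.2 • D2v p.1 - theta0 θ p.2 • D2v₁ p -
    (1 / 2 : ℝ) • upper (A p.1 * A p.1)

theorem ae_fst {P : V2 → Prop} (hP : ∀ᵐ x ∂(volume.restrict ω), P x) :
    ∀ᵐ p ∂(volume.restrict (ω ×ˢ cell)), P p.1 := by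
  rw [Measure.volume_eq_prod, ← Measure.prod_restrict]
  exact Measure.quasiMeasurePreserving_fst.ae hP

/-- For `A = e₃ ⊗ ∇v - ∇v ⊗ e₃` the in-plane block of `A²` is `-∇v ⊗ ∇v`, so `-½ A²` becomes the
membrane term. A form with symmetric coefficients does not notice the missing symmetrization. -/
theorem pairing_rawStrain {l : M2} (hl : ∀ i j, l i j = l j i)
    (hA : ∀ᵐ x ∂(volume.restrict ω),
      A x = Matrix.vecMulVec e3 ![Dv x 0, Dv x 1, 0] - Matrix.vecMulVec ![Dv x 0, Dv x 1, 0] e3) :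
    ∀ᵐ p ∂(volume.restrict (ω ×ˢ cell)), pairing l (rawStrain θ Du Du₁ A D2v D2v₁ p) =
      pairing l (strain θ Du Du₁ Dv D2v D2v₁ p) := by
  filter_upwards [ae_fst hA] with p hp
  have h1 := hl 1 0
  simp only [rawStrain, strain, hp, pairing, symPart, upper, Fin.sum_univ_two, Matrix.smul_apply,
    Matrix.add_apply, Matrix.sub_apply, Matrix.transpose_apply, smul_eq_mul, h1, Matrix.of_apply,
    Matrix.mul_apply, Fin.sum_univ_three, Matrix.vecMulVec_apply]
  simp [e3]
  ring

theorem memLp_theta0_mul (hθ : ContDiff ℝ 2 θ) (hθp : IsPeriodic θ) {f : V2 × V2 → ℝ}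
    (hf : MemLp f 2 (volume.restrict (ω ×ˢ cell))) :
    MemLp (fun p => theta0 θ p.2 * f p) 2 (volume.restrict (ω ×ˢ cell)) := by
  obtain ⟨M, -, hM⟩ := hθp.theta0.exists_bound (continuous_theta0 hθ)
  refine MemLp.of_le_mul (c := M) hf
    (((continuous_theta0 hθ).comp continuous_snd).aestronglyMeasurable.mul hf.1)
    (Eventually.of_forall fun p => ?_)
  rw [norm_mul]
  gcongr
  exact hM _

variable (hθ : ContDiff ℝ 2 θ) (hθp : IsPeriodic θ)
  (hDu : ∀ β α, MemLp (fun p : V2 × V2 => Du p.1 β α + Du₁ p β α) 2 (volume.restrict (ω ×ˢ cell)))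
  (hD2v : ∀ β α, MemLp (fun p : V2 × V2 => -(D2v p.1 β α) - D2v₁ p β α) 2
    (volume.restrict (ω ×ˢ cell)))
  (hAA : ∀ i j, MemLp (fun x => 1 / 2 * (A x * A x) i j) 2 (volume.restrict ω))

theorem rawStrain_apply (p : V2 × V2) (β α : Fin 2) : rawStrain θ Du Du₁ A D2v D2v₁ p β α =
    (Du p.1 β α + Du₁ p β α) + theta0 θ p.2 * (-(D2v p.1 β α) - D2v₁ p β α) -
      1 / 2 * (A p.1 * A p.1) β.castSucc α.castSucc := by
  simp only [rawStrain, Matrix.smul_apply, upper, Matrix.of_apply,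
    Matrix.add_apply, Matrix.sub_apply, smul_eq_mul]
  ring

include hθ hθp hDu hD2v hAA in
theorem memLp_rawStrain (β α : Fin 2) :
    MemLp (fun p => rawStrain θ Du Du₁ A D2v D2v₁ p β α) 2 (volume.restrict (ω ×ˢ cell)) := by
  simp only [rawStrain_apply]
  exact ((hDu β α).add (memLp_theta0_mul hθ hθp (hD2v β α))).sub (memLp_comp_fst (hAA _ _))

variable (hω : IsOpen ω) (hωb : Bornology.IsBounded ω)
  (hpos : ∀ n, 0 < h n) (hlim : Tendsto h atTop (𝓝 0))
  (hy : ∀ᶠ n in atTop, ∀ i, HasWeakGrad (shell ω θ (h n)) (fun x => y n x i) (fun x => Dy n x i))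
  (hDR : ∀ n i j, HasWeakGrad ω (fun x => R n x i j) (fun x => DR n x i j))
  (hcomp : CompactSequence ω θ h y Dy R DR u v Dv A)
  (hDuh : ∀ n β, HasWeakGrad ω (fun x => inPlane θ (h n) (y n) (R n) x β) (fun x => Duh n x β))
  (hts_u : ∀ β α, TwoScale ω h (fun n x => Duh n x β α) (fun p => Du p.1 β α + Du₁ p β α))
  (hts_R : ∀ β α : Fin 2, TwoScale ω h (fun n x => (h n ^ 2)⁻¹ * DR n x β.castSucc 2 α)
      (fun p => -(D2v p.1 β α) - D2v₁ p β α))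

theorem memLp_plate_osc (hωb : Bornology.IsBounded ω) (hψ : TestFn ω ψ) (r : ℝ) :
    MemLp (fun p : V2 × ℝ => ψ p.1 (r⁻¹ • p.1)) 2 (volume.restrict (plate ω 1)) := by
  have := isFiniteMeasure_plate hωb
  obtain ⟨M, -, hM⟩ := hψ.exists_bound
  exact MemLp.of_bound ((hψ.continuous_osc r).comp continuous_fst).aestronglyMeasurable M
    (Eventually.of_forall fun p => hM _ _)

theorem memLp_plate_osc_snd (hω : IsOpen ω) (hωb : Bornology.IsBounded ω) (hψ : TestFn ω ψ) (r : ℝ) :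
    MemLp (fun p : V2 × ℝ => ψ p.1 (r⁻¹ • p.1) * p.2) 2 (volume.restrict (plate ω 1)) := by
  refine MemLp.of_le_mul (c := 1) (memLp_plate_osc hωb hψ r)
    (((hψ.continuous_osc r).comp continuous_fst).mul continuous_snd).aestronglyMeasurable ?_
  filter_upwards [ae_restrict_mem (measurableSet_plate hω)] with p hp
  rw [norm_mul, one_mul]
  exact mul_le_of_le_one_right (norm_nonneg _) (abs_snd_le_of_mem_plate hp)

include hθ hθp hω hωb hpos hlim hy hDR hcomp hDuh hts_u hts_R in
-- Symmetry of `l` is essential: after pairing, `h⁻⁴(R - I)` may be replaced by its symmetric part,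
-- whose strong limit `½ A²` is then subtracted from the limit of the sum.
theorem tendsto_pairing_increment (hψ : TestFn ω ψ) {l : M2} (hl : ∀ i j, l i j = l j i) :
    Tendsto (fun n => ∫ p in plate ω 1, pairing l (upper (increment θ (h n) (Dy n) (R n) p)) *
        ψ p.1 ((h n)⁻¹ • p.1)) atTop
      (𝓝 (∫ p in ω ×ˢ cell, pairing l (strain θ Du Du₁ Dv D2v D2v₁ p) * ψ p.1 p.2)) := by
  obtain ⟨C, hC, hinc⟩ := exists_increment_bound hωb hpos hDR hcomp
  have hraw := memLp_rawStrain hθ hθp (fun β α => (hts_u β α).2.1) (fun β α => (hts_R β α).2.1)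
    (fun i j => (hcomp.sym_limit i j).2.1)
  have h1 : ∫ p in ω ×ˢ cell, pairing l (strain θ Du Du₁ Dv D2v D2v₁ p) * ψ p.1 p.2 =
      ∑ β, ∑ α, l β α * (((∫ p in ω ×ˢ cell, (Du p.1 β α + Du₁ p β α) * ψ p.1 p.2) +
        ∫ p in ω ×ˢ cell, (-(D2v p.1 β α) - D2v₁ p β α) * (theta0 θ p.2 * ψ p.1 p.2)) -
        ∫ p in ω ×ˢ cell, 1 / 2 * (A p.1 * A p.1) β.castSucc α.castSucc * ψ p.1 p.2) := by
    rw [integral_congr_ae (g := fun p => pairing l (rawStrain θ Du Du₁ A D2v D2v₁ p) * ψ p.1 p.2) (by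
      filter_upwards [pairing_rawStrain hl hcomp.A_eq] with p hp
      rw [hp]), integral_pairing_mul l hraw (hψ.memLp hωb)]
    refine Finset.sum_congr rfl fun β _ => Finset.sum_congr rfl fun α _ => ?_
    have i1 := integrable_mul_of_memLp (hts_u β α).2.1 (hψ.memLp hωb)
    have i2 : IntegrableOn (fun p : V2 × V2 => (-(D2v p.1 β α) - D2v₁ p β α) *
        (theta0 θ p.2 * ψ p.1 p.2)) (ω ×ˢ cell) :=
      integrable_mul_of_memLp (hts_R β α).2.1 (memLp_theta0_mul hθ hθp (hψ.memLp hωb))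
    have i3 := integrable_mul_of_memLp
      (memLp_comp_fst (hcomp.sym_limit β.castSucc α.castSucc).2.1) (hψ.memLp hωb)
    rw [← integral_add i1 i2]
    refine congrArg (l β α * ·) (Eq.trans ?_ (integral_sub (i1.add i2) i3))
    congr 1
    funext p
    rw [rawStrain_apply]
    ring
  have h2 : ∀ β α, Tendsto _ atTop _ := fun β α =>
    tendsto_increment_in_plane hω hωb hθ hθp hpos hlim hy hDR hcomp hψ β α (fun n => hDuh n β)
      (hts_u β α) (hts_R β α)
  have h3 : ∀ β α, Tendsto _ atTop _ := fun β α => tendsto_symPart_rotation hωb hpos hlim hcomp hψ β α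
  have h4 := tendsto_finsetSum Finset.univ fun β (_ : β ∈ Finset.univ) =>
    tendsto_finsetSum Finset.univ fun α (_ : α ∈ Finset.univ) =>
      ((h2 β α).sub (h3 β α)).const_mul (l β α)
  rw [h1]
  refine h4.congr fun n => ?_
  rw [integral_pairing_mul (G := fun p => upper (increment θ (h n) (Dy n) (R n) p)) l
    (fun i j => (hinc n i.castSucc j.castSucc).1) (memLp_plate_osc hωb hψ (h n))]
  -- The symmetric part is expanded into the entries `βα` and `αβ`, so that the off-diagonal entries
  -- recombine under the symmetric coefficients.
  have e : ∀ β α : Fin 2, ∫ x in ω, (h n ^ 4)⁻¹ * symPart (R n x - 1) β.castSucc α.castSucc *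
      ψ x ((h n)⁻¹ • x) = 1 / 2 *
      ((∫ x in ω, (h n ^ 4)⁻¹ * (R n x - 1) β.castSucc α.castSucc * ψ x ((h n)⁻¹ • x)) +
        ∫ x in ω, (h n ^ 4)⁻¹ * (R n x - 1) α.castSucc β.castSucc * ψ x ((h n)⁻¹ • x)) := by
    intro β α
    have hi : ∀ i j, Integrable (fun x => (h n ^ 4)⁻¹ * (R n x - 1) i j * ψ x ((h n)⁻¹ • x))
        (volume.restrict ω) := by
      intro i j
      have : IsFiniteMeasure (volume.restrict ω) := ⟨by simpa using hωb.measure_lt_top⟩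
      exact integrable_mul_of_memLp
        (((hDR n i j).memLp.sub (memLp_const ((1 : M3) i j))).const_mul _) (hψ.osc_memLp hωb (h n))
    rw [← integral_add (hi _ _) (hi _ _), ← integral_const_mul]
    congr 1
    funext x
    simp only [symPart, Matrix.smul_apply, Matrix.add_apply, Matrix.transpose_apply, smul_eq_mul]
    ring
  have hl' := hl 1 0
  simp only [e, Fin.sum_univ_two, hl', upper, Matrix.of_apply]
  ring

include hθ hθp hω hωb hpos hlim hy hDR hcomp hts_R in
theorem tendsto_pairing_moment (hψ : TestFn ω ψ) (l : M2) :
    Tendsto (fun n => ∫ p in plate ω 1, pairing l (upper (increment θ (h n) (Dy n) (R n) p)) *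
        (ψ p.1 ((h n)⁻¹ • p.1) * p.2)) atTop
      (𝓝 (- (1 / 12 * ∫ p in ω ×ˢ cell, pairing l (D2v p.1 + D2v₁ p) * ψ p.1 p.2))) := by
  obtain ⟨C, hC, hinc⟩ := exists_increment_bound hωb hpos hDR hcomp
  have hm : ∀ β α, MemLp (fun p : V2 × V2 => (D2v p.1 + D2v₁ p) β α) 2
      (volume.restrict (ω ×ˢ cell)) := fun β α => by
    refine (hts_R β α).2.1.neg.ae_eq (Eventually.of_forall fun p => ?_)
    simp only [Pi.neg_apply, Matrix.add_apply]
    ring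
  rw [integral_pairing_mul l hm (hψ.memLp hωb)]
  have h4 := tendsto_finsetSum Finset.univ fun β (_ : β ∈ Finset.univ) =>
    tendsto_finsetSum Finset.univ fun α (_ : α ∈ Finset.univ) =>
      (tendsto_increment_moment hω hωb hθ hθp hpos hlim hy hDR hcomp hψ β α (hts_R β α)).const_mul (l β α)
  have e : ∀ β α, ∫ p in ω ×ˢ cell, (-(D2v p.1 β α) - D2v₁ p β α) * ψ p.1 p.2 =
      - ∫ p in ω ×ˢ cell, (D2v p.1 + D2v₁ p) β α * ψ p.1 p.2 := by
    intro β α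
    rw [← integral_neg]
    congr 1
    funext p
    rw [Matrix.add_apply]
    ring
  have h5 : -(1 / 12 * ∑ i, ∑ j, l i j * ∫ p in ω ×ˢ cell, (D2v p.1 + D2v₁ p) i j * ψ p.1 p.2) =
      ∑ β, ∑ α, l β α * (1 / 12 * ∫ p in ω ×ˢ cell, (-(D2v p.1 β α) - D2v₁ p β α) * ψ p.1 p.2) := by
    simp only [e, Fin.sum_univ_two]
    ring
  rw [h5]
  refine h4.congr fun n => ?_
  rw [integral_pairing_mul (G := fun p => upper (increment θ (h n) (Dy n) (R n) p)) l
    (fun i j => (hinc n i.castSucc j.castSucc).1) (memLp_plate_osc_snd hω hωb hψ (h n))]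
  rfl

end Strain

/-! ### The strain in the rotated frame. -/

theorem abs_entry_le_one_of_mem_SO3 {Q : M3} (hQ : Q ∈ SO3) (i j : Fin 3) : |Q i j| ≤ 1 :=
  entry_norm_bound_of_unitary (Matrix.mem_specialOrthogonalGroup_iff.1 hQ).1 i j

theorem transpose_mul_self_of_mem_SO3 {Q : M3} (hQ : Q ∈ SO3) : Q.transpose * Q = 1 :=
  (Matrix.mem_orthogonalGroup_iff' (Fin 3) ℝ).1 (Matrix.mem_specialOrthogonalGroup_iff.1 hQ).1

theorem transpose_mem_SO3 {Q : M3} (hQ : Q ∈ SO3) : Q.transpose ∈ SO3 := by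
  obtain ⟨h1, h2⟩ := Matrix.mem_specialOrthogonalGroup_iff.1 hQ
  refine Matrix.mem_specialOrthogonalGroup_iff.2 ⟨?_, by rw [Matrix.det_transpose, h2]⟩
  rw [Matrix.mem_orthogonalGroup_iff', Matrix.transpose_transpose]
  exact (Matrix.mem_orthogonalGroup_iff (Fin 3) ℝ).1 h1

theorem ae_plate_fst {ω : Set V2} {P : V2 → Prop} (hP : ∀ᵐ x ∂(volume.restrict ω), P x) :
    ∀ᵐ p ∂(volume.restrict (plate ω 1)), P p.1 := by
  rw [plate_one_eq, Measure.volume_eq_prod, ← Measure.prod_restrict]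
  exact Measure.quasiMeasurePreserving_fst.ae hP

theorem eLpNorm_plate_comp_fst {ω : Set V2} {f : V2 → ℝ}
    (hf : AEStronglyMeasurable f (volume.restrict ω)) :
    eLpNorm (fun p : V2 × ℝ => f p.1) 2 (volume.restrict (plate ω 1)) =
      eLpNorm f 2 (volume.restrict ω) := by
  have : IsProbabilityMeasure (volume.restrict (Ioo (-(1 / 2) : ℝ) (1 / 2))) := ⟨by simp; norm_num⟩
  rw [plate_one_eq, Measure.volume_eq_prod, ← Measure.prod_restrict]
  exact eLpNorm_comp_measurePreserving hf measurePreserving_fst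

/-- `h⁻⁴ (Rᵀ ∇y ∘ Θ^h ∘ P^h - I)`. -/
noncomputable def rotatedIncrement (θ : V2 → ℝ) (h : ℝ) (Dy : V3 → M3) (R : V2 → M3) (p : V2 × ℝ) :
    M3 :=
  (R p.1).transpose * increment θ h Dy R p

theorem transpose_mul_gradient {θ : V2 → ℝ} {h : ℝ} {Dy : V3 → M3} {R : V2 → M3} (hh : 0 < h)
    {p : V2 × ℝ} (hR : R p.1 ∈ SO3) : (R p.1).transpose * Dy (ThetaP θ h p) =
      1 + h ^ 4 • rotatedIncrement θ h Dy R p := by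
  have h4 : h ^ 4 ≠ 0 := by positivity
  rw [rotatedIncrement, increment, Matrix.mul_smul, smul_smul, mul_inv_cancel₀ h4, one_smul,
    Matrix.mul_sub, transpose_mul_self_of_mem_SO3 hR]
  abel

section Rotated

variable {ω : Set V2} {θ : V2 → ℝ} {h : ℕ → ℝ} {y : ℕ → V3 → V3} {Dy : ℕ → V3 → M3}
  {R : ℕ → V2 → M3} {DR : ℕ → V2 → Fin 3 → Fin 3 → V2} {u : V2 → V2} {v : V2 → ℝ} {Dv : V2 → V2}
  {A : V2 → M3}

variable (hω : IsOpen ω) (hωb : Bornology.IsBounded ω)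
  (hpos : ∀ n, 0 < h n) (hlim : Tendsto h atTop (𝓝 0))
  (hR : ∀ n, ∀ᵐ x ∂(volume.restrict ω), R n x ∈ SO3)
  (hDR : ∀ n i j, HasWeakGrad ω (fun x => R n x i j) (fun x => DR n x i j))
  (hcomp : CompactSequence ω θ h y Dy R DR u v Dv A)

include hωb hpos hR hDR hcomp in
theorem exists_rotatedIncrement_bound : ∃ C : ℝ≥0∞, C ≠ ⊤ ∧ ∀ n i k,
    MemLp (fun p => rotatedIncrement θ (h n) (Dy n) (R n) p i k) 2 (volume.restrict (plate ω 1)) ∧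
    eLpNorm (fun p => rotatedIncrement θ (h n) (Dy n) (R n) p i k) 2
      (volume.restrict (plate ω 1)) ≤ C := by
  obtain ⟨C, hC, hinc⟩ := exists_increment_bound hωb hpos hDR hcomp
  -- Each entry is a sum of three products with entries of a rotation, which are at most one in
  -- modulus.
  refine ⟨3 * C, by finiteness, fun n i k => ?_⟩
  have h1 : ∀ j, MemLp (fun p : V2 × ℝ => R n p.1 j i * increment θ (h n) (Dy n) (R n) p j k) 2
      (volume.restrict (plate ω 1)) ∧
      eLpNorm (fun p : V2 × ℝ => R n p.1 j i * increment θ (h n) (Dy n) (R n) p j k) 2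
      (volume.restrict (plate ω 1)) ≤ C := by
    intro j
    have hb : ∀ᵐ p ∂(volume.restrict (plate ω 1)),
        ‖R n p.1 j i * increment θ (h n) (Dy n) (R n) p j k‖ ≤
          ‖increment θ (h n) (Dy n) (R n) p j k‖ := by
      filter_upwards [ae_plate_fst (hR n)] with p hp
      rw [norm_mul]
      exact mul_le_of_le_one_left (norm_nonneg _) (abs_entry_le_one_of_mem_SO3 hp j i)
    exact ⟨(hinc n j k).1.mono ((memLp_plate_comp_fst (hDR n j i).memLp).1.mul (hinc n j k).1.1) hb,
      (eLpNorm_mono_ae hb).trans (hinc n j k).2⟩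
  have h2 : (fun p => rotatedIncrement θ (h n) (Dy n) (R n) p i k) =
      ∑ j, fun p : V2 × ℝ => R n p.1 j i * increment θ (h n) (Dy n) (R n) p j k := by
    funext p
    simp [rotatedIncrement, Matrix.mul_apply]
  rw [h2]
  refine ⟨memLp_finsetSum' _ fun j _ => (h1 j).1, ?_⟩
  refine (eLpNorm_sum_le (fun j _ => (h1 j).1.1) (by norm_num)).trans ?_
  refine (Finset.sum_le_sum fun j _ => (h1 j).2).trans ?_
  simp

include hω hωb hpos hlim hR hDR hcomp in
-- `R - I` tends to zero in `L²` and the increment is bounded in `L²`, so their product tends to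
-- zero in `L¹` only; this is enough because the test fields are bounded.
theorem tendsto_pairing_rotatedIncrement {l : M2} {b : ℕ → V2 × ℝ → ℝ} {M L : ℝ}
    (hb : ∀ n, Continuous (b n)) (hbM : ∀ n p, p ∈ plate ω 1 → |b n p| ≤ M)
    (hL : Tendsto (fun n => ∫ p in plate ω 1, pairing l (upper (increment θ (h n) (Dy n) (R n) p)) *
        b n p) atTop (𝓝 L)) :
    Tendsto (fun n => ∫ p in plate ω 1, pairing l (upper (rotatedIncrement θ (h n) (Dy n) (R n) p)) *
        b n p) atTop (𝓝 L) := by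
  have := isFiniteMeasure_plate hωb
  have : IsFiniteMeasure (volume.restrict ω) := ⟨by simpa using hωb.measure_lt_top⟩
  obtain ⟨C, hC, hinc⟩ := exists_increment_bound hωb hpos hDR hcomp
  obtain ⟨C', hC', hrot⟩ := exists_rotatedIncrement_bound hωb hpos hR hDR hcomp
  obtain ⟨D, hD⟩ := hcomp.rotation_near 2 (by norm_num) (by norm_num)
  have hbm : ∀ n, MemLp (b n) 2 (volume.restrict (plate ω 1)) := fun n =>
    MemLp.of_bound (hb n).aestronglyMeasurable M (by
      filter_upwards [ae_restrict_mem (measurableSet_plate hω)] with p hp using hbM n p hp)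
  have hRm : ∀ n k i, MemLp (fun x => R n x k i - (1 : M3) k i) 2 (volume.restrict ω) :=
    fun n k i => (hDR n k i).memLp.sub (memLp_const _)
  have hle : ∀ n k i, ∀ᵐ p ∂(volume.restrict (plate ω 1)),
      ‖(R n p.1 k i - (1 : M3) k i) * b n p‖ ≤ M * ‖R n p.1 k i - (1 : M3) k i‖ := by
    intro n k i
    filter_upwards [ae_restrict_mem (measurableSet_plate hω)] with p hp
    rw [norm_mul, mul_comm]
    gcongr
    exact hbM n p hp
  have hgm : ∀ n k i, MemLp (fun p : V2 × ℝ => (R n p.1 k i - (1 : M3) k i) * b n p) 2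
      (volume.restrict (plate ω 1)) := fun n k i =>
    (memLp_plate_comp_fst (hRm n k i)).of_le_mul
      ((memLp_plate_comp_fst (hRm n k i)).1.mul (hbm n).1) (hle n k i)
  have hg0 : ∀ k i, Tendsto (fun n => eLpNorm (fun p : V2 × ℝ => (R n p.1 k i - (1 : M3) k i) * b n p) 2
      (volume.restrict (plate ω 1))) atTop (𝓝 0) := by
    intro k i
    have h1 : Tendsto (fun n => ENNReal.ofReal M * ENNReal.ofReal (D * h n ^ 2)) atTop (𝓝 0) := by
      have h2 : Tendsto (fun n => D * h n ^ 2) atTop (𝓝 0) := by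
        simpa using (hlim.pow 2).const_mul D
      simpa using ENNReal.Tendsto.const_mul (ENNReal.tendsto_ofReal h2)
        (Or.inr (ENNReal.ofReal_ne_top (r := M)))
    refine tendsto_of_tendsto_of_tendsto_of_le_of_le tendsto_const_nhds h1 (fun n => zero_le) fun n => ?_
    refine (eLpNorm_le_mul_eLpNorm_of_ae_le_mul (hle n k i) 2).trans ?_
    gcongr
    have := eLpNorm_plate_comp_fst (hRm n k i).1
    rw [this]
    exact hD n k i
  have hz : ∀ i j k, Tendsto (fun n => ∫ p in plate ω 1, increment θ (h n) (Dy n) (R n) p k j *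
      ((R n p.1 k i - (1 : M3) k i) * b n p)) atTop (𝓝 0) := fun i j k =>
    tendsto_integral_mul_zero hC (Eventually.of_forall fun n => hinc n k j)
      (Eventually.of_forall fun n => hgm n k i) (hg0 k i)
  have hsum := tendsto_finsetSum Finset.univ fun i (_ : i ∈ Finset.univ) =>
    tendsto_finsetSum Finset.univ fun j (_ : j ∈ Finset.univ) =>
      (tendsto_finsetSum Finset.univ fun k (_ : k ∈ Finset.univ) =>
        hz (Fin.castSucc i) (Fin.castSucc j) k).const_mul (l i j)
  simp only [Finset.sum_const_zero, mul_zero] at hsum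
  have hadd := hL.add hsum
  rw [add_zero] at hadd
  refine hadd.congr fun n => ?_
  rw [integral_pairing_mul (G := fun p => upper (increment θ (h n) (Dy n) (R n) p)) l
    (fun i j => (hinc n i.castSucc j.castSucc).1) (hbm n),
    integral_pairing_mul (G := fun p => upper (rotatedIncrement θ (h n) (Dy n) (R n) p)) l
    (fun i j => (hrot n i.castSucc j.castSucc).1) (hbm n), ← Finset.sum_add_distrib]
  refine Finset.sum_congr rfl fun i _ => ?_
  rw [← Finset.sum_add_distrib]
  refine Finset.sum_congr rfl fun j _ => ?_
  have i1 : Integrable (fun p => ∑ k, increment θ (h n) (Dy n) (R n) p k j.castSucc *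
      ((R n p.1 k i.castSucc - (1 : M3) k i.castSucc) * b n p)) (volume.restrict (plate ω 1)) :=
    integrable_finsetSum _ fun k _ => integrable_mul_of_memLp (hinc n k _).1 (hgm n k _)
  rw [← mul_add, ← integral_finsetSum _ fun k _ => integrable_mul_of_memLp (hinc n k _).1 (hgm n k _)]
  refine congrArg (l i j * ·) (Eq.trans (integral_add
    (integrable_mul_of_memLp (hinc n i.castSucc j.castSucc).1 (hbm n)) i1).symm ?_)
  congr 1
  funext p
  simp only [upper, Matrix.of_apply, rotatedIncrement, Matrix.mul_apply, Matrix.transpose_apply]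
  have h1 : ∑ k, increment θ (h n) (Dy n) (R n) p k j.castSucc * (1 : M3) k i.castSucc =
      increment θ (h n) (Dy n) (R n) p i.castSucc j.castSucc := by
    simp [Matrix.one_apply]
  rw [← h1, Finset.sum_mul, Finset.sum_mul, ← Finset.sum_add_distrib]
  refine Finset.sum_congr rfl fun k _ => by ring

end Rotated

/-! ### Lower bounds for the energy. -/

theorem abs_pairing_upper_le (l : M2) (G : M3) :
    |pairing l (upper G)| ≤ (∑ i, ∑ j, |l i j|) * Real.sqrt (∑ i, ∑ j, G i j ^ 2) := by
  have hG : ∀ i j, |G i j| ≤ Real.sqrt (∑ i, ∑ j, G i j ^ 2) := by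
    intro i j
    refine Real.abs_le_sqrt ?_
    refine (Finset.single_le_sum (f := fun j => G i j ^ 2) (fun j _ => sq_nonneg _)
      (Finset.mem_univ j)).trans ?_
    exact Finset.single_le_sum (f := fun i => ∑ j, G i j ^ 2)
      (fun i _ => Finset.sum_nonneg fun j _ => sq_nonneg _) (Finset.mem_univ i)
  rw [pairing, Finset.sum_mul]
  refine (Finset.abs_sum_le_sum_abs _ _).trans (Finset.sum_le_sum fun i _ => ?_)
  rw [Finset.sum_mul]
  refine (Finset.abs_sum_le_sum_abs _ _).trans (Finset.sum_le_sum fun j _ => ?_)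
  rw [abs_mul]
  exact mul_le_mul_of_nonneg_left (hG _ _) (abs_nonneg _)

/-- A lower bound by functions that are affine in the relevant strain components, up to an error
that is quadratic in the strain. -/
theorem IsStoredEnergy.ofReal_le_scaled {W : M3 → ℝ≥0∞} (hW : IsStoredEnergy W) {m : ℕ}
    {l : Fin m → M2} (hl : ∀ G, Q2 W G = ∑ k, pairing (l k) G ^ 2)
    (hup : ∀ X, Q2 W (upper X) ≤ Q3 W X) {ε M : ℝ} (hε : 0 < ε) (hM : 0 ≤ M) :
    ∃ K, 0 ≤ K ∧ ∀ s, 0 < s → ∀ (G : M3) (ψ : Fin m → ℝ), (∀ k, |ψ k| ≤ M) →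
      ENNReal.ofReal ((∑ k, (pairing (l k) (upper G) * ψ k - 1 / 2 * ψ k ^ 2)) -
        (ε + K * s) * ∑ i, ∑ j, G i j ^ 2) ≤ ENNReal.ofReal ((s ^ 2)⁻¹) * W (1 + s • G) := by
  obtain ⟨r, hr, hrW⟩ := hW.ofReal_le hε
  set Λ := ∑ k, ∑ i, ∑ j, |l k i j| with hΛ
  have hΛ0 : 0 ≤ Λ := Finset.sum_nonneg fun k _ => Finset.sum_nonneg fun i _ =>
    Finset.sum_nonneg fun j _ => abs_nonneg _
  have hsr := Real.sqrt_pos.2 hr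
  -- `K` is fixed by the case of large strain: there `s |G| > √r`, hence `|G| ≤ s |G|² / √r`, and `K
  -- s |G|²` dominates the linear term, which is at most `Λ M |G|`.
  refine ⟨Λ * M / Real.sqrt r, by positivity, fun s hs G ψ hψ => ?_⟩
  set S := ∑ i, ∑ j, G i j ^ 2 with hS
  have hS0 : 0 ≤ S := Finset.sum_nonneg fun i _ => Finset.sum_nonneg fun j _ => sq_nonneg _
  have hsS : ∑ i, ∑ j, (s • G) i j ^ 2 = s ^ 2 * S := by
    simp only [hS, Finset.mul_sum, Matrix.smul_apply, smul_eq_mul, mul_pow]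
  have hsq : ∑ k, 1 / 2 * ψ k ^ 2 ≥ 0 := Finset.sum_nonneg fun k _ => by positivity
  by_cases hcase : s ^ 2 * S ≤ r
  · have h1 := hrW (s • G) (by rw [hsS]; exact hcase)
    rw [hsS, hW.Q3_smul] at h1
    refine le_trans ?_ (mul_le_mul_right h1 _)
    rw [← ENNReal.ofReal_mul (by positivity)]
    refine ENNReal.ofReal_le_ofReal ?_
    have h2 : (s ^ 2)⁻¹ * (1 / 2 * (s ^ 2 * Q3 W G) - ε * (s ^ 2 * S)) = 1 / 2 * Q3 W G - ε * S := by
      field_simp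
    rw [h2]
    -- For small strain the bound is Taylor's formula followed by Young's inequality in each form.
    have h3 : ∑ k, (pairing (l k) (upper G) * ψ k - 1 / 2 * ψ k ^ 2) ≤ 1 / 2 * Q3 W G := by
      refine le_trans ?_ (mul_le_mul_of_nonneg_left (hup G) (by norm_num))
      rw [hl, Finset.mul_sum]
      refine Finset.sum_le_sum fun k _ => ?_
      nlinarith [sq_nonneg (pairing (l k) (upper G) - ψ k)]
    have h4 : 0 ≤ Λ * M / Real.sqrt r * s * S := by positivity
    linarith
  · push Not at hcase
    -- For large strain the real number on the left is nonpositive, so no information on `W` is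
    -- needed there and no truncation of the strain.
    rw [ENNReal.ofReal_of_nonpos]
    · exact zero_le
    have h5 : Real.sqrt r ≤ s * Real.sqrt S := by
      rw [← Real.sqrt_sq hs.le, ← Real.sqrt_mul (by positivity)]
      exact Real.sqrt_le_sqrt hcase.le
    have h6 : Real.sqrt S ≤ s * S / Real.sqrt r := by
      rw [le_div_iff₀ hsr]
      nlinarith [Real.mul_self_sqrt hS0, Real.sqrt_nonneg S]
    have h7 : ∑ k, pairing (l k) (upper G) * ψ k ≤ Λ * Real.sqrt S * M := by
      rw [hΛ, Finset.sum_mul, Finset.sum_mul]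
      refine Finset.sum_le_sum fun k _ => (le_abs_self _).trans ?_
      rw [abs_mul]
      exact mul_le_mul (abs_pairing_upper_le _ _) (hψ k) (abs_nonneg _) (by positivity)
    have h8 : Λ * Real.sqrt S * M ≤ Λ * M / Real.sqrt r * s * S := by
      calc Λ * Real.sqrt S * M ≤ Λ * (s * S / Real.sqrt r) * M := by gcongr
        _ = _ := by ring
    rw [Finset.sum_sub_distrib]
    have h9 : 0 ≤ ε * S := by positivity
    linarith

theorem ofReal_integral_le {X : Type*} [MeasurableSpace X] {μ : Measure X} {f : X → ℝ}
    (hf : Integrable f μ) : ENNReal.ofReal (∫ x, f x ∂μ) ≤ ∫⁻ x, ENNReal.ofReal (f x) ∂μ := by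
  have h1 : ∫ x, f x ∂μ ≤ ∫ x, max (f x) 0 ∂μ :=
    integral_mono hf hf.pos_part fun x => le_max_left _ _
  refine (ENNReal.ofReal_le_ofReal h1).trans ?_
  rw [ofReal_integral_eq_lintegral_ofReal hf.pos_part (Eventually.of_forall fun x => le_max_right _ _)]
  refine lintegral_mono fun x => ?_
  simp

section EnergyBound

variable {ω : Set V2} {θ : V2 → ℝ} {h : ℝ} {Dy : V3 → M3} {R : V2 → M3} {Rbar : M3} {W : M3 → ℝ≥0∞}

/-- Frame indifference is used twice, to remove the normalizing rotation and to insert `Rᵀ`. The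
Jacobian `h²` against the prefactor `h⁻¹⁰` leaves `(h⁴)⁻²`, the scaling of a quadratic form in the
strain `h⁴ G`. -/
theorem GoodScale.lintegral_rotated_le_energy (hg : GoodScale ω θ h) (hθ : ContDiff ℝ 2 θ)
    (hW : IsStoredEnergy W) {δ : ℝ} (hδ : δ < 1)
    (hdet : ∀ z : V3, |z 2| < 1 →
      |(fderiv ℝ (fun z => ThetaP θ h (split z)) z).det - h ^ 2| ≤ δ * h ^ 2)
    (hR : ∀ᵐ x ∂(volume.restrict ω), R x ∈ SO3) (hRbar : Rbar ∈ SO3) :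
    ENNReal.ofReal (1 - δ) * ∫⁻ p in plate ω 1, ENNReal.ofReal (((h ^ 4) ^ 2)⁻¹) *
      W (1 + h ^ 4 • rotatedIncrement θ h (fun x => Rbar.transpose * Dy x) R p) ≤
      energy W ω θ h Dy := by
  have hh := hg.pos
  have h1 : ∀ᵐ p ∂(volume.restrict (plate ω 1)),
      W (1 + h ^ 4 • rotatedIncrement θ h (fun x => Rbar.transpose * Dy x) R p) =
        W (Dy (ThetaP θ h p)) := by
    filter_upwards [ae_plate_fst hR] with p hp
    rw [← transpose_mul_gradient hh hp, hW.frame _ _ (transpose_mem_SO3 hp),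
      hW.frame _ _ (transpose_mem_SO3 hRbar)]
  have h2 := hg.le_lintegral_shell hθ hdet fun x => W (Dy x)
  rw [lintegral_const_mul' _ _ ENNReal.ofReal_ne_top, lintegral_congr_ae h1, energy]
  refine le_trans (le_of_eq ?_) (mul_le_mul_right h2 _)
  rw [← mul_assoc, ← mul_assoc, ← ENNReal.ofReal_mul (by linarith), ← ENNReal.ofReal_mul (by positivity)]
  congr 2
  field_simp

theorem GoodScale.ofReal_le_energy (hg : GoodScale ω θ h) (hθ : ContDiff ℝ 2 θ) (hω : IsOpen ω)
    (hW : IsStoredEnergy W) {δ : ℝ} (hδ : δ < 1)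
    (hdet : ∀ z : V3, |z 2| < 1 →
      |(fderiv ℝ (fun z => ThetaP θ h (split z)) z).det - h ^ 2| ≤ δ * h ^ 2)
    (hR : ∀ᵐ x ∂(volume.restrict ω), R x ∈ SO3) (hRbar : Rbar ∈ SO3) {m : ℕ} {l : Fin m → M2}
    {ε K M : ℝ}
    (hK : ∀ s, 0 < s → ∀ (G : M3) (ψ : Fin m → ℝ), (∀ k, |ψ k| ≤ M) →
      ENNReal.ofReal ((∑ k, (pairing (l k) (upper G) * ψ k - 1 / 2 * ψ k ^ 2)) -
        (ε + K * s) * ∑ i, ∑ j, G i j ^ 2) ≤ ENNReal.ofReal ((s ^ 2)⁻¹) * W (1 + s • G))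
    (hG : ∀ i j, MemLp (fun p => rotatedIncrement θ h (fun x => Rbar.transpose * Dy x) R p i j) 2
      (volume.restrict (plate ω 1)))
    {Ψ : Fin m → V2 × ℝ → ℝ} (hΨ : ∀ k, MemLp (Ψ k) 2 (volume.restrict (plate ω 1)))
    (hΨM : ∀ k, ∀ p ∈ plate ω 1, |Ψ k p| ≤ M) :
    ENNReal.ofReal (1 - δ) * ENNReal.ofReal ((∑ k,
      ((∫ p in plate ω 1, pairing (l k)
        (upper (rotatedIncrement θ h (fun x => Rbar.transpose * Dy x) R p)) * Ψ k p) -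
        1 / 2 * ∫ p in plate ω 1, Ψ k p ^ 2)) -
      (ε + K * h ^ 4) * ∑ i, ∑ j, ∫ p in plate ω 1,
        rotatedIncrement θ h (fun x => Rbar.transpose * Dy x) R p i j ^ 2) ≤ energy W ω θ h Dy := by
  refine le_trans (mul_le_mul_right ?_ _) (hg.lintegral_rotated_le_energy hθ hW hδ hdet hR hRbar)
  set G := rotatedIncrement θ h (fun x => Rbar.transpose * Dy x) R with hGdef
  have i1 : ∀ k, Integrable (fun p => pairing (l k) (upper (G p)) * Ψ k p)
      (volume.restrict (plate ω 1)) := fun k =>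
    integrable_mul_of_memLp (memLp_pairing (G := fun p => upper (G p)) (l k)
      fun i j => hG i.castSucc j.castSucc) (hΨ k)
  have i2 : ∀ k, Integrable (fun p => 1 / 2 * Ψ k p ^ 2) (volume.restrict (plate ω 1)) := fun k =>
    (hΨ k).integrable_sq.const_mul _
  have i3 : ∀ i j, Integrable (fun p => G p i j ^ 2) (volume.restrict (plate ω 1)) := fun i j =>
    (hG i j).integrable_sq
  have i12 : ∀ k, Integrable (fun p => pairing (l k) (upper (G p)) * Ψ k p - 1 / 2 * Ψ k p ^ 2)
      (volume.restrict (plate ω 1)) := fun k => (i1 k).sub (i2 k)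
  have i4 : Integrable (fun p => ∑ k, (pairing (l k) (upper (G p)) * Ψ k p - 1 / 2 * Ψ k p ^ 2))
      (volume.restrict (plate ω 1)) := integrable_finsetSum _ fun k _ => i12 k
  have i5 : Integrable (fun p => (ε + K * h ^ 4) * ∑ i, ∑ j, G p i j ^ 2)
      (volume.restrict (plate ω 1)) :=
    (integrable_finsetSum _ fun i _ => integrable_finsetSum _ fun j _ => i3 i j).const_mul _
  have e1 : (∑ k, ((∫ p in plate ω 1, pairing (l k) (upper (G p)) * Ψ k p) -
        1 / 2 * ∫ p in plate ω 1, Ψ k p ^ 2)) -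
      (ε + K * h ^ 4) * ∑ i, ∑ j, ∫ p in plate ω 1, G p i j ^ 2 =
      ∫ p in plate ω 1, ((∑ k, (pairing (l k) (upper (G p)) * Ψ k p - 1 / 2 * Ψ k p ^ 2)) -
        (ε + K * h ^ 4) * ∑ i, ∑ j, G p i j ^ 2) := by
    rw [integral_sub i4 i5, integral_finsetSum _ fun k _ => i12 k, integral_const_mul,
      integral_finsetSum _ fun i _ => integrable_finsetSum _ fun j _ => i3 i j]
    congr 1
    · refine Finset.sum_congr rfl fun k _ => ?_
      rw [integral_sub (i1 k) (i2 k), integral_const_mul]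
    · congr 1
      refine Finset.sum_congr rfl fun i _ => ?_
      rw [integral_finsetSum _ fun j _ => i3 i j]
  rw [e1]
  refine (ofReal_integral_le (i4.sub i5)).trans (lintegral_mono_ae ?_)
  filter_upwards [ae_restrict_mem (measurableSet_plate hω)] with p hp
  exact hK (h ^ 4) (pow_pos hg.pos 4) (G p) (fun k => Ψ k p) fun k => hΨM k p hp

end EnergyBound

section TestFields

variable {ω : Set V2} {ψ χ : V2 → V2 → ℝ} {h : ℕ → ℝ}

/-- The cross term is odd in `t`, so the two families of test functions decouple; `1/12` is the
second moment of the thickness variable. -/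
theorem integral_plate_sq_osc (hω : IsOpen ω) (hωb : Bornology.IsBounded ω) (hψ : TestFn ω ψ)
    (hχ : TestFn ω χ) (r : ℝ) :
    ∫ p in plate ω 1, (ψ p.1 (r⁻¹ • p.1) + χ p.1 (r⁻¹ • p.1) * p.2) ^ 2 =
      (∫ x in ω, ψ x (r⁻¹ • x) * ψ x (r⁻¹ • x)) +
        1 / 12 * ∫ x in ω, χ x (r⁻¹ • x) * χ x (r⁻¹ • x) := by
  have m0 := memLp_plate_osc hωb hψ r
  have m1 := memLp_plate_osc_snd hω hωb hχ r
  have i1 : Integrable (fun p : V2 × ℝ => ψ p.1 (r⁻¹ • p.1) * ψ p.1 (r⁻¹ • p.1) * 1)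
      (volume.restrict (plate ω 1)) := (integrable_mul_of_memLp m0 m0).mul_const 1
  have i2 : Integrable (fun p : V2 × ℝ => 2 * (ψ p.1 (r⁻¹ • p.1) * χ p.1 (r⁻¹ • p.1)) * p.2)
      (volume.restrict (plate ω 1)) := by
    refine ((integrable_mul_of_memLp m0 m1).const_mul 2).congr (Eventually.of_forall fun p => ?_)
    ring
  have i3 : Integrable (fun p : V2 × ℝ => χ p.1 (r⁻¹ • p.1) * χ p.1 (r⁻¹ • p.1) * p.2 ^ 2)
      (volume.restrict (plate ω 1)) := by
    refine (integrable_mul_of_memLp m1 m1).congr (Eventually.of_forall fun p => ?_)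
    ring
  have e1 := setIntegral_plate_mul (ω := ω) (fun x => ψ x (r⁻¹ • x) * ψ x (r⁻¹ • x)) fun _ => 1
  have e2 := setIntegral_plate_mul (ω := ω) (fun x => 2 * (ψ x (r⁻¹ • x) * χ x (r⁻¹ • x))) fun t => t
  have e3 := setIntegral_plate_mul (ω := ω) (fun x => χ x (r⁻¹ • x) * χ x (r⁻¹ • x)) fun t => t ^ 2
  rw [integral_thickness_moments.1, mul_one] at e1
  rw [integral_thickness_moments.2.1, mul_zero] at e2
  rw [integral_thickness_moments.2.2.1] at e3
  have e4 := integral_add (i1.add i2) i3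
  have e5 := integral_add i1 i2
  rw [mul_comm (1 / 12 : ℝ), ← e3, ← e1, ← add_zero (∫ p in plate ω 1, _ * 1), ← e2, ← e5]
  refine Eq.trans ?_ e4
  congr 1
  funext p
  simp only [Pi.add_apply]
  ring

theorem tendsto_integral_plate_sq_osc (hω : IsOpen ω) (hωb : Bornology.IsBounded ω)
    (hpos : ∀ n, 0 < h n) (hlim : Tendsto h atTop (𝓝 0)) (hψ : TestFn ω ψ) (hχ : TestFn ω χ) :
    Tendsto (fun n => ∫ p in plate ω 1, (ψ p.1 ((h n)⁻¹ • p.1) + χ p.1 ((h n)⁻¹ • p.1) * p.2) ^ 2)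
      atTop (𝓝 ((∫ p in ω ×ˢ cell, ψ p.1 p.2 * ψ p.1 p.2) +
        1 / 12 * ∫ p in ω ×ˢ cell, χ p.1 p.2 * χ p.1 p.2)) := by
  simp only [integral_plate_sq_osc hω hωb hψ hχ]
  exact ((hψ.mul hψ).tendsto_average hpos hlim).add
    (((hχ.mul hχ).tendsto_average hpos hlim).const_mul _)

end TestFields

section LowerBound

variable {ω : Set V2} {θ : V2 → ℝ} {W : M3 → ℝ≥0∞} {h : ℕ → ℝ} {y : ℕ → V3 → V3} {Dy : ℕ → V3 → M3}
  {R : ℕ → V2 → M3} {DR : ℕ → V2 → Fin 3 → Fin 3 → V2} {Rbar : ℕ → M3}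
  {u : V2 → V2} {v : V2 → ℝ} {Dv : V2 → V2}
  {A : V2 → M3} {Duh : ℕ → V2 → M2} {Du : V2 → M2} {D2v : V2 → M2}
  {Du₁ D2v₁ : V2 × V2 → M2}

/-- The lower bound for the energies, in dual form. -/
theorem ofReal_dual_le_liminf_energy (hω : IsOpen ω) (hωb : Bornology.IsBounded ω)
    (hθ : ContDiff ℝ 2 θ) (hθp : IsPeriodic θ) (hW : IsStoredEnergy W)
    (hpos : ∀ n, 0 < h n) (hlim : Tendsto h atTop (𝓝 0))
    (hy : ∀ᶠ n in atTop, ∀ i, HasWeakGrad (shell ω θ (h n)) (fun x => y n x i)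
      (fun x => ((Rbar n).transpose * Dy n x) i))
    (hR : ∀ n, ∀ᵐ x ∂(volume.restrict ω), R n x ∈ SO3)
    (hDR : ∀ n i j, HasWeakGrad ω (fun x => R n x i j) (fun x => DR n x i j))
    (hRbar : ∀ n, Rbar n ∈ SO3)
    (hcomp : CompactSequence ω θ h y (fun n x => (Rbar n).transpose * Dy n x) R DR u v Dv A)
    (hDuh : ∀ n β, HasWeakGrad ω (fun x => inPlane θ (h n) (y n) (R n) x β) (fun x => Duh n x β))
    (hts_u : ∀ β α, TwoScale ω h (fun n x => Duh n x β α) (fun p => Du p.1 β α + Du₁ p β α))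
    (hts_R : ∀ β α : Fin 2, TwoScale ω h (fun n x => (h n ^ 2)⁻¹ * DR n x β.castSucc 2 α)
      (fun p => -(D2v p.1 β α) - D2v₁ p β α))
    {m : ℕ} {l : Fin m → M2} (hls : ∀ k i j, l k i j = l k j i)
    (hl : ∀ G, Q2 W G = ∑ k, pairing (l k) G ^ 2) (hup : ∀ X, Q2 W (upper X) ≤ Q3 W X)
    {ψ χ : Fin m → V2 → V2 → ℝ} (hψ : ∀ k, TestFn ω (ψ k)) (hχ : ∀ k, TestFn ω (χ k)) :
    ENNReal.ofReal (∑ k, (((∫ p in ω ×ˢ cell,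
        pairing (l k) (strain θ Du Du₁ Dv D2v D2v₁ p) * ψ k p.1 p.2) -
        1 / 12 * ∫ p in ω ×ˢ cell, pairing (l k) (D2v p.1 + D2v₁ p) * χ k p.1 p.2) -
        1 / 2 * ((∫ p in ω ×ˢ cell, ψ k p.1 p.2 * ψ k p.1 p.2) +
          1 / 12 * ∫ p in ω ×ˢ cell, χ k p.1 p.2 * χ k p.1 p.2))) ≤
      liminf (fun n => energy W ω θ (h n) (Dy n)) atTop := by
  set J := ∑ k, (((∫ p in ω ×ˢ cell,
        pairing (l k) (strain θ Du Du₁ Dv D2v D2v₁ p) * ψ k p.1 p.2) -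
        1 / 12 * ∫ p in ω ×ˢ cell, pairing (l k) (D2v p.1 + D2v₁ p) * χ k p.1 p.2) -
        1 / 2 * ((∫ p in ω ×ˢ cell, ψ k p.1 p.2 * ψ k p.1 p.2) +
          1 / 12 * ∫ p in ω ×ˢ cell, χ k p.1 p.2 * χ k p.1 p.2)) with hJ
  obtain ⟨C, hC, hrot⟩ := exists_rotatedIncrement_bound hωb hpos hR hDR hcomp
  choose Mψ hMψ0 hMψ using fun k => (hψ k).exists_bound
  choose Mχ hMχ0 hMχ using fun k => (hχ k).exists_bound
  set M := ∑ k, (Mψ k + Mχ k) with hM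
  have hM0 : 0 ≤ M := Finset.sum_nonneg fun k _ => by have := hMψ0 k; have := hMχ0 k; positivity
  set Ψ : ℕ → Fin m → V2 × ℝ → ℝ := fun n k p =>
    ψ k p.1 ((h n)⁻¹ • p.1) + χ k p.1 ((h n)⁻¹ • p.1) * p.2 with hΨdef
  have hΨm : ∀ n k, MemLp (Ψ n k) 2 (volume.restrict (plate ω 1)) := fun n k =>
    (memLp_plate_osc hωb (hψ k) (h n)).add (memLp_plate_osc_snd hω hωb (hχ k) (h n))
  have hΨM : ∀ n k, ∀ p ∈ plate ω 1, |Ψ n k p| ≤ M := by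
    intro n k p hp
    have h1 : |χ k p.1 ((h n)⁻¹ • p.1) * p.2| ≤ Mχ k := by
      rw [abs_mul]
      calc _ ≤ Mχ k * 1 := mul_le_mul (hMχ k _ _) (abs_snd_le_of_mem_plate hp) (abs_nonneg _) (hMχ0 k).le
        _ = Mχ k := mul_one _
    refine (abs_add_le _ _).trans ((add_le_add (hMψ k _ _) h1).trans ?_)
    exact Finset.single_le_sum (f := fun k => Mψ k + Mχ k)
      (fun k _ => by have := hMψ0 k; have := hMχ0 k; positivity) (Finset.mem_univ k)
  set G : ℕ → V2 × ℝ → M3 := fun n =>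
    rotatedIncrement θ (h n) (fun x => (Rbar n).transpose * Dy n x) (R n) with hGdef
  have hlin : ∀ k, Tendsto (fun n => ∫ p in plate ω 1, pairing (l k) (upper (G n p)) * Ψ n k p) atTop
      (𝓝 ((∫ p in ω ×ˢ cell, pairing (l k) (strain θ Du Du₁ Dv D2v D2v₁ p) * ψ k p.1 p.2) -
        1 / 12 * ∫ p in ω ×ˢ cell, pairing (l k) (D2v p.1 + D2v₁ p) * χ k p.1 p.2)) := by
    intro k
    have h1 := tendsto_pairing_rotatedIncrement hω hωb hpos hlim hR hDR hcomp (M := Mψ k)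
      (b := fun n p => ψ k p.1 ((h n)⁻¹ • p.1))
      (fun n => ((hψ k).continuous_osc (h n)).comp continuous_fst) (fun n p _ => hMψ k _ _)
      (tendsto_pairing_increment hθ hθp hω hωb hpos hlim hy hDR hcomp hDuh hts_u hts_R (hψ k) (hls k))
    have h2 := tendsto_pairing_rotatedIncrement hω hωb hpos hlim hR hDR hcomp (M := Mχ k)
      (b := fun n p => χ k p.1 ((h n)⁻¹ • p.1) * p.2)
      (fun n => (((hχ k).continuous_osc (h n)).comp continuous_fst).mul continuous_snd)
      (fun n p hp => by
        rw [abs_mul]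
        calc _ ≤ Mχ k * 1 :=
              mul_le_mul (hMχ k _ _) (abs_snd_le_of_mem_plate hp) (abs_nonneg _) (hMχ0 k).le
          _ = Mχ k := mul_one _)
      (tendsto_pairing_moment hθ hθp hω hωb hpos hlim hy hDR hcomp hts_R (hχ k) (l k))
    rw [sub_eq_add_neg]
    refine (h1.add h2).congr fun n => ?_
    have hpm := memLp_pairing (G := fun p => upper (G n p)) (l k)
      fun i j => (hrot n i.castSucc j.castSucc).1
    refine (integral_add (integrable_mul_of_memLp hpm (memLp_plate_osc hωb (hψ k) (h n)))
      (integrable_mul_of_memLp hpm (memLp_plate_osc_snd hω hωb (hχ k) (h n)))).symm.trans ?_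
    congr 1
    funext p
    exact (mul_add _ _ _).symm
  have hquad : ∀ k, Tendsto (fun n => ∫ p in plate ω 1, Ψ n k p ^ 2) atTop _ := fun k =>
    tendsto_integral_plate_sq_osc hω hωb hpos hlim (hψ k) (hχ k)
  have hJlim : Tendsto (fun n => ∑ k, ((∫ p in plate ω 1, pairing (l k) (upper (G n p)) * Ψ n k p) -
      1 / 2 * ∫ p in plate ω 1, Ψ n k p ^ 2)) atTop (𝓝 J) :=
    tendsto_finsetSum _ fun k _ => (hlin k).sub ((hquad k).const_mul _)
  -- A bound for the squared `L²` norm of the rotated strain, uniform in `n`; it controls the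
  -- quadratic error of the affine lower bound.
  set B := ∑ _i : Fin 3, ∑ _j : Fin 3, C.toReal * C.toReal with hB
  have hGB : ∀ n, ∑ i, ∑ j, ∫ p in plate ω 1, G n p i j ^ 2 ≤ B := by
    intro n
    refine Finset.sum_le_sum fun i _ => Finset.sum_le_sum fun j _ => ?_
    have h1 := integral_abs_mul_le (hrot n i j).1 (hrot n i j).1
    have h2 : (eLpNorm (fun p => G n p i j) 2 (volume.restrict (plate ω 1))).toReal ≤ C.toReal :=
      ENNReal.toReal_mono hC (hrot n i j).2
    have h3 : ∫ p in plate ω 1, G n p i j ^ 2 = ∫ p in plate ω 1, |G n p i j * G n p i j| := by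
      congr 1
      funext p
      rw [abs_mul_self, sq]
    rw [h3]
    exact h1.trans (mul_le_mul h2 h2 ENNReal.toReal_nonneg ENNReal.toReal_nonneg)
  -- The single parameter `t` serves both as Taylor tolerance and as relative defect of the
  -- Jacobian. It is sent to zero only after the limit in `n`.
  have key : ∀ t : ℝ, 0 < t → t < 1 → ENNReal.ofReal (1 - t) * ENNReal.ofReal (J - t * B) ≤
      liminf (fun n => energy W ω θ (h n) (Dy n)) atTop := by
    intro t ht ht1
    obtain ⟨K, hK0, hK⟩ := hW.ofReal_le_scaled hl hup ht hM0
    obtain ⟨h₀, hh₀, hdet⟩ := abs_det_fderiv_ThetaP hθ hθp ht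
    have hlow : Tendsto (fun n => ENNReal.ofReal (1 - t) * ENNReal.ofReal ((∑ k,
        ((∫ p in plate ω 1, pairing (l k) (upper (G n p)) * Ψ n k p) -
        1 / 2 * ∫ p in plate ω 1, Ψ n k p ^ 2)) - (t + K * h n ^ 4) * B)) atTop
        (𝓝 (ENNReal.ofReal (1 - t) * ENNReal.ofReal (J - t * B))) := by
      refine ENNReal.Tendsto.const_mul (ENNReal.tendsto_ofReal (hJlim.sub ?_))
        (Or.inr ENNReal.ofReal_ne_top)
      have h1 : Tendsto (fun n => (t + K * h n ^ 4) * B) atTop (𝓝 ((t + K * 0 ^ 4) * B)) :=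
        (((hlim.pow 4).const_mul K).const_add t).mul_const B
      simpa using h1
    rw [← hlow.liminf_eq]
    refine liminf_le_liminf ?_
    filter_upwards [eventually_goodScale hθ hθp hω hpos hlim, hlim.eventually (gt_mem_nhds hh₀)]
      with n hg hn
    refine le_trans ?_ (hg.ofReal_le_energy hθ hω hW ht1 (hdet (h n) (hpos n) hn) (hR n) (hRbar n) hK
      (fun i j => (hrot n i j).1) (hΨm n) (hΨM n))
    refine mul_le_mul_right (ENNReal.ofReal_le_ofReal ?_) _
    have : (t + K * h n ^ 4) * ∑ i, ∑ j, ∫ p in plate ω 1, G n p i j ^ 2 ≤ (t + K * h n ^ 4) * B :=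
      mul_le_mul_of_nonneg_left (hGB n) (by have := hpos n; positivity)
    exact sub_le_sub_left this _
  have hlim0 : Tendsto (fun t : ℝ => ENNReal.ofReal (1 - t) * ENNReal.ofReal (J - t * B)) (𝓝[>] 0)
      (𝓝 (ENNReal.ofReal (1 - 0) * ENNReal.ofReal (J - 0 * B))) := by
    refine (ENNReal.Tendsto.mul (ENNReal.tendsto_ofReal (Continuous.tendsto (by fun_prop) _))
      (Or.inr ENNReal.ofReal_ne_top) (ENNReal.tendsto_ofReal (Continuous.tendsto (by fun_prop) _))
      (Or.inr ENNReal.ofReal_ne_top)).mono_left nhdsWithin_le_nhds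
  rw [sub_zero, zero_mul, sub_zero, ENNReal.ofReal_one, one_mul] at hlim0
  refine le_of_tendsto hlim0 ?_
  filter_upwards [Ioo_mem_nhdsGT one_pos] with t ht using key t ht.1 ht.2

end LowerBound

/-! ### Recovering the quadratic limit functional from the affine bounds. -/

section Duality

variable {ω : Set V2}

/-- Completing the square, the loss in Young's inequality is exactly `½ ‖f - ψ‖²`, which density
makes small. -/
theorem exists_testFn_dual_ge (hω : IsOpen ω) (hωb : Bornology.IsBounded ω) {f : V2 × V2 → ℝ}
    (hf : MemLp f 2 (volume.restrict (ω ×ˢ cell))) {η : ℝ} (hη : 0 < η) :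
    ∃ ψ, TestFn ω ψ ∧ 1 / 2 * (∫ p in ω ×ˢ cell, f p ^ 2) - η ≤
      (∫ p in ω ×ˢ cell, f p * ψ p.1 p.2) - 1 / 2 * ∫ p in ω ×ˢ cell, ψ p.1 p.2 * ψ p.1 p.2 := by
  -- Ensures `r² ≤ η`.
  set r := min 1 η with hr
  have hr0 : 0 < r := lt_min one_pos hη
  obtain ⟨ψ, hψ, hd⟩ := exists_testFn_eLpNorm_sub_le hω hωb hf (ENNReal.ofReal_pos.2 hr0).ne'
  refine ⟨ψ, hψ, ?_⟩
  have hψm := hψ.memLp hωb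
  have h1 := integral_abs_mul_le (hf.sub hψm) (hf.sub hψm)
  have h2 : (eLpNorm (f - fun p : V2 × V2 => ψ p.1 p.2) 2 (volume.restrict (ω ×ˢ cell))).toReal ≤ r :=
    ENNReal.toReal_le_of_le_ofReal hr0.le hd
  have h3 : ∫ p in ω ×ˢ cell, (f p - ψ p.1 p.2) ^ 2 ≤ η := by
    have h4 : ∫ p in ω ×ˢ cell, (f p - ψ p.1 p.2) ^ 2 = ∫ p in ω ×ˢ cell,
        |(f - fun p : V2 × V2 => ψ p.1 p.2) p * (f - fun p : V2 × V2 => ψ p.1 p.2) p| := by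
      congr 1
      funext p
      rw [abs_mul_self, sq]
      rfl
    rw [h4]
    refine (h1.trans (mul_le_mul h2 h2 ENNReal.toReal_nonneg hr0.le)).trans ?_
    have := min_le_left 1 η
    have := min_le_right 1 η
    nlinarith
  have i1 := hf.integrable_sq
  have i2 := integrable_mul_of_memLp hf hψm
  have i3 := integrable_mul_of_memLp hψm hψm
  have h5 : ∫ p in ω ×ˢ cell, (f p - ψ p.1 p.2) ^ 2 = ((∫ p in ω ×ˢ cell, f p ^ 2) -
      2 * ∫ p in ω ×ˢ cell, f p * ψ p.1 p.2) + ∫ p in ω ×ˢ cell, ψ p.1 p.2 * ψ p.1 p.2 := by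
    rw [← integral_const_mul, ← integral_sub i1 (i2.const_mul 2)]
    refine Eq.trans ?_ (integral_add (i1.sub (i2.const_mul 2)) i3)
    congr 1
    funext p
    ring
  linarith

theorem setIntegral_prod_comp_fst {f : V2 → ℝ} (hf : AEStronglyMeasurable f (volume.restrict ω)) :
    ∫ p in ω ×ˢ cell, f p.1 = ∫ x in ω, f x := by
  have : IsProbabilityMeasure (volume.restrict cell) := ⟨by simp [volume_cell]⟩
  rw [Measure.volume_eq_prod, ← Measure.prod_restrict]
  exact (integral_map measurable_fst.aemeasurable
    (by rw [Measure.map_fst_prod, measure_univ, one_smul]; exact hf)).symm.trans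
    (by rw [Measure.map_fst_prod, measure_univ, one_smul])

/-- The constant `1` is an admissible periodic test function, so a weak derivative on the torus has
mean zero. -/
theorem IsL2Hdot2.integral_hess_eq_zero {w : V2 × V2 → ℝ} {g : V2 × V2 → V2} {H : V2 × V2 → M2}
    (hw : IsL2Hdot2 ω w g H) (l : M2) :
    ∀ᵐ x ∂(volume.restrict ω), ∫ y in cell, pairing l (H (x, y)) = 0 := by
  have : IsFiniteMeasure (volume.restrict cell) := ⟨by simp [volume_cell]⟩
  filter_upwards [hw.hess] with x hx
  have h1 : ∀ i j, ∫ y in cell, H (x, y) i j = 0 := by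
    intro i j
    have h2 := (hx i).integral_eq (fun _ => 1) contDiff_const (fun _ _ => rfl) j
    simp only [pderiv_const, mul_zero, integral_zero, mul_one] at h2
    linarith
  have h3 : ∀ i j, Integrable (fun y => l i j * H (x, y) i j) (volume.restrict cell) := fun i j =>
    (((hx i).memLp_grad j).integrable (by norm_num)).const_mul _
  simp only [pairing]
  rw [integral_finsetSum _ fun i _ => integrable_finsetSum _ fun j _ => h3 i j]
  refine Finset.sum_eq_zero fun i _ => ?_
  rw [integral_finsetSum _ fun j _ => h3 i j]
  refine Finset.sum_eq_zero fun j _ => ?_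
  rw [integral_const_mul, h1, mul_zero]

/-- The macroscopic and the microscopic curvatures are orthogonal. -/
theorem integral_sq_pairing_add {w : V2 × V2 → ℝ} {g : V2 × V2 → V2} {H : V2 × V2 → M2}
    (hw : IsL2Hdot2 ω w g H) {D : V2 → M2} (hD : ∀ i j, MemLp (fun x => D x i j) 2 (volume.restrict ω))
    (l : M2) : ∫ p in ω ×ˢ cell, pairing l (D p.1 + H p) ^ 2 =
      (∫ x in ω, pairing l (D x) ^ 2) + ∫ p in ω ×ˢ cell, pairing l (H p) ^ 2 := by
  have hDm := memLp_pairing l hD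
  have hD' := memLp_comp_fst hDm
  have hHm := memLp_pairing l hw.memLp_hess
  have hcross : ∫ p in ω ×ˢ cell, pairing l (D p.1) * pairing l (H p) = 0 := by
    have hi := integrable_mul_of_memLp hD' hHm
    rw [Measure.volume_eq_prod, ← Measure.prod_restrict] at hi ⊢
    rw [integral_prod _ hi]
    refine integral_eq_zero_of_ae ?_
    filter_upwards [hw.integral_hess_eq_zero l] with x hx
    simp only [integral_const_mul, hx, mul_zero, Pi.zero_apply]
  rw [← setIntegral_prod_comp_fst hDm.integrable_sq.1, ← add_zero (_ + _), ← mul_zero 2, ← hcross,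
    ← integral_const_mul]
  have i1 := hD'.integrable_sq
  have i2 := hHm.integrable_sq
  have i3 := (integrable_mul_of_memLp hD' hHm).const_mul 2
  rw [← integral_add i1 i2]
  refine Eq.trans ?_ (integral_add (i1.add i2) i3)
  congr 1
  funext p
  have : pairing l (D p.1 + H p) = pairing l (D p.1) + pairing l (H p) := by
    simp only [pairing, Matrix.add_apply, mul_add, Finset.sum_add_distrib]
  rw [this]
  ring

end Duality

/-- Transfers the weak gradient to the normalized deformation `Rbarᵀ y - c`. The constant drops out
because the derivative of a compactly supported function has integral zero. -/
theorem HasWeakGrad.linear_combination {d m : ℕ} {U : Set (Fin d → ℝ)} (hU : volume U ≠ ⊤)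
    {f : Fin m → (Fin d → ℝ) → ℝ} {g : Fin m → (Fin d → ℝ) → Fin d → ℝ}
    (hf : ∀ k, HasWeakGrad U (f k) (g k)) (a : Fin m → ℝ) (c : ℝ) :
    HasWeakGrad U (fun x => ∑ k, a k * f k x - c) (fun x i => ∑ k, a k * g k x i) := by
  have : IsFiniteMeasure (volume.restrict U) := ⟨by simpa using hU.lt_top⟩
  refine ⟨(memLp_finsetSum _ fun k _ => (hf k).memLp.const_mul _).sub (memLp_const _),
    fun i => memLp_finsetSum _ fun k _ => ((hf k).memLp_grad i).const_mul _,
    fun φ hφ hφc hφU i => ?_⟩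
  have hφ1 : ContDiff ℝ 1 φ := hφ.of_le (by exact_mod_cast le_top)
  have hd := continuous_pderiv hφ1 i
  have hdc := hasCompactSupport_pderiv hφc i
  have hm : MemLp (pderiv i φ) 2 (volume.restrict U) := hd.memLp_of_hasCompactSupport hdc
  have hφm : MemLp φ 2 (volume.restrict U) := hφ.continuous.memLp_of_hasCompactSupport hφc
  have h0 : ∫ x in U, pderiv i φ x = 0 := by
    rw [setIntegral_eq_integral_of_forall_compl_eq_zero fun x hx =>
      image_eq_zero_of_notMem_tsupport fun h => hx (hφU (tsupport_pderiv_subset φ i h))]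
    have h1 := integral_mul_fderiv_eq_neg_fderiv_mul_of_integrable (μ := volume)
      (f := fun _ : Fin d → ℝ => (1 : ℝ)) (g := φ) (v := Pi.single i 1) (by simp)
      (by simp only [one_mul]; exact hd.integrable_of_hasCompactSupport hdc)
      (by simpa using hφ.continuous.integrable_of_hasCompactSupport hφc)
      (fun x _ => by fun_prop) (fun x _ => hφ.differentiable (by simp) x)
    simpa [pderiv] using h1
  have i1 : ∀ k, Integrable (fun x => a k * (f k x * pderiv i φ x)) (volume.restrict U) := fun k =>
    (integrable_mul_of_memLp (hf k).memLp hm).const_mul _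
  have i2 : ∀ k, Integrable (fun x => a k * (g k x i * φ x)) (volume.restrict U) := fun k =>
    (integrable_mul_of_memLp ((hf k).memLp_grad i) hφm).const_mul _
  have e1 : ∫ x in U, (∑ k, a k * f k x - c) * pderiv i φ x =
      (∑ k, a k * ∫ x in U, f k x * pderiv i φ x) - c * ∫ x in U, pderiv i φ x := by
    simp only [← integral_const_mul]
    rw [← integral_finsetSum _ fun k _ => i1 k]
    refine Eq.trans ?_ (integral_sub (integrable_finsetSum _ fun k _ => i1 k)
      ((hm.integrable (by norm_num)).const_mul c))
    congr 1
    funext x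
    rw [sub_mul, Finset.sum_mul]
    simp only [mul_assoc]
  have e2 : ∫ x in U, (∑ k, a k * g k x i) * φ x = ∑ k, a k * ∫ x in U, g k x i * φ x := by
    simp only [← integral_const_mul]
    rw [← integral_finsetSum _ fun k _ => i2 k]
    congr 1
    funext x
    rw [Finset.sum_mul]
    simp only [mul_assoc]
  rw [e1, e2, h0, mul_zero, sub_zero, ← Finset.sum_neg_distrib]
  refine Finset.sum_congr rfl fun k _ => ?_
  rw [(hf k).integral_eq φ hφ hφc hφU i, mul_neg]

section LimitEnergy

variable {ω : Set V2} {θ : V2 → ℝ} {W : M3 → ℝ≥0∞} {Dv : V2 → V2} {Du : V2 → M2} {D2v : V2 → M2}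
  {Du₁ D2v₁ : V2 × V2 → M2}

theorem lintegral_ofReal_Q2 {X : Type*} [MeasurableSpace X] {μ : Measure X} {m : ℕ} {l : Fin m → M2}
    (hl : ∀ G, Q2 W G = ∑ k, pairing (l k) G ^ 2) {G : X → M2}
    (hG : ∀ k, MemLp (fun p => pairing (l k) (G p)) 2 μ) {c : ℝ} (hc : 0 ≤ c) :
    ∫⁻ p, ENNReal.ofReal (c * Q2 W (G p)) ∂μ =
      ENNReal.ofReal (∑ k, c * ∫ p, pairing (l k) (G p) ^ 2 ∂μ) := by
  have hi : ∀ k, Integrable (fun p => c * pairing (l k) (G p) ^ 2) μ := fun k =>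
    (hG k).integrable_sq.const_mul c
  simp only [hl, Finset.mul_sum, ← integral_const_mul]
  rw [← integral_finsetSum _ fun k _ => hi k, ofReal_integral_eq_lintegral_ofReal
    (integrable_finsetSum _ fun k _ => hi k)
    (Eventually.of_forall fun p => Finset.sum_nonneg fun k _ => by positivity)]

/-- The two bending terms are recombined into one squared norm of the total curvature, the form in
which the duality argument produces it; this is where the orthogonality of `∇²v` and `∇_y² v₁`
enters. -/
theorem limitEnergy_eq {m : ℕ} {l : Fin m → M2} (hl : ∀ G, Q2 W G = ∑ k, pairing (l k) G ^ 2)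
    (hs : ∀ k, MemLp (fun p => pairing (l k) (strain θ Du Du₁ Dv D2v D2v₁ p)) 2
      (volume.restrict (ω ×ˢ cell)))
    {w : V2 × V2 → ℝ} {g : V2 × V2 → V2} (hw : IsL2Hdot2 ω w g D2v₁)
    (hD : ∀ i j, MemLp (fun x => D2v x i j) 2 (volume.restrict ω)) :
    limitEnergy W ω θ Du Du₁ Dv D2v D2v₁ = ENNReal.ofReal (∑ k,
      (1 / 2 * (∫ p in ω ×ˢ cell, pairing (l k) (strain θ Du Du₁ Dv D2v D2v₁ p) ^ 2) +
        1 / 24 * ∫ p in ω ×ˢ cell, pairing (l k) (D2v p.1 + D2v₁ p) ^ 2)) := by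
  have n1 : ∀ (c : ℝ) (G : V2 × V2 → M2), 0 ≤ c →
      0 ≤ ∑ k, c * ∫ p in ω ×ˢ cell, pairing (l k) (G p) ^ 2 := fun c G hc =>
    Finset.sum_nonneg fun k _ => mul_nonneg hc (integral_nonneg fun p => sq_nonneg _)
  have n2 : 0 ≤ ∑ k, 1 / 24 * ∫ x in ω, pairing (l k) (D2v x) ^ 2 :=
    Finset.sum_nonneg fun k _ => mul_nonneg (by norm_num) (integral_nonneg fun p => sq_nonneg _)
  rw [limitEnergy, lintegral_ofReal_Q2 hl hs (by norm_num),
    lintegral_ofReal_Q2 hl (fun k => memLp_pairing (l k) hw.memLp_hess) (by norm_num),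
    lintegral_ofReal_Q2 hl (fun k => memLp_pairing (l k) hD) (by norm_num),
    ← ENNReal.ofReal_add (n1 _ _ (by norm_num)) (n1 _ _ (by norm_num)),
    ← ENNReal.ofReal_add (add_nonneg (n1 _ _ (by norm_num)) (n1 _ _ (by norm_num))) n2,
    ← Finset.sum_add_distrib, ← Finset.sum_add_distrib]
  congr 1
  refine Finset.sum_congr rfl fun k _ => ?_
  rw [integral_sq_pairing_add hw hD]
  ring

end LimitEnergy

end WrinkledPlate

/-! ### The lower bound for the energies. -/

theorem corollary1
    -- the mid-plane, the shape function and the stored energy density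
    (ω : Set V2) (hω : IsOpen ω) (hωb : Bornology.IsBounded ω)
    (θ : V2 → ℝ) (hθ : ContDiff ℝ 2 θ) (hθp : IsPeriodic θ)
    (W : M3 → ℝ≥0∞) (hW : IsStoredEnergy W)
    -- a sequence of scales tending to zero
    (h : ℕ → ℝ) (hpos : ∀ n, 0 < h n) (hlim : Tendsto h atTop (𝓝 0))
    -- deformations of the shell, of class W^{1,2}, with their gradients
    (y : ℕ → V3 → V3) (Dy : ℕ → V3 → M3)
    (hy : ∀ n i, HasWeakGrad (shell ω θ (h n)) (fun x => y n x i) (fun x => Dy n x i))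
    -- fields of rotations, of class W^{1,2}, with their gradients
    (R : ℕ → V2 → M3) (DR : ℕ → V2 → Fin 3 → Fin 3 → V2)
    (hR : ∀ n, ∀ᵐ x ∂(volume.restrict ω), R n x ∈ SO3)
    (hDR : ∀ n i j, HasWeakGrad ω (fun x => R n x i j) (fun x => DR n x i j))
    -- constant rigid motions, by which the deformations are normalized
    (Rbar : ℕ → M3) (hRbar : ∀ n, Rbar n ∈ SO3) (c : ℕ → V3)
    -- the limit displacements u in W^{1,2} and v in W^{2,2}
    (u : V2 → V2) (Du : V2 → M2)
    (hu : ∀ β, HasWeakGrad ω (fun x => u x β) (fun x => Du x β))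
    (v : V2 → ℝ) (Dv : V2 → V2) (D2v : V2 → M2) (hv : HasWeakHess ω v Dv D2v)
    -- the correctors u₁ in L²(ω; Ḣ¹_#(Y))² and v₁ in L²(ω; Ḣ²_#(Y))
    (u₁ : V2 × V2 → V2) (Du₁ : V2 × V2 → M2)
    (hu₁ : ∀ β, IsL2Hdot1 ω (fun p => u₁ p β) (fun p => Du₁ p β))
    (v₁ : V2 × V2 → ℝ) (Dv₁ : V2 × V2 → V2) (D2v₁ : V2 × V2 → M2)
    (hv₁ : IsL2Hdot2 ω v₁ Dv₁ D2v₁)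
    -- the compactness convergences for the normalized deformations
    (A : V2 → M3)
    (hcomp : CompactSequence ω θ h (fun n x => (Rbar n).transpose.mulVec (y n x) - c n)
      (fun n x => (Rbar n).transpose * Dy n x) R DR u v Dv A)
    -- the gradients of the in-plane displacements u^h, and their two-scale limit
    (Duh : ℕ → V2 → M2)
    (hDuh : ∀ n β, HasWeakGrad ω
      (fun x => inPlane θ (h n) (fun z => (Rbar n).transpose.mulVec (y n z) - c n) (R n) x β)
      (fun x => Duh n x β))
    (hts_u : ∀ β α, TwoScale ω h (fun n x => Duh n x β α) (fun p => Du p.1 β α + Du₁ p β α))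
    -- the two-scale limit of the gradients of (R^h₁₃, R^h₂₃) / h²
    (hts_R : ∀ β α : Fin 2, TwoScale ω h (fun n x => (h n ^ 2)⁻¹ * DR n x β.castSucc 2 α)
      (fun p => -(D2v p.1 β α) - D2v₁ p β α)) :
    limitEnergy W ω θ Du Du₁ Dv D2v D2v₁
      ≤ liminf (fun n => energy W ω θ (h n) (Dy n)) atTop := by
  have hy' : ∀ᶠ n in atTop, ∀ i, HasWeakGrad (shell ω θ (h n))
      (fun x => ((Rbar n).transpose.mulVec (y n x) - c n) i)
      (fun x => ((Rbar n).transpose * Dy n x) i) := by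
    filter_upwards [eventually_goodScale hθ hθp hω hpos hlim] with n hg i
    exact HasWeakGrad.linear_combination (hg.volume_shell_ne_top hθ hωb) (hy n)
      (fun k => Rbar n k i) (c n i)
  obtain ⟨m, l, hls, hl, hup⟩ := hW.exists_Q2_eq_sum_sq
  have hs : ∀ k, MemLp (fun p => pairing (l k) (strain θ Du Du₁ Dv D2v D2v₁ p)) 2
      (volume.restrict (ω ×ˢ cell)) := fun k =>
    (memLp_pairing (l k) (memLp_rawStrain hθ hθp (fun β α => (hts_u β α).2.1)
      (fun β α => (hts_R β α).2.1) (fun i j => (hcomp.sym_limit i j).2.1))).ae_eq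
      (pairing_rawStrain (hls k) hcomp.A_eq)
  have hD : ∀ i j, MemLp (fun x => D2v x i j) 2 (volume.restrict ω) := fun i j =>
    (hv.hess i).memLp_grad j
  have hκ : ∀ k, MemLp (fun p : V2 × V2 => pairing (l k) (D2v p.1 + D2v₁ p)) 2
      (volume.restrict (ω ×ˢ cell)) := fun k =>
    memLp_pairing (l k) fun i j => (memLp_comp_fst (hD i j)).add (hv₁.memLp_hess i j)
  rw [limitEnergy_eq hl hs hv₁ hD]
  set J := ∑ k, (1 / 2 * (∫ p in ω ×ˢ cell, pairing (l k) (strain θ Du Du₁ Dv D2v D2v₁ p) ^ 2) +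
        1 / 24 * ∫ p in ω ×ˢ cell, pairing (l k) (D2v p.1 + D2v₁ p) ^ 2) with hJ
  -- Each form loses at most `η` through `ψ` and `η/12` through `χ`; the `2` is a convenient upper
  -- bound.
  have key : ∀ η : ℝ, 0 < η → ENNReal.ofReal (J - η * ∑ _k : Fin m, 2) ≤
      liminf (fun n => energy W ω θ (h n) (Dy n)) atTop := by
    intro η hη
    choose ψ hψ hψJ using fun k => exists_testFn_dual_ge hω hωb (hs k) hη
    -- The first moment converges to minus the curvature over `12`, so `χ` has to approximate the
    -- negative of the curvature form.
    choose χ hχ hχJ using fun k => exists_testFn_dual_ge hω hωb (hκ k).neg hη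
    refine le_trans (ENNReal.ofReal_le_ofReal ?_)
      (ofReal_dual_le_liminf_energy hω hωb hθ hθp hW hpos hlim hy' hR hDR hRbar hcomp hDuh hts_u hts_R
        hls hl hup hψ hχ)
    rw [hJ, Finset.mul_sum, ← Finset.sum_sub_distrib]
    refine Finset.sum_le_sum fun k _ => ?_
    have h1 := hψJ k
    have h2 := hχJ k
    simp only [Pi.neg_apply, neg_sq, neg_mul, integral_neg] at h2
    linarith
  have hlim0 : Tendsto (fun η : ℝ => ENNReal.ofReal (J - η * ∑ _k : Fin m, 2)) (𝓝[>] 0)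
      (𝓝 (ENNReal.ofReal (J - 0 * ∑ _k : Fin m, 2))) :=
    (ENNReal.tendsto_ofReal (Continuous.tendsto (by fun_prop) _)).mono_left nhdsWithin_le_nhds
  rw [zero_mul, sub_zero] at hlim0
  refine le_of_tendsto hlim0 ?_
  filter_upwards [self_mem_nhdsWithin] with η hη using key η hη
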